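/- Let $k$ be a field and let $B$ be a unital differential graded $k$-algebra, homologically graded and concentrated in non-negative degrees, which is quasi-free: there is a graded subspace $V\subseteq B$ such that the canonical map $TV\to B$ is an isomorphism of graded algebras (the differential of $B$ is arbitrary). Write $\otimes=\otimes_k$, $\bar B=B/k1$ and $B^e=B\otimes B^{op}$. All complexes below are total complexes of (first quadrant in the resolution direction) bicomplexes $M_p$, $p\ge 0$, of dg $k$-modules: an element of internal degree $m$ in column $p$ has total degree $p+m$, and the differential on column $p$ is $d_h+(-1)^p d_v$. If the $M_p$ are dg $B$-bimodules, $B$ acts on column $p$ of the total complex by $b\cdot x\cdot b'=(-1)^{p|b|}bxb'$. * The small resolution $S_*(B)$ has columns $S_0=B\otimes B$, $S_1=B\otimes V\otimes B$, $S_p=0$ for $p\ge2$, and $d_h(b\otimes v\otimes b')=bv\otimes b'-b\otimes vb'$. The internal differential of $S_1$ is that of the bimodule of Kähler differentials: $d_v(b\otimes v\otimes b')=db\otimes v\otimes b'+(-1)^{|b|}b\,D(dv)\,b'+(-1)^{|b|+|v|}b\otimes v\otimes db'$, where $D:B\to B\otimes V\otimes B$ is the derivation with $D(v)=1\otimes v\otimes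 1$ for $v\in V$. * The two-sided bar resolution $\mathsf{Bar}_*(B)$ has columns $B\otimes B^{\otimes p}\otimes B$, with $d_h(b_0\otimes\cdots\otimes b_{p+1})=\sum_{i=0}^{p}(-1)^i b_0\otimes\cdots\otimes b_ib_{i+1}\otimes\cdots\otimes b_{p+1}$ and $d_v$ the tensor product differential. The normalized two-sided bar resolution is its quotient with columns $B\otimes\bar B^{\otimes p}\otimes B$. * $\Theta_*(B)=B\otimes_{B^e}S_*(B)$ and $\mathcal X^*(B)=\hom_{B^e}(S_*(B),B)$, the complex of graded bimodule maps, where a map $f$ of cohomological degree $n$ lowers homological degree by $n$, satisfies $f(bx)=(-1)^{n|b|}bf(x)$, $f(xb)=f(x)b$, and has differential $d\circ f-(-1)^n f\circ d$. * The Hochschild chain complex $C_*(B)$ has columns $B\otimes\bar B^{\otimes p}$ with the tensor product differential as $d_v$ and $$d_h(b_0\otimes\cdots\otimes b_p)=\sum_{i=0}^{p-1}(-1)^i b_0\otimes\cdots\otimes b_ib_{i+1}\otimes\cdots\otimes b_p+(-1)^{p+|b_p|(|b_0|+\cdots+|b_{p-1}|)}\,b_pb_0\otimes b_1\otimes\cdots\otimes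 b_{p-1}.$$ * The Hochschild cochain complex $C^*(B)$ consists in degree $n$ of the families $(f_p)_{p\ge0}$ of maps $f_p:\bar B^{\otimes p}\to B$ of homological degree $p-n$. Its differential is $d_h+(-1)^pd_v$, where, for $f$ in column $p$ of internal cohomological degree $q=n-p$, $d_vf=d\circ f-(-1)^qf\circ d$ and $$(d_hf)(b_1\otimes\cdots\otimes b_{p+1})=(-1)^{q|b_1|}b_1f(b_2\otimes\cdots\otimes b_{p+1})+\sum_{i=1}^{p}(-1)^if(b_1\otimes\cdots\otimes b_ib_{i+1}\otimes\cdots\otimes b_{p+1})+(-1)^{p+1}f(b_1\otimes\cdots\otimes b_p)b_{p+1}.$$ Then there is a homotopy deformation retract $(i,\pi,h)$ of $\mathsf{Bar}_*(B)$ onto $S_*(B)$ in the category of dg $B$-bimodules, i.e. morphisms of dg bimodules $i:S_*(B)\to\mathsf{Bar}_*(B)$ and $\pi:\mathsf{Bar}_*(B)\to S_*(B)$ and a bimodule map $h$ of degree $1$ on $\mathsf{Bar}_*(B)$ (so $h(bx)=(-1)^{|b|}bh(x)$ and $h(xb)=h(x)b$) with $\pi i=1$ and $i\pi-1=dh+hd$,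 such that $\pi$ is the identity on the column $B\otimes B$, is zero on the columns $p\ge2$, and satisfies on the column $B\otimes B\otimes B$, for all $n\ge0$ and $v_1,\dots,v_n\in V$, $$\pi(1\otimes v_1\cdots v_n\otimes1)=\sum_{i=1}^n v_1\cdots v_{i-1}\otimes v_i\otimes v_{i+1}\cdots v_n .$$ The same holds with the normalized two-sided bar resolution in place of $\mathsf{Bar}_*(B)$. Moreover the chain complex $C_*(B)$ is homotopy equivalent to $\Theta_*(B)$, and the cochain complex $C^*(B)$ is homotopy equivalent to $\mathcal X^*(B)$ (as complexes of $k$-modules). -/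

import Mathlib

open scoped TensorProduct DirectSum

universe u

namespace DGHoch

section Grading

variable {k : Type u} [CommRing k] {M : Type u} [AddCommGroup M] [Module k M]
  {N : Type u} [AddCommGroup N] [Module k N]

/-- The decomposition of a graded module into its homogeneous components. -/
noncomputable def components (gr : ℤ → Submodule k M) (h : DirectSum.IsInternal gr) :
    M ≃ₗ[k] ⨁ n, gr n :=
  (LinearEquiv.ofBijective (DirectSum.coeLinearMap gr) h).symm

theorem components_of_mem {gr : ℤ → Submodule k M} (h : DirectSum.IsInternal gr) {n : ℤ} {x : M}
    (hx : x ∈ gr n) : components gr h x = DirectSum.lof k ℤ (fun n => gr n) n ⟨x, hx⟩ := by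
  refine (LinearEquiv.symm_apply_eq _).2 ?_
  exact (DirectSum.coeLinearMap_lof (A := gr) n ⟨x, hx⟩).symm

theorem homog_induction {gr : ℤ → Submodule k M} (h : DirectSum.IsInternal gr) {P : M → Prop}
    (h0 : P 0) (hadd : ∀ x y, P x → P y → P (x + y)) (hom : ∀ n, ∀ x ∈ gr n, P x) (x : M) :
    P x :=
  Submodule.iSup_induction gr (motive := P)
    (by rw [h.submodule_iSup_eq_top]; exact Submodule.mem_top) hom h0 hadd

theorem homog_ext {gr : ℤ → Submodule k M} (h : DirectSum.IsInternal gr) {f g : M →ₗ[k] N}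
    (hfg : ∀ n, ∀ x ∈ gr n, f x = g x) (x : M) : f x = g x :=
  homog_induction h (P := fun x => f x = g x) (by simp) (fun x y hx hy => by simp [hx, hy]) hfg x

/-- A criterion for a family of submodules to be a grading. -/
theorem isInternal_of_coaction {gr : ℤ → Submodule k M} (δ : M →ₗ[k] (ℤ →₀ M))
    (hδ : ∀ n, ∀ x ∈ gr n, δ x = Finsupp.single n x) (htop : ∀ x, x ∈ ⨆ n, gr n) :
    DirectSum.IsInternal gr := by
  have key : ∀ (x : ⨁ n, gr n) (n : ℤ), δ (DirectSum.coeLinearMap gr x) n = (x n : M) := by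
    intro x n
    induction x using DirectSum.induction_on with
    | zero => simp
    | of i x =>
      rw [DirectSum.coeLinearMap_of, hδ i x x.2]
      by_cases hin : i = n
      · subst hin; simp
      · rw [Finsupp.single_eq_of_ne (Ne.symm hin), DirectSum.of_eq_of_ne _ _ _ (Ne.symm hin)]; rfl
    | add x y hx hy => simp [hx, hy]
  constructor
  · intro x y hxy
    refine DFinsupp.ext fun n => Subtype.ext ?_
    have hxy' : DirectSum.coeLinearMap gr x = DirectSum.coeLinearMap gr y := hxy
    rw [← key x n, ← key y n, hxy']
  · intro x
    have : x ∈ LinearMap.range (DirectSum.coeLinearMap gr) := by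
      rw [DirectSum.range_coeLinearMap]; exact htop x
    exact this

/-- `x ↦ ∑ₙ n ⊗ xₙ`. -/
noncomputable def coaction (gr : ℤ → Submodule k M) (h : DirectSum.IsInternal gr) :
    M →ₗ[k] (ℤ →₀ M) :=
  (DirectSum.toModule k ℤ (ℤ →₀ M) fun n => (Finsupp.lsingle n).comp (gr n).subtype).comp
    (components gr h).toLinearMap

theorem coaction_of_mem {gr : ℤ → Submodule k M} (h : DirectSum.IsInternal gr) {n : ℤ} {x : M}
    (hx : x ∈ gr n) : coaction gr h x = Finsupp.single n x := by
  simp [coaction, components_of_mem h hx]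

/-- The Koszul twist: it multiplies a homogeneous element `x` by `(-1) ^ (q * |x|)`. -/
noncomputable def twist (gr : ℤ → Submodule k M) (h : DirectSum.IsInternal gr) (q : ℤ) :
    M →ₗ[k] M :=
  (DirectSum.toModule k ℤ M fun n => (((q * n).negOnePow : ℤˣ) : ℤ) • (gr n).subtype).comp
    (components gr h).toLinearMap

theorem twist_of_mem {gr : ℤ → Submodule k M} (h : DirectSum.IsInternal gr) (q : ℤ) {n : ℤ} {x : M}
    (hx : x ∈ gr n) : twist gr h q x = (((q * n).negOnePow : ℤˣ) : ℤ) • x := by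
  simp [twist, components_of_mem h hx]

theorem twist_mem {gr : ℤ → Submodule k M} (h : DirectSum.IsInternal gr) (q : ℤ) {n : ℤ} {x : M}
    (hx : x ∈ gr n) : twist gr h q x ∈ gr n := by
  rw [twist_of_mem h q hx]; exact zsmul_mem hx _

theorem twist_twist {gr : ℤ → Submodule k M} (h : DirectSum.IsInternal gr) (p q : ℤ) (x : M) :
    twist gr h p (twist gr h q x) = twist gr h (p + q) x := by
  refine homog_ext h (f := (twist gr h p).comp (twist gr h q)) (fun n x hx => ?_) x
  rw [LinearMap.comp_apply, twist_of_mem h q hx, map_zsmul, twist_of_mem h p hx,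
    twist_of_mem h _ hx, smul_smul, add_mul, add_comm, Int.negOnePow_add]
  simp

theorem twist_even {gr : ℤ → Submodule k M} (h : DirectSum.IsInternal gr) {q : ℤ} (hq : Even q)
    (x : M) : twist gr h q x = x := by
  refine homog_ext h (g := LinearMap.id) (fun n x hx => ?_) x
  rw [twist_of_mem h q hx, Int.negOnePow_even _ (hq.mul_right n)]
  simp

/-- A homogeneous map of degree `r` commutes with twists up to the sign `(-1) ^ (q * r)`. -/
theorem twist_map {gr : ℤ → Submodule k M} (h : DirectSum.IsInternal gr) {gr' : ℤ → Submodule k N}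
    (h' : DirectSum.IsInternal gr') {r : ℤ} {f : M →ₗ[k] N}
    (hf : ∀ n, ∀ x ∈ gr n, f x ∈ gr' (n + r)) (q : ℤ) (x : M) :
    twist gr' h' q (f x) = (((q * r).negOnePow : ℤˣ) : ℤ) • f (twist gr h q x) := by
  refine homog_ext h (f := (twist gr' h' q).comp f)
    (g := (((q * r).negOnePow : ℤˣ) : ℤ) • f.comp (twist gr h q)) (fun n x hx => ?_) x
  rw [LinearMap.comp_apply, twist_of_mem h' q (hf n x hx), LinearMap.smul_apply,
    LinearMap.comp_apply, twist_of_mem h q hx, map_zsmul, smul_smul, mul_add, add_comm,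
    Int.negOnePow_add]
  simp

theorem twist_map_zero {gr : ℤ → Submodule k M} (h : DirectSum.IsInternal gr)
    {gr' : ℤ → Submodule k N} (h' : DirectSum.IsInternal gr') {f : M →ₗ[k] N}
    (hf : ∀ n, ∀ x ∈ gr n, f x ∈ gr' n) (q : ℤ) (x : M) :
    twist gr' h' q (f x) = f (twist gr h q x) := by
  have := twist_map h h' (r := 0) (f := f) (fun n x hx => by simpa using hf n x hx) q x
  simpa using this

/-- The total grading on a tensor product. -/
def tensorGr (gr : ℤ → Submodule k M) (gr' : ℤ → Submodule k N) (n : ℤ) : Submodule k (M ⊗[k] N) :=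
  Submodule.span k {z | ∃ i j : ℤ, i + j = n ∧ ∃ x ∈ gr i, ∃ y ∈ gr' j, z = x ⊗ₜ[k] y}

theorem tmul_mem_tensorGr {gr : ℤ → Submodule k M} {gr' : ℤ → Submodule k N} {i j n : ℤ}
    (hn : i + j = n) {x : M} {y : N} (hx : x ∈ gr i) (hy : y ∈ gr' j) :
    x ⊗ₜ[k] y ∈ tensorGr gr gr' n :=
  Submodule.subset_span ⟨i, j, hn, x, hx, y, hy, rfl⟩

theorem tensorGr_induction {gr : ℤ → Submodule k M} {gr' : ℤ → Submodule k N} {n : ℤ}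
    {S : Submodule k (M ⊗[k] N)}
    (hS : ∀ i j, i + j = n → ∀ x ∈ gr i, ∀ y ∈ gr' j, x ⊗ₜ[k] y ∈ S) : tensorGr gr gr' n ≤ S := by
  refine Submodule.span_le.2 ?_
  rintro _ ⟨i, j, hn, x, hx, y, hy, rfl⟩
  exact hS i j hn x hx y hy

/-- Two linear maps on a tensor product agree if they agree on tensors of homogeneous elements. -/
theorem tensor_homog_induction {gr : ℤ → Submodule k M} (h : DirectSum.IsInternal gr)
    {gr' : ℤ → Submodule k N} (h' : DirectSum.IsInternal gr') {P : M ⊗[k] N → Prop}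
    (h0 : P 0) (hadd : ∀ x y, P x → P y → P (x + y))
    (hom : ∀ i j, ∀ x ∈ gr i, ∀ y ∈ gr' j, P (x ⊗ₜ[k] y)) (z : M ⊗[k] N) : P z := by
  induction z using TensorProduct.induction_on with
  | zero => exact h0
  | add x y hx hy => exact hadd x y hx hy
  | tmul x y =>
    refine homog_induction h (P := fun x => P (x ⊗ₜ[k] y)) (by simpa using h0)
      (fun a b ha hb => by rw [TensorProduct.add_tmul]; exact hadd _ _ ha hb) (fun i x hx => ?_) x
    refine homog_induction h' (P := fun y => P (x ⊗ₜ[k] y)) (by simpa using h0)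
      (fun a b ha hb => by rw [TensorProduct.tmul_add]; exact hadd _ _ ha hb) (fun j y hy => ?_) y
    exact hom i j x hx y hy

theorem tensorGr_internal {gr : ℤ → Submodule k M} (h : DirectSum.IsInternal gr)
    {gr' : ℤ → Submodule k N} (h' : DirectSum.IsInternal gr') :
    DirectSum.IsInternal (tensorGr gr gr') := by
  refine isInternal_of_coaction ((Finsupp.lmapDomain _ k fun p : ℤ × ℤ => p.1 + p.2).comp
    ((finsuppTensorFinsupp k k M N ℤ ℤ).toLinearMap.comp
      (TensorProduct.map (coaction gr h) (coaction gr' h')))) ?_ ?_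
  · intro n x hx
    refine Submodule.span_induction ?_ (by simp) (fun x y _ _ hx hy => by
      rw [map_add, hx, hy, Finsupp.single_add]) (fun a x _ hx => by
      rw [map_smul, hx, Finsupp.smul_single]) hx
    rintro _ ⟨i, j, rfl, x, hx, y, hy, rfl⟩
    simp [coaction_of_mem h hx, coaction_of_mem h' hy, Finsupp.mapDomain_single]
  · intro z
    refine tensor_homog_induction h h' (zero_mem _) (fun _ _ => add_mem) ?_ z
    intro i j x hx y hy
    exact Submodule.mem_iSup_of_mem (i + j) (tmul_mem_tensorGr rfl hx hy)

theorem twist_tmul {gr : ℤ → Submodule k M} (h : DirectSum.IsInternal gr)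
    {gr' : ℤ → Submodule k N} (h' : DirectSum.IsInternal gr') (q : ℤ) (x : M) (y : N) :
    twist (tensorGr gr gr') (tensorGr_internal h h') q (x ⊗ₜ[k] y) =
      twist gr h q x ⊗ₜ[k] twist gr' h' q y := by
  have : ∀ z, twist (tensorGr gr gr') (tensorGr_internal h h') q z =
      TensorProduct.map (twist gr h q) (twist gr' h' q) z := by
    intro z
    refine tensor_homog_induction h h' (P := fun z => twist (tensorGr gr gr')
      (tensorGr_internal h h') q z = TensorProduct.map (twist gr h q) (twist gr' h' q) z)
      (by simp) (fun a b ha hb => by rw [map_add, map_add, ha, hb])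
      (fun i j x hx y hy => ?_) z
    rw [twist_of_mem _ q (tmul_mem_tensorGr rfl hx hy), TensorProduct.map_tmul, twist_of_mem h q hx,
      twist_of_mem h' q hy, ← TensorProduct.smul_tmul', TensorProduct.tmul_smul, smul_smul, mul_add,
      Int.negOnePow_add, Units.val_mul]
  simpa using this (x ⊗ₜ[k] y)

/-- The Koszul symmetry `x ⊗ y ↦ (-1) ^ (|x| * |y|) y ⊗ x`. -/
noncomputable def braid (gr : ℤ → Submodule k M) (h : DirectSum.IsInternal gr)
    (gr' : ℤ → Submodule k N) (h' : DirectSum.IsInternal gr') : M ⊗[k] N →ₗ[k] N ⊗[k] M :=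
  TensorProduct.lift (LinearMap.flip
    ((DirectSum.toModule k ℤ (M →ₗ[k] N ⊗[k] M) fun j =>
      (LinearMap.lcomp k (N ⊗[k] M) (twist gr h j)).comp
        ((TensorProduct.mk k N M).comp (gr' j).subtype)).comp (components gr' h').toLinearMap))

theorem braid_tmul {gr : ℤ → Submodule k M} (h : DirectSum.IsInternal gr)
    {gr' : ℤ → Submodule k N} (h' : DirectSum.IsInternal gr') (x : M) {j : ℤ} {y : N}
    (hy : y ∈ gr' j) :
    braid gr h gr' h' (x ⊗ₜ[k] y) = y ⊗ₜ[k] twist gr h j x := by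
  simp [braid, components_of_mem h' hy]

end Grading

/-- A differential graded `k`-module, homologically graded by `ℤ`: a module which is the internal
direct sum of the submodules `gr n`, with a square-zero differential of degree `-1`. -/
structure DGMod (k : Type u) [CommRing k] where
  carrier : Type u
  [addCommGroup : AddCommGroup carrier]
  [module : Module k carrier]
  gr : ℤ → Submodule k carrier
  internal : DirectSum.IsInternal gr
  d : carrier →ₗ[k] carrier
  d_mem : ∀ n, ∀ x ∈ gr n, d x ∈ gr (n - 1)
  d_sq : ∀ x, d (d x) = 0

instance {k : Type u} [CommRing k] : CoeSort (DGMod k) (Type u) := ⟨DGMod.carrier⟩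

attribute [instance] DGMod.addCommGroup DGMod.module

namespace DGMod

variable {k : Type u} [CommRing k]

/-- The Koszul twist `x ↦ (-1) ^ (q * |x|) x`. -/
noncomputable def tw (M : DGMod k) (q : ℤ) : M →ₗ[k] M := twist M.gr M.internal q

theorem tw_of_mem (M : DGMod k) (q : ℤ) {n : ℤ} {x : M} (hx : x ∈ M.gr n) :
    M.tw q x = (((q * n).negOnePow : ℤˣ) : ℤ) • x := twist_of_mem M.internal q hx

theorem tw_mem (M : DGMod k) (q : ℤ) {n : ℤ} {x : M} (hx : x ∈ M.gr n) : M.tw q x ∈ M.gr n :=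
  twist_mem M.internal q hx

theorem tw_tw (M : DGMod k) (p q : ℤ) (x : M) : M.tw p (M.tw q x) = M.tw (p + q) x :=
  twist_twist M.internal p q x

theorem tw_even (M : DGMod k) {q : ℤ} (hq : Even q) (x : M) : M.tw q x = x :=
  twist_even M.internal hq x

theorem tw_congr (M : DGMod k) {p q : ℤ} (h : Even (p - q)) (x : M) : M.tw p x = M.tw q x := by
  have : M.tw p x = M.tw (p - q) (M.tw q x) := by rw [tw_tw, sub_add_cancel]
  rw [this, tw_even _ h]

theorem tw_d (M : DGMod k) (q : ℤ) (x : M) :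
    M.tw q (M.d x) = ((q.negOnePow : ℤˣ) : ℤ) • M.d (M.tw q x) := by
  have := twist_map M.internal M.internal (r := -1) (f := M.d)
    (fun n x hx => by simpa [sub_eq_add_neg] using M.d_mem n x hx) q x
  simpa [tw] using this

theorem tw_one_d (M : DGMod k) (x : M) : M.tw 1 (M.d x) = - M.d (M.tw 1 x) := by
  rw [tw_d]; simp

theorem d_tw (M : DGMod k) (q : ℤ) (x : M) :
    M.d (M.tw q x) = ((q.negOnePow : ℤˣ) : ℤ) • M.tw q (M.d x) := by
  rw [tw_d, smul_smul, ← Units.val_mul, Int.units_mul_self]; simp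

theorem tw_one_one (M : DGMod k) (x : M) : M.tw 1 (M.tw 1 x) = x := by
  rw [tw_tw, tw_even _ (by decide)]

/-- Morphisms of dg modules: linear maps of degree zero that commute with the differentials. -/
structure Hom (M N : DGMod k) where
  toLin : M →ₗ[k] N
  map_gr : ∀ n, ∀ x ∈ M.gr n, toLin x ∈ N.gr n
  map_d : ∀ x, toLin (M.d x) = N.d (toLin x)

theorem Hom.map_tw {M N : DGMod k} (f : Hom M N) (q : ℤ) (x : M) :
    f.toLin (M.tw q x) = N.tw q (f.toLin x) :=
  (twist_map_zero M.internal N.internal f.map_gr q x).symm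

/-- The ground ring, in degree zero. -/
noncomputable abbrev unit (k : Type u) [CommRing k] : DGMod k where
  carrier := k
  gr n := if n = 0 then ⊤ else ⊥
  internal := by
    refine isInternal_of_coaction (Finsupp.lsingle 0) (fun n x hx => ?_) (fun x => ?_)
    · by_cases hn : n = 0
      · subst hn; rfl
      · rw [if_neg hn, Submodule.mem_bot] at hx
        subst hx; simp
    · exact Submodule.mem_iSup_of_mem 0 (by simp)
  d := 0
  d_mem n x _ := by simp
  d_sq x := by simp

/-- The tensor product of dg modules, with `d (x ⊗ y) = d x ⊗ y + (-1) ^ |x| x ⊗ d y`. -/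
noncomputable abbrev tensor (M N : DGMod k) : DGMod k where
  carrier := M ⊗[k] N
  gr := tensorGr M.gr N.gr
  internal := tensorGr_internal M.internal N.internal
  d := TensorProduct.map M.d LinearMap.id + TensorProduct.map (M.tw 1) N.d
  d_mem n x hx := by
    have : tensorGr M.gr N.gr n ≤ (tensorGr M.gr N.gr (n - 1)).comap
        (TensorProduct.map M.d LinearMap.id + TensorProduct.map (M.tw 1) N.d) := by
      refine tensorGr_induction fun i j hn x hx y hy => ?_
      simp only [Submodule.mem_comap, LinearMap.add_apply, TensorProduct.map_tmul,
        LinearMap.id_coe, id_eq]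
      exact add_mem (tmul_mem_tensorGr (by omega) (M.d_mem i x hx) hy)
        (tmul_mem_tensorGr (by omega) (M.tw_mem 1 hx) (N.d_mem j y hy))
    exact this hx
  d_sq x := by
    induction x using TensorProduct.induction_on with
    | zero => simp
    | add x y hx hy => rw [map_add, map_add, hx, hy, add_zero]
    | tmul x y => simp [M.d_sq, N.d_sq, tw_one_d, TensorProduct.neg_tmul]

theorem tensor_d (M N : DGMod k) (x : M) (y : N) :
    (tensor M N).d (x ⊗ₜ[k] y) = M.d x ⊗ₜ[k] y + M.tw 1 x ⊗ₜ[k] N.d y := by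
  simp

theorem tensor_tw (M N : DGMod k) (q : ℤ) (x : M) (y : N) :
    (tensor M N).tw q (x ⊗ₜ[k] y) = M.tw q x ⊗ₜ[k] N.tw q y :=
  twist_tmul M.internal N.internal q x y

/-- The quotient of a dg module by the submodule spanned by a set of homogeneous elements whose
differentials lie in that submodule. -/
noncomputable abbrev quot (M : DGMod k) (s : Set M) (hs : ∀ x ∈ s, ∃ n, x ∈ M.gr n)
    (hd : ∀ x ∈ s, M.d x ∈ Submodule.span k s) : DGMod k where
  carrier := M ⧸ Submodule.span k s
  gr n := (M.gr n).map (Submodule.span k s).mkQ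
  internal := by
    have hc : Submodule.span k s ≤ LinearMap.ker
        ((Finsupp.mapRange.linearMap (α := ℤ) (Submodule.span k s).mkQ).comp
          (coaction M.gr M.internal)) := by
      refine Submodule.span_le.2 fun x hx => ?_
      obtain ⟨n, hn⟩ := hs x hx
      have h0 : (Submodule.span k s).mkQ x = 0 := by
        simpa using Submodule.subset_span hx
      simp only [SetLike.mem_coe, LinearMap.mem_ker, LinearMap.comp_apply,
        coaction_of_mem M.internal hn, Finsupp.mapRange.linearMap_apply, Finsupp.mapRange_single,
        h0, Finsupp.single_zero]
    refine isInternal_of_coaction ((Submodule.span k s).liftQ _ hc) ?_ ?_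
    · rintro n _ ⟨x, hx, rfl⟩
      rw [Submodule.mkQ_apply, Submodule.liftQ_apply, LinearMap.comp_apply,
        coaction_of_mem M.internal hx]
      simp
    · intro x
      obtain ⟨x, rfl⟩ := (Submodule.span k s).mkQ_surjective x
      refine homog_induction M.internal
        (P := fun x => (Submodule.span k s).mkQ x ∈ ⨆ n, (M.gr n).map (Submodule.span k s).mkQ)
        (by simp) (fun x y hx hy => by rw [map_add]; exact add_mem hx hy) (fun n x hx => ?_) x
      exact Submodule.mem_iSup_of_mem n ⟨x, hx, rfl⟩
  d := (Submodule.span k s).mapQ _ M.d (Submodule.span_le.2 hd)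
  d_mem n x hx := by
    obtain ⟨x, hx, rfl⟩ := hx
    exact ⟨M.d x, M.d_mem n x hx, rfl⟩
  d_sq x := by
    obtain ⟨x, rfl⟩ := (Submodule.span k s).mkQ_surjective x
    simp [M.d_sq]

/-- The grading of the total complex: an element of degree `m` in column `p` has total degree
`p + m`. -/
def totalGr (M : ℕ → DGMod k) (n : ℤ) : Submodule k (⨁ p, M p) :=
  ⨆ p : ℕ, ((M p).gr (n - p)).map (DirectSum.lof k ℕ (fun p => M p) p)

theorem lof_mem_totalGr {M : ℕ → DGMod k} {n m : ℤ} (p : ℕ) (hn : p + m = n) {x : M p}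
    (hx : x ∈ (M p).gr m) : DirectSum.lof k ℕ (fun p => M p) p x ∈ totalGr M n := by
  refine Submodule.mem_iSup_of_mem p ⟨x, ?_, rfl⟩
  have : n - p = m := by omega
  rwa [this]

theorem totalGr_induction {M : ℕ → DGMod k} {n : ℤ} {S : Submodule k (⨁ p, M p)}
    (hS : ∀ (p : ℕ) (m : ℤ), p + m = n → ∀ x ∈ (M p).gr m,
      DirectSum.lof k ℕ (fun p => M p) p x ∈ S) : totalGr M n ≤ S := by
  refine iSup_le fun p => ?_
  rintro _ ⟨x, hx, rfl⟩
  exact hS p _ (by omega) x hx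

theorem totalGr_internal (M : ℕ → DGMod k) : DirectSum.IsInternal (totalGr M) := by
  refine isInternal_of_coaction (DirectSum.toModule k ℕ (ℤ →₀ ⨁ p, M p) fun p =>
    (Finsupp.lmapDomain _ k fun m : ℤ => (p : ℤ) + m).comp
      ((Finsupp.mapRange.linearMap (α := ℤ) (DirectSum.lof k ℕ (fun p => M p) p)).comp
        (coaction (M p).gr (M p).internal))) ?_ ?_
  · intro n x hx
    refine LinearMap.mem_eqLocus.1 (totalGr_induction (S := LinearMap.eqLocus _
      (Finsupp.lsingle (R := k) n)) (fun p m hn x hx => ?_) hx)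
    rw [LinearMap.mem_eqLocus]
    simp [coaction_of_mem (M p).internal hx, hn, Finsupp.mapDomain_single]
  · intro x
    induction x using DirectSum.induction_on with
    | zero => exact zero_mem _
    | add x y hx hy => exact add_mem hx hy
    | of p x =>
      refine homog_induction (M p).internal
        (P := fun x => DirectSum.lof k ℕ (fun p => M p) p x ∈ ⨆ n, totalGr M n)
        (by simp) (fun x y hx hy => by rw [map_add]; exact add_mem hx hy) (fun n x hx => ?_) x
      exact Submodule.mem_iSup_of_mem (p + n) (lof_mem_totalGr p rfl hx)

/-- The horizontal part of the differential of a total complex. -/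
noncomputable def horiz (M : ℕ → DGMod k) (D : ∀ p, Hom (M (p + 1)) (M p)) :
    ∀ p, M p →ₗ[k] ⨁ p, M p
  | 0 => 0
  | p + 1 => (DirectSum.lof k ℕ (fun p => M p) p).comp (D p).toLin

/-- The differential of the total complex: `horizontal + (-1) ^ p vertical` on column `p`. -/
noncomputable def totalD (M : ℕ → DGMod k) (D : ∀ p, Hom (M (p + 1)) (M p)) :
    (⨁ p, M p) →ₗ[k] ⨁ p, M p :=
  DirectSum.toModule k ℕ _ fun p =>
    horiz M D p + (-1 : ℤ) ^ p • (DirectSum.lof k ℕ (fun p => M p) p).comp (M p).d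

theorem totalD_lof (M : ℕ → DGMod k) (D : ∀ p, Hom (M (p + 1)) (M p)) (p : ℕ) (x : M p) :
    totalD M D (DirectSum.lof k ℕ (fun p => M p) p x) =
      horiz M D p x + (-1 : ℤ) ^ p • DirectSum.lof k ℕ (fun p => M p) p ((M p).d x) := by
  simp [totalD]

/-- The (direct sum) total complex of a complex `⋯ → M 2 → M 1 → M 0` of dg modules. -/
noncomputable abbrev total (M : ℕ → DGMod k) (D : ∀ p, Hom (M (p + 1)) (M p))
    (hD : ∀ p x, (D p).toLin ((D (p + 1)).toLin x) = 0) : DGMod k where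
  carrier := ⨁ p, M p
  gr := totalGr M
  internal := totalGr_internal M
  d := totalD M D
  d_mem n x hx := by
    have : totalGr M n ≤ (totalGr M (n - 1)).comap (totalD M D) := by
      refine totalGr_induction fun p m hn x hx => ?_
      rw [Submodule.mem_comap, totalD_lof]
      refine add_mem ?_ (zsmul_mem (lof_mem_totalGr p (by omega) ((M p).d_mem m x hx)) _)
      cases p with
      | zero => exact zero_mem _
      | succ p => exact lof_mem_totalGr p (by push_cast at hn; omega) ((D p).map_gr m x hx)
    exact this hx
  d_sq x := by
    induction x using DirectSum.induction_on with
    | zero => simp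
    | add x y hx hy => rw [map_add, map_add, hx, hy, add_zero]
    | of p x =>
      change totalD M D (totalD M D (DirectSum.lof k ℕ (fun p => M p) p x)) = 0
      rw [totalD_lof, map_add, map_zsmul, totalD_lof, (M p).d_sq]
      rcases p with _ | _ | p
      · simp [horiz]
      · simp [horiz, totalD_lof, (D 0).map_d]
      · simp only [horiz, LinearMap.comp_apply, totalD_lof, hD, (D (p + 1)).map_d, map_zero,
          zero_add, smul_zero, add_zero, ← add_smul, pow_succ]
        simp

/-- The chain complex of homogeneous parts of a dg module. -/
noncomputable def toComplex (M : DGMod k) : ChainComplex (ModuleCat.{u} k) ℤ :=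
  ChainComplex.of (fun n => ModuleCat.of k (M.gr n))
    (fun n => ModuleCat.ofHom (M.d.restrict fun x hx => by
      simpa using M.d_mem (n + 1) x hx))
    (fun n => by
      ext x
      exact M.d_sq x.1)

end DGMod

namespace DGMod

variable {k : Type u} [CommRing k]

namespace Hom

/-- Composition of morphisms. -/
noncomputable def comp {M N P : DGMod k} (g : Hom N P) (f : Hom M N) : Hom M P where
  toLin := g.toLin.comp f.toLin
  map_gr n x hx := g.map_gr n _ (f.map_gr n x hx)
  map_d x := by simp [f.map_d, g.map_d]

/-- Difference of morphisms. -/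
noncomputable def sub {M N : DGMod k} (f g : Hom M N) : Hom M N where
  toLin := f.toLin - g.toLin
  map_gr n x hx := sub_mem (f.map_gr n x hx) (g.map_gr n x hx)
  map_d x := by simp [f.map_d, g.map_d]

/-- `x ⊗ y ↦ x ⊗ f y`. -/
noncomputable def lTensor (P : DGMod k) {M N : DGMod k} (f : Hom M N) :
    Hom (tensor P M) (tensor P N) where
  toLin := f.toLin.lTensor P
  map_gr n x hx := by
    have : tensorGr P.gr M.gr n ≤ (tensorGr P.gr N.gr n).comap (f.toLin.lTensor P) :=
      tensorGr_induction fun i j hn x hx y hy => tmul_mem_tensorGr hn hx (f.map_gr j y hy)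
    exact this hx
  map_d x := by
    induction x using TensorProduct.induction_on with
    | zero => simp
    | add x y hx hy => rw [map_add, map_add, hx, hy, ← map_add, ← map_add]
    | tmul x y => simp [f.map_d]

/-- `x ⊗ y ↦ f x ⊗ y`. -/
noncomputable def rTensor (P : DGMod k) {M N : DGMod k} (f : Hom M N) :
    Hom (tensor M P) (tensor N P) where
  toLin := f.toLin.rTensor P
  map_gr n x hx := by
    have : tensorGr M.gr P.gr n ≤ (tensorGr N.gr P.gr n).comap (f.toLin.rTensor P) :=
      tensorGr_induction fun i j hn x hx y hy => tmul_mem_tensorGr hn (f.map_gr i x hx) hy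
    exact this hx
  map_d x := by
    induction x using TensorProduct.induction_on with
    | zero => simp
    | add x y hx hy => rw [map_add, map_add, hx, hy, ← map_add, ← map_add]
    | tmul x y => simp [f.map_d, f.map_tw]

/-- `x ⊗ (y ⊗ z) ↦ (x ⊗ y) ⊗ z`. -/
noncomputable def assocInv (M N P : DGMod k) :
    Hom (tensor M (tensor N P)) (tensor (tensor M N) P) where
  toLin := (TensorProduct.assoc k M N P).symm.toLinearMap
  map_gr n x hx := by
    have : tensorGr M.gr (tensorGr N.gr P.gr) n ≤ (tensorGr (tensorGr M.gr N.gr) P.gr n).comap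
        (TensorProduct.assoc k M N P).symm.toLinearMap := by
      refine tensorGr_induction fun i j hn x hx y hy => ?_
      have h2 : tensorGr N.gr P.gr j ≤ (tensorGr (tensorGr M.gr N.gr) P.gr n).comap
          ((TensorProduct.assoc k M N P).symm.toLinearMap.comp (TensorProduct.mk k M _ x)) :=
        tensorGr_induction fun a b hab y hy z hz =>
          tmul_mem_tensorGr (i := i + a) (j := b) (by omega) (tmul_mem_tensorGr rfl hx hy) hz
      exact h2 hy
    exact this hx
  map_d x := by
    induction x using TensorProduct.induction_on with
    | zero => simp
    | add x y hx hy => rw [map_add, map_add, hx, hy, ← map_add, ← map_add]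
    | tmul x y =>
      induction y using TensorProduct.induction_on with
      | zero => simp
      | add y z hy hz => rw [TensorProduct.tmul_add, map_add, map_add, hy, hz, ← map_add, ← map_add]
      | tmul y z =>
        simp only [LinearMap.add_apply, TensorProduct.map_tmul, LinearMap.id_coe, id_eq,
          TensorProduct.tmul_add, map_add, LinearEquiv.coe_coe, TensorProduct.assoc_symm_tmul,
          TensorProduct.add_tmul]
        rw [add_assoc]
        refine congrArg₂ _ rfl (congrArg₂ _ rfl ?_)
        exact congrArg (fun u => u ⊗ₜ[k] P.d z) (tensor_tw M N 1 x y).symm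

/-- The Koszul symmetry `x ⊗ y ↦ (-1) ^ (|x| * |y|) y ⊗ x`. -/
noncomputable def swap (M N : DGMod k) : Hom (tensor M N) (tensor N M) where
  toLin := braid M.gr M.internal N.gr N.internal
  map_gr n x hx := by
    have : tensorGr M.gr N.gr n ≤ (tensorGr N.gr M.gr n).comap
        (braid M.gr M.internal N.gr N.internal) := by
      refine tensorGr_induction fun i j hn x hx y hy => ?_
      rw [Submodule.mem_comap, braid_tmul _ _ _ hy]
      exact tmul_mem_tensorGr (by omega) hy (M.tw_mem j hx)
    exact this hx
  map_d z := by
    refine tensor_homog_induction M.internal N.internal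
      (P := fun z => braid M.gr M.internal N.gr N.internal ((tensor M N).d z) =
        (tensor N M).d (braid M.gr M.internal N.gr N.internal z)) (by simp)
      (fun x y hx hy => by rw [map_add, map_add, hx, hy, ← map_add, ← map_add])
      (fun i j x hx y hy => ?_) z
    rw [tensor_d, map_add, braid_tmul _ _ _ hy, braid_tmul _ _ _ hy,
      braid_tmul _ _ _ (N.d_mem j y hy)]
    change _ + N.d y ⊗ₜ[k] M.tw (j - 1) (M.tw 1 x) = (tensor N M).d (y ⊗ₜ[k] M.tw j x)
    rw [tensor_d, tw_tw, sub_add_cancel, d_tw, N.tw_of_mem 1 hy, ← TensorProduct.smul_tmul',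
      TensorProduct.tmul_smul, smul_smul, one_mul, ← Units.val_mul, Int.units_mul_self,
      Units.val_one, one_smul, add_comm]
    rfl

theorem swap_tmul (M N : DGMod k) (x : M) {j : ℤ} {y : N} (hy : y ∈ N.gr j) :
    (swap M N).toLin (x ⊗ₜ[k] y) = y ⊗ₜ[k] M.tw j x :=
  braid_tmul _ _ _ hy

end Hom

end DGMod

/-- A (unital, associative) differential graded `k`-algebra, homologically graded, with
`d (x y) = (d x) y + (-1) ^ |x| x (d y)`. -/
structure DGAlgebra (k : Type u) [CommRing k] where
  carrier : Type u
  [ring : Ring carrier]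
  [algebra : Algebra k carrier]
  gr : ℤ → Submodule k carrier
  internal : DirectSum.IsInternal gr
  one_mem : (1 : carrier) ∈ gr 0
  mul_mem : ∀ m n, ∀ x ∈ gr m, ∀ y ∈ gr n, x * y ∈ gr (m + n)
  d : carrier →ₗ[k] carrier
  d_mem : ∀ n, ∀ x ∈ gr n, d x ∈ gr (n - 1)
  d_sq : ∀ x, d (d x) = 0
  leibniz : ∀ x y, d (x * y) = d x * y + twist gr internal 1 x * d y

instance {k : Type u} [CommRing k] : CoeSort (DGAlgebra k) (Type u) := ⟨DGAlgebra.carrier⟩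

attribute [instance] DGAlgebra.ring DGAlgebra.algebra

namespace DGAlgebra

variable {k : Type u} [CommRing k]

/-- The underlying dg module of a dg algebra. -/
abbrev toMod (A : DGAlgebra k) : DGMod k where
  carrier := A
  gr := A.gr
  internal := A.internal
  d := A.d
  d_mem := A.d_mem
  d_sq := A.d_sq

theorem leibniz' (A : DGAlgebra k) (x y : A) :
    A.d (x * y) = A.d x * y + A.toMod.tw 1 x * A.d y := A.leibniz x y

theorem tw_one_elem (A : DGAlgebra k) (q : ℤ) : A.toMod.tw q (1 : A) = 1 := by
  rw [A.toMod.tw_of_mem q A.one_mem]; simp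

theorem tw_mul (A : DGAlgebra k) (q : ℤ) (x y : A) :
    A.toMod.tw q (x * y) = A.toMod.tw q x * A.toMod.tw q y := by
  refine homog_induction A.internal
    (P := fun x => A.toMod.tw q (x * y) = A.toMod.tw q x * A.toMod.tw q y) (by simp)
    (fun a b ha hb => by rw [add_mul, map_add, ha, hb, map_add, add_mul]) (fun i x hx => ?_) x
  refine homog_induction A.internal
    (P := fun y => A.toMod.tw q (x * y) = A.toMod.tw q x * A.toMod.tw q y) (by simp)
    (fun a b ha hb => by rw [mul_add, map_add, ha, hb, map_add, mul_add]) (fun j y hy => ?_) y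
  rw [A.toMod.tw_of_mem q (A.mul_mem i j x hx y hy), A.toMod.tw_of_mem q hx,
    A.toMod.tw_of_mem q hy, smul_mul_smul_comm, mul_add, Int.negOnePow_add, Units.val_mul]

theorem d_one (A : DGAlgebra k) : A.d 1 = 0 := by
  have h := A.leibniz' 1 1
  rw [tw_one_elem, mul_one, one_mul, mul_one] at h
  simpa using h

open DGMod

/-- Multiplication as a morphism of dg modules. -/
noncomputable def mulHom (A : DGAlgebra k) : Hom (tensor A.toMod A.toMod) A.toMod where
  toLin := LinearMap.mul' k A
  map_gr n x hx := by
    have : tensorGr A.gr A.gr n ≤ (A.gr n).comap (LinearMap.mul' k A) :=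
      tensorGr_induction fun i j hn x hx y hy => by
        rw [Submodule.mem_comap, LinearMap.mul'_apply, ← hn]; exact A.mul_mem i j x hx y hy
    exact this hx
  map_d x := by
    induction x using TensorProduct.induction_on with
    | zero => simp
    | add x y hx hy => rw [map_add, map_add, hx, hy, ← map_add, ← map_add]
    | tmul x y => simp [A.leibniz']

/-- `x ↦ 1 ⊗ x`. -/
noncomputable def oneTmul (A : DGAlgebra k) (M : DGMod k) : Hom M (tensor A.toMod M) where
  toLin := TensorProduct.mk k A M 1
  map_gr n x hx := tmul_mem_tensorGr (zero_add n) A.one_mem hx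
  map_d x := by simp [A.d_one, A.tw_one_elem]

/-- `x ↦ x ⊗ 1`. -/
noncomputable def tmulOne (A : DGAlgebra k) (M : DGMod k) : Hom M (tensor M A.toMod) where
  toLin := (TensorProduct.mk k M A).flip 1
  map_gr n x hx := tmul_mem_tensorGr (add_zero n) hx A.one_mem
  map_d x := by simp [A.d_one]

/-- Multiplication on the first factor, `a ⊗ (x ⊗ m) ↦ (a x) ⊗ m`. -/
noncomputable def mulFirst (A : DGAlgebra k) (M : DGMod k) :
    Hom (tensor A.toMod (tensor A.toMod M)) (tensor A.toMod M) :=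
  (A.mulHom.rTensor M).comp (Hom.assocInv A.toMod A.toMod M)

theorem mulFirst_tmul (A : DGAlgebra k) (M : DGMod k) (a x : A) (m : M) :
    (A.mulFirst M).toLin (a ⊗ₜ[k] (x ⊗ₜ[k] m)) = (a * x) ⊗ₜ[k] m := by
  simp [mulFirst, Hom.comp, Hom.rTensor, Hom.assocInv, mulHom]

end DGAlgebra

/-- A dg bimodule over a dg algebra `A`; `l a x` is `a x` and `r a x` is `x a`. -/
structure DGBimod {k : Type u} [CommRing k] (A : DGAlgebra k) extends DGMod k where
  l : A →ₗ[k] carrier →ₗ[k] carrier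
  r : A →ₗ[k] carrier →ₗ[k] carrier
  l_one : ∀ x, l 1 x = x
  r_one : ∀ x, r 1 x = x
  l_mul : ∀ a b x, l (a * b) x = l a (l b x)
  r_mul : ∀ a b x, r (a * b) x = r b (r a x)
  l_r : ∀ a b x, l a (r b x) = r b (l a x)
  l_mem : ∀ m n, ∀ a ∈ A.gr m, ∀ x ∈ gr n, l a x ∈ gr (m + n)
  r_mem : ∀ m n, ∀ a ∈ A.gr m, ∀ x ∈ gr n, r a x ∈ gr (n + m)
  d_l : ∀ a x, d (l a x) = l (A.d a) x + l (A.toMod.tw 1 a) (d x)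
  d_r : ∀ a x, d (r a x) = r a (d x) + r (A.d a) (twist gr internal 1 x)

namespace DGBimod

open DGMod

variable {k : Type u} [CommRing k] {A : DGAlgebra k}

instance : CoeSort (DGBimod A) (Type u) := ⟨fun M => M.carrier⟩

/-- Morphisms of dg bimodules. -/
structure Hom (M N : DGBimod A) extends DGMod.Hom M.toDGMod N.toDGMod where
  map_l : ∀ a x, toLin (M.l a x) = N.l a (toLin x)
  map_r : ∀ a x, toLin (M.r a x) = N.r a (toLin x)

theorem d_r' (M : DGBimod A) (a : A) (x : M) :
    M.d (M.r a x) = M.r a (M.d x) + M.r (A.d a) (M.tw 1 x) := M.d_r a x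

theorem tw_l (M : DGBimod A) (q : ℤ) (a : A) (x : M) :
    M.tw q (M.l a x) = M.l (A.toMod.tw q a) (M.tw q x) := by
  refine homog_induction A.internal
    (P := fun a => M.tw q (M.l a x) = M.l (A.toMod.tw q a) (M.tw q x)) (by simp)
    (fun a b ha hb => by simp [ha, hb]) (fun i a ha => ?_) a
  refine homog_induction M.internal
    (P := fun x => M.tw q (M.l a x) = M.l (A.toMod.tw q a) (M.tw q x)) (by simp)
    (fun x y hx hy => by simp [hx, hy]) (fun j x hx => ?_) x
  rw [M.tw_of_mem q (M.l_mem i j a ha x hx), A.toMod.tw_of_mem q ha, M.tw_of_mem q hx,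
    map_zsmul, map_zsmul, LinearMap.smul_apply, smul_smul, mul_add, add_comm, Int.negOnePow_add,
    Units.val_mul]

theorem tw_r (M : DGBimod A) (q : ℤ) (a : A) (x : M) :
    M.tw q (M.r a x) = M.r (A.toMod.tw q a) (M.tw q x) := by
  refine homog_induction A.internal
    (P := fun a => M.tw q (M.r a x) = M.r (A.toMod.tw q a) (M.tw q x)) (by simp)
    (fun a b ha hb => by simp [ha, hb]) (fun i a ha => ?_) a
  refine homog_induction M.internal
    (P := fun x => M.tw q (M.r a x) = M.r (A.toMod.tw q a) (M.tw q x)) (by simp)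
    (fun x y hx hy => by simp [hx, hy]) (fun j x hx => ?_) x
  rw [M.tw_of_mem q (M.r_mem i j a ha x hx), A.toMod.tw_of_mem q ha, M.tw_of_mem q hx,
    map_zsmul, map_zsmul, LinearMap.smul_apply, smul_smul, mul_add, Int.negOnePow_add,
    Units.val_mul]

theorem free_induction {W : DGMod k} {P : A ⊗[k] (W ⊗[k] A) → Prop} (zero : P 0)
    (add : ∀ x y, P x → P y → P (x + y)) (tmul : ∀ x w y, P (x ⊗ₜ[k] (w ⊗ₜ[k] y)))
    (z : A ⊗[k] (W ⊗[k] A)) : P z := by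
  induction z using TensorProduct.induction_on with
  | zero => exact zero
  | add x y hx hy => exact add x y hx hy
  | tmul x z =>
    induction z using TensorProduct.induction_on with
    | zero => simpa using zero
    | add y z hy hz => rw [TensorProduct.tmul_add]; exact add _ _ hy hz
    | tmul w y => exact tmul x w y

theorem free_gr_induction {W : DGMod k} {n : ℤ} {S : Submodule k (A ⊗[k] (W ⊗[k] A))}
    (hS : ∀ i j m, i + (j + m) = n → ∀ x ∈ A.gr i, ∀ w ∈ W.gr j, ∀ y ∈ A.gr m,
      x ⊗ₜ[k] (w ⊗ₜ[k] y) ∈ S) : tensorGr A.gr (tensorGr W.gr A.gr) n ≤ S := by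
  refine tensorGr_induction fun i j hn x hx y hy => ?_
  have h2 : tensorGr W.gr A.gr j ≤ S.comap (TensorProduct.mk k A _ x) :=
    tensorGr_induction fun a b hab w hw y hy => hS i a b (by omega) x hx w hw y hy
  exact h2 hy

/-- The free bimodule `A ⊗ W ⊗ A` on a dg module `W`. -/
noncomputable abbrev free (A : DGAlgebra k) (W : DGMod k) : DGBimod A where
  toDGMod := tensor A.toMod (tensor W A.toMod)
  l := (LinearMap.rTensorHom _).comp (LinearMap.mul k A)
  r := (LinearMap.lTensorHom _).comp ((LinearMap.lTensorHom _).comp (LinearMap.mul k A).flip)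
  l_one x := by
    induction x using free_induction with
    | zero => simp
    | add x y hx hy => rw [map_add, hx, hy]
    | tmul x w y =>
      simp
  r_one x := by
    induction x using free_induction with
    | zero => simp
    | add x y hx hy => rw [map_add, hx, hy]
    | tmul x w y =>
      simp
  l_mul a b x := by
    induction x using free_induction with
    | zero => simp
    | add x y hx hy => rw [map_add, map_add, map_add, hx, hy]
    | tmul x w y =>
      simp [mul_assoc]
  r_mul a b x := by
    induction x using free_induction with
    | zero => simp
    | add x y hx hy => rw [map_add, map_add, map_add, hx, hy]
    | tmul x w y =>
      simp [mul_assoc]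
  l_r a b x := by
    induction x using free_induction with
    | zero => simp
    | add x y hx hy => rw [map_add, map_add, map_add, map_add, hx, hy]
    | tmul x w y =>
      simp
  l_mem m n a ha x hx := by
    have : tensorGr A.gr (tensorGr W.gr A.gr) n ≤
        (tensorGr A.gr (tensorGr W.gr A.gr) (m + n)).comap
          ((LinearMap.mul k A a).rTensor (W ⊗[k] A)) :=
      free_gr_induction fun i j p hn x hx w hw y hy =>
        tmul_mem_tensorGr (i := m + i) (j := j + p) (by omega) (A.mul_mem m i a ha x hx)
          (tmul_mem_tensorGr rfl hw hy)
    exact this hx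
  r_mem m n a ha x hx := by
    have : tensorGr A.gr (tensorGr W.gr A.gr) n ≤
        (tensorGr A.gr (tensorGr W.gr A.gr) (n + m)).comap
          ((((LinearMap.mul k A).flip a).lTensor W).lTensor A) :=
      free_gr_induction fun i j p hn x hx w hw y hy =>
        tmul_mem_tensorGr (i := i) (j := j + (p + m)) (by omega) hx
          (tmul_mem_tensorGr rfl hw (A.mul_mem p m y hy a ha))
    exact this hx
  d_l a x := by
    induction x using free_induction with
    | zero => simp
    | add x y hx hy => simp only [map_add] at hx hy ⊢; rw [hx, hy]; abel
    | tmul x w y =>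
      simp only [LinearMap.comp_apply, LinearMap.coe_rTensorHom, LinearMap.rTensor_tmul,
        LinearMap.mul_apply', LinearMap.add_apply, TensorProduct.map_tmul, LinearMap.id_coe, id_eq,
        map_add, A.leibniz', A.tw_mul, TensorProduct.add_tmul]
      abel
  d_r a x := by
    induction x using free_induction with
    | zero => simp
    | add x y hx hy => simp only [map_add] at hx hy ⊢; rw [hx, hy]; abel
    | tmul x w y =>
      change _ = _ + (((LinearMap.mul k A).flip (A.d a)).lTensor W).lTensor A
        ((tensor A.toMod (tensor W A.toMod)).tw 1 (x ⊗ₜ[k] (w ⊗ₜ[k] y)))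
      rw [tensor_tw, tensor_tw]
      simp only [LinearMap.comp_apply, LinearMap.coe_lTensorHom, LinearMap.lTensor_tmul,
        LinearMap.mul_apply', LinearMap.flip_apply, LinearMap.add_apply, TensorProduct.map_tmul,
        LinearMap.id_coe, id_eq, map_add, A.leibniz', TensorProduct.tmul_add]
      abel

theorem free_l (W : DGMod k) (a x : A) (z : W ⊗[k] A) :
    (free A W).l a (x ⊗ₜ[k] z) = (a * x) ⊗ₜ[k] z := rfl

theorem free_r (W : DGMod k) (a x : A) (w : W) (y : A) :
    (free A W).r a (x ⊗ₜ[k] (w ⊗ₜ[k] y)) = x ⊗ₜ[k] (w ⊗ₜ[k] (y * a)) := rfl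

theorem free_d (W : DGMod k) (x : A) (w : W) (y : A) :
    (free A W).d (x ⊗ₜ[k] (w ⊗ₜ[k] y)) = A.d x ⊗ₜ[k] (w ⊗ₜ[k] y) +
      A.toMod.tw 1 x ⊗ₜ[k] (W.d w ⊗ₜ[k] y + W.tw 1 w ⊗ₜ[k] A.d y) := by
  simp

/-- The bimodule map `x ⊗ w ⊗ y ↦ x g(w) y` on underlying modules. -/
noncomputable def extendLin {W : DGMod k} (N : DGBimod A) (g : W →ₗ[k] N) :
    A ⊗[k] (W ⊗[k] A) →ₗ[k] N :=
  TensorProduct.lift (LinearMap.flip ((LinearMap.flip N.l).comp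
    (TensorProduct.lift (LinearMap.flip (N.r.compl₂ g))))).flip.flip

theorem extendLin_tmul {W : DGMod k} (N : DGBimod A) (g : W →ₗ[k] N) (x : A) (w : W) (y : A) :
    extendLin N g (x ⊗ₜ[k] (w ⊗ₜ[k] y)) = N.l x (N.r y (g w)) := by
  simp [extendLin]

/-- The bimodule morphism `x ⊗ w ⊗ y ↦ x g(w) y` extending a morphism of dg modules `g`. -/
noncomputable def extend {W : DGMod k} (N : DGBimod A) (g : DGMod.Hom W N.toDGMod) :
    Hom (free A W) N where
  toLin := extendLin N g.toLin
  map_gr n x hx := by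
    have : tensorGr A.gr (tensorGr W.gr A.gr) n ≤ (N.gr n).comap (extendLin N g.toLin) := by
      refine free_gr_induction fun i j p hn x hx w hw y hy => ?_
      rw [Submodule.mem_comap, extendLin_tmul, ← hn]
      exact N.l_mem _ _ _ hx _ (N.r_mem _ _ _ hy _ (g.map_gr _ _ hw))
    exact this hx
  map_d x := by
    induction x using free_induction with
    | zero => simp
    | add x y hx hy => simp only [map_add] at hx hy ⊢; rw [hx, hy]
    | tmul x w y =>
      rw [free_d]
      simp only [map_add, TensorProduct.tmul_add, extendLin_tmul, N.d_l, N.d_r', g.map_d, g.map_tw]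
  map_l a x := by
    induction x using free_induction with
    | zero => simp
    | add x y hx hy => simp only [map_add] at hx hy ⊢; rw [hx, hy]
    | tmul x w y =>
      rw [free_l, extendLin_tmul, extendLin_tmul, N.l_mul]
  map_r a x := by
    induction x using free_induction with
    | zero => simp
    | add x y hx hy => simp only [map_add] at hx hy ⊢; rw [hx, hy]
    | tmul x w y =>
      rw [free_r, extendLin_tmul, extendLin_tmul, N.r_mul, N.l_r]

/-- The left action on the total complex of a complex of dg bimodules: passing `a` through the `p`
suspensions of column `p` gives the sign `(-1) ^ (p * |a|)`. -/
noncomputable def totalL (M : ℕ → DGBimod A) :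
    A →ₗ[k] (⨁ p, (M p).toDGMod) →ₗ[k] ⨁ p, (M p).toDGMod :=
  LinearMap.flip (DirectSum.toModule k ℕ _ fun p =>
    (((M p).l.comp (A.toMod.tw p)).flip).compr₂
      (DirectSum.lof k ℕ (fun p => (M p).toDGMod) p))

/-- The right action on the total complex of a complex of dg bimodules. -/
noncomputable def totalR (M : ℕ → DGBimod A) :
    A →ₗ[k] (⨁ p, (M p).toDGMod) →ₗ[k] ⨁ p, (M p).toDGMod :=
  LinearMap.flip (DirectSum.toModule k ℕ _ fun p =>
    ((M p).r.flip).compr₂ (DirectSum.lof k ℕ (fun p => (M p).toDGMod) p))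

/-- The element `x` of column `p` inside the total complex. -/
noncomputable abbrev col (M : ℕ → DGBimod A) (p : ℕ) :
    (M p).toDGMod →ₗ[k] ⨁ p, (M p).toDGMod :=
  DirectSum.lof k ℕ (fun p => (M p).toDGMod) p

theorem totalL_col (M : ℕ → DGBimod A) (p : ℕ) (a : A) (x : M p) :
    totalL M a (col M p x) = col M p ((M p).l (A.toMod.tw p a) x) := by
  simp [totalL]

theorem totalR_col (M : ℕ → DGBimod A) (p : ℕ) (a : A) (x : M p) :
    totalR M a (col M p x) = col M p ((M p).r a x) := by
  simp [totalR]

theorem total_induction {M : ℕ → DGBimod A} {P : (⨁ p, (M p).toDGMod) → Prop} (zero : P 0)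
    (add : ∀ x y, P x → P y → P (x + y)) (col : ∀ p x, P (col M p x))
    (z : ⨁ p, (M p).toDGMod) : P z := by
  induction z using DirectSum.induction_on with
  | zero => exact zero
  | add x y hx hy => exact add x y hx hy
  | of p x => exact col p x

theorem total_tw (M : ℕ → DGBimod A) (q : ℤ) (p : ℕ) (x : M p) :
    twist (totalGr fun p => (M p).toDGMod) (totalGr_internal _) q (col M p x) =
      (((q * p).negOnePow : ℤˣ) : ℤ) • col M p ((M p).tw q x) := by
  refine twist_map (M p).internal (totalGr_internal fun p => (M p).toDGMod) (r := p)
    (f := col M p) (fun n x hx => ?_) q x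
  exact lof_mem_totalGr (M := fun p => (M p).toDGMod) p (add_comm _ _) hx

theorem negOnePow_natCast (p : ℕ) : (((p : ℤ).negOnePow : ℤˣ) : ℤ) = (-1) ^ p := by
  rw [Int.negOnePow_def]; simp

/-- The total complex of a complex `⋯ → M 2 → M 1 → M 0` of dg bimodules, as a dg bimodule. -/
noncomputable abbrev total (M : ℕ → DGBimod A) (D : ∀ p, Hom (M (p + 1)) (M p))
    (hD : ∀ p x, (D p).toLin ((D (p + 1)).toLin x) = 0) : DGBimod A where
  toDGMod := DGMod.total (fun p => (M p).toDGMod) (fun p => (D p).toHom) hD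
  l := totalL M
  r := totalR M
  l_one x := by
    induction x using total_induction with
    | zero => simp
    | add x y hx hy => rw [map_add, hx, hy]
    | col p x =>
      rw [totalL_col, A.tw_one_elem, (M p).l_one]
  r_one x := by
    induction x using total_induction with
    | zero => simp
    | add x y hx hy => rw [map_add, hx, hy]
    | col p x =>
      rw [totalR_col, (M p).r_one]
  l_mul a b x := by
    induction x using total_induction with
    | zero => simp
    | add x y hx hy => simp only [map_add] at hx hy ⊢; rw [hx, hy]
    | col p x =>
      rw [totalL_col, totalL_col, totalL_col, A.tw_mul, (M p).l_mul]
  r_mul a b x := by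
    induction x using total_induction with
    | zero => simp
    | add x y hx hy => simp only [map_add] at hx hy ⊢; rw [hx, hy]
    | col p x =>
      rw [totalR_col, totalR_col, totalR_col, (M p).r_mul]
  l_r a b x := by
    induction x using total_induction with
    | zero => simp
    | add x y hx hy => simp only [map_add] at hx hy ⊢; rw [hx, hy]
    | col p x =>
      rw [totalL_col, totalR_col, totalR_col, totalL_col, (M p).l_r]
  l_mem m n a ha x hx := by
    have : totalGr (fun p => (M p).toDGMod) n ≤
        (totalGr (fun p => (M p).toDGMod) (m + n)).comap (totalL M a) := by
      refine totalGr_induction fun p j hn x hx => ?_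
      rw [Submodule.mem_comap]
      erw [totalL_col]
      exact lof_mem_totalGr (m := m + j) p (by omega)
        ((M p).l_mem m j _ (A.toMod.tw_mem p ha) x hx)
    exact this hx
  r_mem m n a ha x hx := by
    have : totalGr (fun p => (M p).toDGMod) n ≤
        (totalGr (fun p => (M p).toDGMod) (n + m)).comap (totalR M a) := by
      refine totalGr_induction fun p j hn x hx => ?_
      rw [Submodule.mem_comap]
      erw [totalR_col]
      exact lof_mem_totalGr (m := j + m) p (by omega) ((M p).r_mem m j _ ha x hx)
    exact this hx
  d_l a x := by
    induction x using total_induction with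
    | zero => simp
    | add x y hx hy => simp only [map_add] at hx hy ⊢; rw [hx, hy]; abel
    | col p x =>
      have key : ∀ a : A, totalL M a (horiz (fun p => (M p).toDGMod) (fun p => (D p).toHom) p x) =
          horiz (fun p => (M p).toDGMod) (fun p => (D p).toHom) p
            ((M p).l (A.toMod.tw (p - 1) a) x) := by
        intro a
        cases p with
        | zero => simp [horiz]
        | succ p =>
          simp only [horiz, LinearMap.comp_apply, (D p).map_l]
          erw [totalL_col]
          rw [Nat.cast_succ, add_sub_cancel_right]
      rw [totalL_col, totalL_col]
      erw [totalD_lof, totalD_lof]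
      rw [map_add, map_zsmul, key, A.toMod.tw_tw, sub_add_cancel]
      erw [totalL_col]
      rw [(M p).d_l, map_add, A.toMod.tw_tw, A.toMod.d_tw, map_zsmul, negOnePow_natCast,
        LinearMap.smul_apply, map_zsmul, smul_add, smul_smul, ← mul_pow, A.toMod.tw_tw,
        add_comm (1 : ℤ) p]
      simp only [mul_neg, mul_one, neg_neg, one_pow, one_smul]
      abel
  d_r a x := by
    induction x using total_induction with
    | zero => simp
    | add x y hx hy => simp only [map_add] at hx hy ⊢; rw [hx, hy]; abel
    | col p x =>
      have key : ∀ a : A, totalR M a (horiz (fun p => (M p).toDGMod) (fun p => (D p).toHom) p x) =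
          horiz (fun p => (M p).toDGMod) (fun p => (D p).toHom) p ((M p).r a x) := by
        intro a
        cases p with
        | zero => simp [horiz]
        | succ p =>
          simp only [horiz, LinearMap.comp_apply, (D p).map_r]
          erw [totalR_col]
      rw [totalR_col]
      erw [totalD_lof, totalD_lof]
      rw [map_add, map_zsmul, key, total_tw, map_zsmul]
      erw [totalR_col, totalR_col]
      rw [(M p).d_r', map_add, smul_add, one_mul, negOnePow_natCast]
      abel

end DGBimod

namespace DGMod

variable {k : Type u} [CommRing k]

/-- The morphism induced on quotients. -/
noncomputable def quotMap {M N : DGMod k} {s : Set M} (hs : ∀ x ∈ s, ∃ n, x ∈ M.gr n)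
    (hd : ∀ x ∈ s, M.d x ∈ Submodule.span k s) {t : Set N} (ht : ∀ x ∈ t, ∃ n, x ∈ N.gr n)
    (hd' : ∀ x ∈ t, N.d x ∈ Submodule.span k t) (f : Hom M N)
    (hf : ∀ x ∈ s, f.toLin x ∈ Submodule.span k t) :
    Hom (quot M s hs hd) (quot N t ht hd') where
  toLin := (Submodule.span k s).mapQ _ f.toLin (Submodule.span_le.2 hf)
  map_gr n x hx := by
    obtain ⟨x, hx, rfl⟩ := hx
    exact ⟨f.toLin x, f.map_gr n x hx, rfl⟩
  map_d x := by
    obtain ⟨x, rfl⟩ := (Submodule.span k s).mkQ_surjective x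
    simp [f.map_d]

end DGMod

namespace DGBimod

open DGMod

variable {k : Type u} [CommRing k] {A : DGAlgebra k}

/-- The quotient of a dg bimodule by a homogeneous dg sub-bimodule with spanning set `s`. -/
noncomputable abbrev quot (M : DGBimod A) (s : Set M) (hs : ∀ x ∈ s, ∃ n, x ∈ M.gr n)
    (hd : ∀ x ∈ s, M.d x ∈ Submodule.span k s) (hl : ∀ a, ∀ x ∈ s, M.l a x ∈ Submodule.span k s)
    (hr : ∀ a, ∀ x ∈ s, M.r a x ∈ Submodule.span k s) : DGBimod A where
  toDGMod := DGMod.quot M.toDGMod s hs hd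
  l := LinearMap.flip ((Submodule.span k s).liftQ (M.l.flip.compr₂ (Submodule.span k s).mkQ)
    (Submodule.span_le.2 fun x hx => LinearMap.ext fun a => by
      simpa using hl a x hx))
  r := LinearMap.flip ((Submodule.span k s).liftQ (M.r.flip.compr₂ (Submodule.span k s).mkQ)
    (Submodule.span_le.2 fun x hx => LinearMap.ext fun a => by
      simpa using hr a x hx))
  l_one x := by
    obtain ⟨x, rfl⟩ := (Submodule.span k s).mkQ_surjective x
    simp [M.l_one]
  r_one x := by
    obtain ⟨x, rfl⟩ := (Submodule.span k s).mkQ_surjective x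
    simp [M.r_one]
  l_mul a b x := by
    obtain ⟨x, rfl⟩ := (Submodule.span k s).mkQ_surjective x
    simp [M.l_mul]
  r_mul a b x := by
    obtain ⟨x, rfl⟩ := (Submodule.span k s).mkQ_surjective x
    simp [M.r_mul]
  l_r a b x := by
    obtain ⟨x, rfl⟩ := (Submodule.span k s).mkQ_surjective x
    simp [M.l_r]
  l_mem m n a ha x hx := by
    obtain ⟨x, hx, rfl⟩ := hx
    exact ⟨_, M.l_mem m n a ha x hx, rfl⟩
  r_mem m n a ha x hx := by
    obtain ⟨x, hx, rfl⟩ := hx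
    exact ⟨_, M.r_mem m n a ha x hx, rfl⟩
  d_l a x := by
    obtain ⟨x, rfl⟩ := (Submodule.span k s).mkQ_surjective x
    simp [M.d_l]
  d_r a x := by
    obtain ⟨x, rfl⟩ := (Submodule.span k s).mkQ_surjective x
    have h := twist_map_zero M.internal (DGMod.quot M.toDGMod s hs hd).internal
      (f := (Submodule.span k s).mkQ) (fun n x hx => ⟨x, hx, rfl⟩) 1 x
    rw [h]
    have h2 := M.d_r a x
    simp [h2]

/-- The zero bimodule. -/
noncomputable abbrev zero (A : DGAlgebra k) : DGBimod A where
  carrier := PUnit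
  gr _ := ⊤
  internal := isInternal_of_coaction 0 (fun n x _ => by
    have h : x = 0 := rfl
    rw [h, map_zero]; exact (Finsupp.single_zero n).symm) (fun x => by rw [Subsingleton.elim x 0]; exact zero_mem _)
  d := 0
  d_mem _ _ _ := Submodule.mem_top
  d_sq _ := rfl
  l := 0
  r := 0
  l_one _ := rfl
  r_one _ := rfl
  l_mul _ _ _ := rfl
  r_mul _ _ _ := rfl
  l_r _ _ _ := rfl
  l_mem _ _ _ _ _ _ := Submodule.mem_top
  r_mem _ _ _ _ _ _ := Submodule.mem_top
  d_l _ _ := rfl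
  d_r _ _ := rfl

/-- The zero morphism. -/
noncomputable def zeroHom (M N : DGBimod A) : Hom M N where
  toLin := 0
  map_gr _ _ _ := zero_mem _
  map_d _ := by simp
  map_l _ _ := by simp
  map_r _ _ := by simp

/-- A dg algebra as a dg bimodule over itself. -/
noncomputable abbrev self (A : DGAlgebra k) : DGBimod A where
  toDGMod := A.toMod
  l := LinearMap.mul k A
  r := (LinearMap.mul k A).flip
  l_one := one_mul
  r_one := mul_one
  l_mul a b x := mul_assoc a b x
  r_mul a b x := (mul_assoc x a b).symm
  l_r a b x := (mul_assoc a x b).symm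
  l_mem m n a ha x hx := A.mul_mem m n a ha x hx
  r_mem m n a ha x hx := A.mul_mem n m x hx a ha
  d_l a x := A.leibniz' a x
  d_r a x := A.leibniz' x a

end DGBimod

namespace DGAlgebra

open DGMod

variable {k : Type u} [CommRing k]

/-- The tensor powers of `A` over the ground ring. -/
noncomputable abbrev tpow (A : DGAlgebra k) : ℕ → DGMod k
  | 0 => DGMod.unit k
  | p + 1 => tensor A.toMod (tpow A p)

/-- `a ⊗ (x ⊗ t ⊗ y) ↦ 1 ⊗ (a x ⊗ t) ⊗ y`. -/
noncomputable def iota (A : DGAlgebra k) (p : ℕ) :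
    DGMod.Hom (tensor A.toMod (DGBimod.free A (A.tpow p)).toDGMod)
      (DGBimod.free A (A.tpow (p + 1))).toDGMod :=
  (A.oneTmul _).comp ((Hom.assocInv A.toMod (A.tpow p) A.toMod).comp
    (A.mulFirst (tensor (A.tpow p) A.toMod)))

theorem iota_tmul (A : DGAlgebra k) (p : ℕ) (a x : A) (t : A.tpow p) (y : A) :
    (A.iota p).toLin (a ⊗ₜ[k] (x ⊗ₜ[k] (t ⊗ₜ[k] y))) =
      (1 : A) ⊗ₜ[k] (((a * x) ⊗ₜ[k] t) ⊗ₜ[k] y) := by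
  simp only [iota, Hom.comp, LinearMap.comp_apply]
  rfl

/-- The bar differential on `1 ⊗ (b₁ ⊗ ⋯ ⊗ bₚ₊₁) ⊗ 1`, i.e.
`b₁ ⊗ (b₂ ⊗ ⋯ ⊗ bₚ₊₁) ⊗ 1 + ∑ i ∈ [1, p], (-1) ^ i 1 ⊗ (b₁ ⊗ ⋯ ⊗ bᵢ bᵢ₊₁ ⊗ ⋯ ⊗ bₚ₊₁) ⊗ 1`
`+ (-1) ^ (p + 1) 1 ⊗ (b₁ ⊗ ⋯ ⊗ bₚ) ⊗ bₚ₊₁`, by recursion on `p`. -/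
noncomputable def beta (A : DGAlgebra k) :
    ∀ p, DGMod.Hom (A.tpow (p + 1)) (DGBimod.free A (A.tpow p)).toDGMod
  | 0 => (Hom.lTensor A.toMod (A.tmulOne (DGMod.unit k))).sub
      ((A.oneTmul _).comp (Hom.swap A.toMod (DGMod.unit k)))
  | p + 1 => (Hom.lTensor A.toMod (A.tmulOne (A.tpow (p + 1)))).sub
      ((A.iota p).comp (Hom.lTensor A.toMod (A.beta p)))

theorem beta_zero (A : DGAlgebra k) (a : A) (c : k) :
    (A.beta 0).toLin (a ⊗ₜ[k] c) =
      a ⊗ₜ[k] (c ⊗ₜ[k] (1 : A)) - (1 : A) ⊗ₜ[k] (c ⊗ₜ[k] a) := by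
  have h : (Hom.swap A.toMod (DGMod.unit k)).toLin (a ⊗ₜ[k] c) = c ⊗ₜ[k] a := by
    rw [Hom.swap_tmul _ _ _ (j := 0) (by simp), tw_even _ (by simp)]
  simp only [beta, Hom.sub, Hom.comp, LinearMap.sub_apply, LinearMap.comp_apply, h]
  rfl

theorem beta_succ (A : DGAlgebra k) (p : ℕ) (a : A) (t : A.tpow (p + 1)) :
    (A.beta (p + 1)).toLin (a ⊗ₜ[k] t) =
      a ⊗ₜ[k] (t ⊗ₜ[k] (1 : A)) - (A.iota p).toLin (a ⊗ₜ[k] (A.beta p).toLin t) := by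
  rfl

/-- The bar differential `A ⊗ A^{⊗(p+1)} ⊗ A → A ⊗ A^{⊗p} ⊗ A`. -/
noncomputable def barD (A : DGAlgebra k) (p : ℕ) :
    DGBimod.Hom (DGBimod.free A (A.tpow (p + 1))) (DGBimod.free A (A.tpow p)) :=
  DGBimod.extend _ (A.beta p)

theorem barD_tmul (A : DGAlgebra k) (p : ℕ) (x : A) (t : A.tpow (p + 1)) (y : A) :
    (A.barD p).toLin (x ⊗ₜ[k] (t ⊗ₜ[k] y)) =
      (DGBimod.free A (A.tpow p)).l x ((DGBimod.free A (A.tpow p)).r y ((A.beta p).toLin t)) :=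
  DGBimod.extendLin_tmul _ _ _ _ _

theorem iota_l (A : DGAlgebra k) (p : ℕ) (a x : A) (z : DGBimod.free A (A.tpow p)) :
    (A.iota p).toLin (a ⊗ₜ[k] (DGBimod.free A (A.tpow p)).l x z) =
      (A.iota p).toLin ((a * x) ⊗ₜ[k] z) := by
  induction z using DGBimod.free_induction with
  | zero => simp
  | add y z hy hz => rw [map_add, TensorProduct.tmul_add, map_add, hy, hz, ← map_add,
      TensorProduct.tmul_add]
  | tmul x' t y => rw [DGBimod.free_l, iota_tmul, iota_tmul, mul_assoc]

theorem iota_r (A : DGAlgebra k) (p : ℕ) (a y : A) (z : DGBimod.free A (A.tpow p)) :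
    (A.iota p).toLin (a ⊗ₜ[k] (DGBimod.free A (A.tpow p)).r y z) =
      (DGBimod.free A (A.tpow (p + 1))).r y ((A.iota p).toLin (a ⊗ₜ[k] z)) := by
  induction z using DGBimod.free_induction with
  | zero => simp
  | add w z hw hz => rw [map_add, TensorProduct.tmul_add, map_add, hw, hz, ← map_add,
      ← map_add, TensorProduct.tmul_add]
  | tmul x' t y' => rw [DGBimod.free_r, iota_tmul, iota_tmul, DGBimod.free_r]

theorem barD_iota (A : DGAlgebra k) (p : ℕ) (a : A) (z : DGBimod.free A (A.tpow (p + 1))) :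
    (A.barD (p + 1)).toLin ((A.iota (p + 1)).toLin (a ⊗ₜ[k] z)) =
      (DGBimod.free A (A.tpow (p + 1))).l a z -
        (A.iota p).toLin (a ⊗ₜ[k] (A.barD p).toLin z) := by
  induction z using DGBimod.free_induction with
  | zero => simp
  | add y z hy hz =>
    rw [TensorProduct.tmul_add, map_add, map_add, hy, hz, map_add, map_add,
      TensorProduct.tmul_add, map_add]
    abel
  | tmul x t y =>
    rw [iota_tmul, barD_tmul, barD_tmul, beta_succ, (DGBimod.free A _).l_one, map_sub,
      DGBimod.free_r, one_mul, iota_l, iota_r]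
    rfl

theorem barD_barD (A : DGAlgebra k) (p : ℕ) (z : DGBimod.free A (A.tpow (p + 2))) :
    (A.barD p).toLin ((A.barD (p + 1)).toLin z) = 0 := by
  have key : ∀ (p : ℕ) (t : A.tpow (p + 2)), (A.barD p).toLin ((A.beta (p + 1)).toLin t) = 0 := by
    intro p
    induction p with
    | zero =>
      intro t
      induction t using TensorProduct.induction_on with
      | zero => simp
      | add x y hx hy => rw [map_add, map_add, hx, hy, add_zero]
      | tmul a t =>
        induction t using TensorProduct.induction_on with
        | zero => simp
        | add x y hx hy => rw [TensorProduct.tmul_add, map_add, map_add, hx, hy, add_zero]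
        | tmul b c =>
          rw [beta_succ, beta_zero, TensorProduct.tmul_sub, map_sub, map_sub, iota_tmul, iota_tmul,
            map_sub, barD_tmul, barD_tmul, barD_tmul, beta_zero, beta_zero, beta_zero]
          simp only [map_sub, LinearMap.comp_apply, LinearMap.coe_lTensorHom,
            LinearMap.coe_rTensorHom, LinearMap.lTensor_tmul, LinearMap.rTensor_tmul,
            LinearMap.mul_apply', LinearMap.flip_apply, one_mul, mul_one]
          abel
    | succ p ih =>
      intro t
      induction t using TensorProduct.induction_on with
      | zero => simp
      | add x y hx hy => rw [map_add, map_add, hx, hy, add_zero]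
      | tmul a t =>
        rw [beta_succ, map_sub, barD_iota, ih, barD_tmul, (DGBimod.free A _).r_one]
        simp
  induction z using DGBimod.free_induction with
  | zero => simp
  | add y z hy hz => rw [map_add, map_add, hy, hz, add_zero]
  | tmul x t y => rw [barD_tmul, (A.barD p).map_l, (A.barD p).map_r, key]; simp

end DGAlgebra

namespace DGAlgebra

open DGMod

variable {k : Type u} [CommRing k]

/-- The columns `A ⊗ A^{⊗p} ⊗ A` of the bar resolution. -/
noncomputable abbrev barCol (A : DGAlgebra k) (p : ℕ) : DGBimod A := DGBimod.free A (A.tpow p)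

/-- The two-sided (unnormalized) bar resolution of `A`. -/
noncomputable abbrev bar (A : DGAlgebra k) : DGBimod A :=
  DGBimod.total A.barCol A.barD A.barD_barD

/-- The homogeneous tensors `b₁ ⊗ ⋯ ⊗ bₚ` in `A^{⊗p}` with some `bᵢ = 1`. They span the kernel of
`A^{⊗p} → Ā^{⊗p}`, where `Ā = A / k 1`. -/
def degen (A : DGAlgebra k) : ∀ p, Set (A.tpow p)
  | 0 => ∅
  | p + 1 => {z | ∃ n, ∃ t ∈ (A.tpow p).gr n, z = (1 : A) ⊗ₜ[k] t} ∪
      {z | ∃ n, ∃ a ∈ A.gr n, ∃ t ∈ A.degen p, z = a ⊗ₜ[k] t}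

theorem degen_homog (A : DGAlgebra k) :
    ∀ p, ∀ t ∈ A.degen p, ∃ n, t ∈ (A.tpow p).gr n
  | 0, t, ht => ht.elim
  | p + 1, z, hz => by
    rcases hz with ⟨n, t, ht, rfl⟩ | ⟨n, a, ha, t, ht, rfl⟩
    · exact ⟨n, tmul_mem_tensorGr (zero_add n) A.one_mem ht⟩
    · obtain ⟨m, hm⟩ := A.degen_homog p t ht
      exact ⟨n + m, tmul_mem_tensorGr rfl ha hm⟩

theorem one_tmul_mem_degen (A : DGAlgebra k) (p : ℕ) (t : A.tpow p) :
    (1 : A) ⊗ₜ[k] t ∈ Submodule.span k (A.degen (p + 1)) :=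
  homog_induction (A.tpow p).internal
    (P := fun t => (1 : A) ⊗ₜ[k] t ∈ Submodule.span k (A.degen (p + 1)))
    (by simp) (fun x y hx hy => by rw [TensorProduct.tmul_add]; exact add_mem hx hy)
    (fun n t ht => Submodule.subset_span (Or.inl ⟨n, t, ht, rfl⟩)) t

theorem tmul_mem_degen (A : DGAlgebra k) (p : ℕ) (a : A) {t : A.tpow p}
    (ht : t ∈ Submodule.span k (A.degen p)) :
    a ⊗ₜ[k] t ∈ Submodule.span k (A.degen (p + 1)) := by
  refine homog_induction A.internal
    (P := fun a => a ⊗ₜ[k] t ∈ Submodule.span k (A.degen (p + 1)))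
    (by simp) (fun x y hx hy => by rw [TensorProduct.add_tmul]; exact add_mem hx hy)
    (fun n a ha => ?_) a
  have : Submodule.span k (A.degen p) ≤
      (Submodule.span k (A.degen (p + 1))).comap (TensorProduct.mk k A (A.tpow p) a) :=
    Submodule.span_le.2 fun t ht => Submodule.subset_span (Or.inr ⟨n, a, ha, t, ht, rfl⟩)
  exact this ht

theorem d_mem_degen (A : DGAlgebra k) :
    ∀ p, ∀ t ∈ A.degen p, (A.tpow p).d t ∈ Submodule.span k (A.degen p)
  | 0, t, ht => ht.elim
  | p + 1, z, hz => by
    rcases hz with ⟨n, t, ht, rfl⟩ | ⟨n, a, ha, t, ht, rfl⟩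
    · rw [tensor_d, A.d_one, TensorProduct.zero_tmul, zero_add, A.tw_one_elem]
      exact A.one_tmul_mem_degen p _
    · rw [tensor_d]
      exact add_mem (A.tmul_mem_degen p _ (Submodule.subset_span ht))
        (A.tmul_mem_degen p _ (A.d_mem_degen p t ht))

/-- The degenerate tensors in `A ⊗ A^{⊗p} ⊗ A`. -/
def barDegen (A : DGAlgebra k) (p : ℕ) : Set (A.barCol p) :=
  {z | ∃ m n, ∃ x ∈ A.gr m, ∃ t ∈ A.degen p, ∃ y ∈ A.gr n, z = x ⊗ₜ[k] (t ⊗ₜ[k] y)}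

theorem tmul_mem_barDegen (A : DGAlgebra k) (p : ℕ) (x y : A) {t : A.tpow p}
    (ht : t ∈ Submodule.span k (A.degen p)) :
    x ⊗ₜ[k] (t ⊗ₜ[k] y) ∈ Submodule.span k (A.barDegen p) := by
  refine homog_induction A.internal
    (P := fun x => x ⊗ₜ[k] (t ⊗ₜ[k] y) ∈ Submodule.span k (A.barDegen p))
    (by simp) (fun x y hx hy => by rw [TensorProduct.add_tmul]; exact add_mem hx hy)
    (fun m x hx => ?_) x
  refine homog_induction A.internal
    (P := fun y => x ⊗ₜ[k] (t ⊗ₜ[k] y) ∈ Submodule.span k (A.barDegen p))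
    (by simp) (fun x y hx hy => by
      rw [TensorProduct.tmul_add, TensorProduct.tmul_add]; exact add_mem hx hy)
    (fun n y hy => ?_) y
  have : Submodule.span k (A.degen p) ≤ (Submodule.span k (A.barDegen p)).comap
      ((TensorProduct.mk k A _ x).comp ((TensorProduct.mk k (A.tpow p) A).flip y)) :=
    Submodule.span_le.2 fun t ht => Submodule.subset_span ⟨m, n, x, hx, t, ht, y, hy, rfl⟩
  exact this ht

theorem barDegen_homog (A : DGAlgebra k) (p : ℕ) :
    ∀ z ∈ A.barDegen p, ∃ n, z ∈ (A.barCol p).gr n := by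
  rintro _ ⟨m, n, x, hx, t, ht, y, hy, rfl⟩
  obtain ⟨j, hj⟩ := A.degen_homog p t ht
  exact ⟨m + (j + n), tmul_mem_tensorGr rfl hx (tmul_mem_tensorGr rfl hj hy)⟩

theorem barDegen_d (A : DGAlgebra k) (p : ℕ) :
    ∀ z ∈ A.barDegen p, (A.barCol p).d z ∈ Submodule.span k (A.barDegen p) := by
  rintro _ ⟨m, n, x, hx, t, ht, y, hy, rfl⟩
  obtain ⟨j, hj⟩ := A.degen_homog p t ht
  have h1 : t ∈ Submodule.span k (A.degen p) := Submodule.subset_span ht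
  rw [DGBimod.free_d, TensorProduct.tmul_add]
  refine add_mem (A.tmul_mem_barDegen p _ _ h1) (add_mem
    (A.tmul_mem_barDegen p _ _ (A.d_mem_degen p t ht)) (A.tmul_mem_barDegen p _ _ ?_))
  rw [(A.tpow p).tw_of_mem 1 hj]
  exact zsmul_mem h1 _

theorem barDegen_l (A : DGAlgebra k) (p : ℕ) (a : A) :
    ∀ z ∈ A.barDegen p, (A.barCol p).l a z ∈ Submodule.span k (A.barDegen p) := by
  rintro _ ⟨m, n, x, hx, t, ht, y, hy, rfl⟩
  exact A.tmul_mem_barDegen p _ _ (Submodule.subset_span ht)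

theorem barDegen_r (A : DGAlgebra k) (p : ℕ) (a : A) :
    ∀ z ∈ A.barDegen p, (A.barCol p).r a z ∈ Submodule.span k (A.barDegen p) := by
  rintro _ ⟨m, n, x, hx, t, ht, y, hy, rfl⟩
  exact A.tmul_mem_barDegen p _ _ (Submodule.subset_span ht)

theorem iota_mem_barDegen (A : DGAlgebra k) (p : ℕ) (a : A) {z : A.barCol p}
    (hz : z ∈ Submodule.span k (A.barDegen p)) :
    (A.iota p).toLin (a ⊗ₜ[k] z) ∈ Submodule.span k (A.barDegen (p + 1)) := by
  have : Submodule.span k (A.barDegen p) ≤ (Submodule.span k (A.barDegen (p + 1))).comap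
      ((A.iota p).toLin.comp (TensorProduct.mk k A _ a)) := by
    refine Submodule.span_le.2 ?_
    rintro _ ⟨m, n, x, hx, t, ht, y, hy, rfl⟩
    change (A.iota p).toLin (a ⊗ₜ[k] (x ⊗ₜ[k] (t ⊗ₜ[k] y))) ∈ Submodule.span k (A.barDegen (p + 1))
    rw [iota_tmul]
    exact A.tmul_mem_barDegen _ _ _ (A.tmul_mem_degen _ _ (Submodule.subset_span ht))
  exact this hz

theorem iota_iota_mem_barDegen (A : DGAlgebra k) (p : ℕ) (a : A) (z : A.barCol p) :
    (A.iota (p + 1)).toLin ((1 : A) ⊗ₜ[k] (A.iota p).toLin (a ⊗ₜ[k] z)) ∈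
      Submodule.span k (A.barDegen (p + 2)) := by
  induction z using DGBimod.free_induction with
  | zero => simp
  | add x y hx hy =>
    rw [TensorProduct.tmul_add, map_add, TensorProduct.tmul_add, map_add]; exact add_mem hx hy
  | tmul x t y =>
    rw [iota_tmul, iota_tmul, one_mul]
    exact A.tmul_mem_barDegen _ _ _ (A.one_tmul_mem_degen _ _)

theorem beta_mem_barDegen (A : DGAlgebra k) :
    ∀ p, ∀ t ∈ A.degen (p + 1), (A.beta p).toLin t ∈ Submodule.span k (A.barDegen p)
  | 0, z, hz => by
    rcases hz with ⟨n, t, ht, rfl⟩ | ⟨n, a, ha, t, ht, rfl⟩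
    · rw [beta_zero, sub_self]; exact zero_mem _
    · exact ht.elim
  | p + 1, z, hz => by
    rcases hz with ⟨n, t, ht, rfl⟩ | ⟨n, a, ha, t, ht, rfl⟩
    · clear ht
      induction t using TensorProduct.induction_on with
      | zero => simp
      | add x y hx hy => rw [TensorProduct.tmul_add, map_add]; exact add_mem hx hy
      | tmul b t =>
        cases p with
        | zero =>
          rw [beta_succ, beta_zero, TensorProduct.tmul_sub, map_sub, iota_tmul, iota_tmul,
            one_mul, sub_sub_cancel, one_mul]
          exact A.tmul_mem_barDegen _ _ _ (A.one_tmul_mem_degen _ _)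
        | succ p =>
          rw [beta_succ, beta_succ, TensorProduct.tmul_sub, map_sub, iota_tmul, one_mul,
            sub_sub_cancel]
          exact A.iota_iota_mem_barDegen p b _
    · rw [beta_succ]
      exact sub_mem (A.tmul_mem_barDegen _ _ _ (Submodule.subset_span ht))
        (A.iota_mem_barDegen _ _ (A.beta_mem_barDegen p t ht))

theorem barD_mem_barDegen (A : DGAlgebra k) (p : ℕ) :
    ∀ z ∈ A.barDegen (p + 1), (A.barD p).toLin z ∈ Submodule.span k (A.barDegen p) := by
  rintro _ ⟨m, n, x, hx, t, ht, y, hy, rfl⟩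
  rw [barD_tmul]
  have h1 : Submodule.span k (A.barDegen p) ≤
      (Submodule.span k (A.barDegen p)).comap ((A.barCol p).r y) :=
    Submodule.span_le.2 (A.barDegen_r p y)
  have h2 : Submodule.span k (A.barDegen p) ≤
      (Submodule.span k (A.barDegen p)).comap ((A.barCol p).l x) :=
    Submodule.span_le.2 (A.barDegen_l p x)
  exact h2 (h1 (A.beta_mem_barDegen p t ht))

/-- The columns `A ⊗ Ā^{⊗p} ⊗ A` of the normalized bar resolution, where `Ā = A / k 1`, as
quotients of `A ⊗ A^{⊗p} ⊗ A`. -/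
noncomputable abbrev nbarCol (A : DGAlgebra k) (p : ℕ) : DGBimod A :=
  DGBimod.quot (A.barCol p) (A.barDegen p) (A.barDegen_homog p) (A.barDegen_d p) (A.barDegen_l p)
    (A.barDegen_r p)

/-- The class in `A ⊗ Ā^{⊗p} ⊗ A` of an element of `A ⊗ A^{⊗p} ⊗ A`. -/
noncomputable abbrev nbarMk (A : DGAlgebra k) (p : ℕ) : A.barCol p →ₗ[k] A.nbarCol p :=
  (Submodule.span k (A.barDegen p)).mkQ

/-- The differential of the normalized bar resolution. -/
noncomputable def nbarD (A : DGAlgebra k) (p : ℕ) :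
    DGBimod.Hom (A.nbarCol (p + 1)) (A.nbarCol p) where
  toHom := quotMap (A.barDegen_homog _) (A.barDegen_d _) (A.barDegen_homog _) (A.barDegen_d _)
    (A.barD p).toHom (A.barD_mem_barDegen p)
  map_l a x := by
    obtain ⟨x, rfl⟩ := (Submodule.span k (A.barDegen (p + 1))).mkQ_surjective x
    exact congrArg (Submodule.span k (A.barDegen p)).mkQ ((A.barD p).map_l a x)
  map_r a x := by
    obtain ⟨x, rfl⟩ := (Submodule.span k (A.barDegen (p + 1))).mkQ_surjective x
    exact congrArg (Submodule.span k (A.barDegen p)).mkQ ((A.barD p).map_r a x)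

theorem nbarD_nbarD (A : DGAlgebra k) (p : ℕ) (x : A.nbarCol (p + 2)) :
    (A.nbarD p).toLin ((A.nbarD (p + 1)).toLin x) = 0 := by
  obtain ⟨x, rfl⟩ := (Submodule.span k (A.barDegen (p + 2))).mkQ_surjective x
  have h := congrArg (A.nbarMk p) (A.barD_barD p x)
  rw [map_zero] at h
  exact h

/-- The normalized two-sided bar resolution of `A`. -/
noncomputable abbrev nbar (A : DGAlgebra k) : DGBimod A :=
  DGBimod.total A.nbarCol A.nbarD A.nbarD_nbarD

/-- `c ⊗ (x ⊗ t ⊗ y) ↦ (-1) ^ (|y| (|c| + |x| + |t|)) y c x ⊗ t`. -/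
noncomputable def wrap (A : DGAlgebra k) (W : DGMod k) :
    DGMod.Hom (tensor A.toMod (DGBimod.free A W).toDGMod) (tensor A.toMod W) :=
  (A.mulFirst W).comp ((Hom.swap (tensor A.toMod W) A.toMod).comp
    ((Hom.assocInv A.toMod W A.toMod).comp (A.mulFirst (tensor W A.toMod))))

theorem wrap_tmul (A : DGAlgebra k) (W : DGMod k) (c x : A) (t : W) {n : ℤ} {y : A}
    (hy : y ∈ A.gr n) :
    (A.wrap W).toLin (c ⊗ₜ[k] (x ⊗ₜ[k] (t ⊗ₜ[k] y))) =
      (y * A.toMod.tw n (c * x)) ⊗ₜ[k] W.tw n t := by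
  have h1 : (Hom.assocInv A.toMod W A.toMod).toLin ((c * x) ⊗ₜ[k] (t ⊗ₜ[k] y)) =
      ((c * x) ⊗ₜ[k] t) ⊗ₜ[k] y := rfl
  have h2 := Hom.swap_tmul (tensor A.toMod W) A.toMod ((c * x) ⊗ₜ[k] t) hy
  rw [tensor_tw] at h2
  have h3 : (A.wrap W).toLin (c ⊗ₜ[k] (x ⊗ₜ[k] (t ⊗ₜ[k] y))) = (A.mulFirst W).toLin
      ((Hom.swap (tensor A.toMod W) A.toMod).toLin ((Hom.assocInv A.toMod W A.toMod).toLin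
        ((A.mulFirst (tensor W A.toMod)).toLin (c ⊗ₜ[k] (x ⊗ₜ[k] (t ⊗ₜ[k] y)))))) := rfl
  rw [h3, mulFirst_tmul, h1, h2, mulFirst_tmul]

/-- The Hochschild differential `A ⊗ A^{⊗(p+1)} → A ⊗ A^{⊗p}` with Koszul signs:
`b₀ ⊗ b₁ ⊗ ⋯ ⊗ bₚ₊₁ ↦ ∑ i ∈ [0, p], (-1) ^ i b₀ ⊗ ⋯ ⊗ bᵢ bᵢ₊₁ ⊗ ⋯ ⊗ bₚ₊₁`
`+ (-1) ^ (p + 1 + |bₚ₊₁| (|b₀| + ⋯ + |bₚ|)) bₚ₊₁ b₀ ⊗ b₁ ⊗ ⋯ ⊗ bₚ`. -/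
noncomputable def hochD (A : DGAlgebra k) (p : ℕ) :
    DGMod.Hom (tensor A.toMod (A.tpow (p + 1))) (tensor A.toMod (A.tpow p)) :=
  (A.wrap (A.tpow p)).comp (Hom.lTensor A.toMod (A.beta p))

theorem hochD_tmul (A : DGAlgebra k) (p : ℕ) (c : A) (t : A.tpow (p + 1)) :
    (A.hochD p).toLin (c ⊗ₜ[k] t) = (A.wrap (A.tpow p)).toLin (c ⊗ₜ[k] (A.beta p).toLin t) := rfl

theorem wrap_l_r (A : DGAlgebra k) (W : DGMod k) (c x : A) {n : ℤ} {y : A} (hy : y ∈ A.gr n)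
    (z : DGBimod.free A W) :
    (A.wrap W).toLin ((y * A.toMod.tw n (c * x)) ⊗ₜ[k] (DGBimod.free A W).tw n z) =
      (A.wrap W).toLin (c ⊗ₜ[k] (DGBimod.free A W).l x ((DGBimod.free A W).r y z)) := by
  induction z using DGBimod.free_induction with
  | zero => simp
  | add z w hz hw => simp only [map_add, TensorProduct.tmul_add, hz, hw]
  | tmul x' t y' =>
    refine homog_induction A.internal
      (P := fun y' => (A.wrap W).toLin ((y * A.toMod.tw n (c * x)) ⊗ₜ[k]
        (DGBimod.free A W).tw n (x' ⊗ₜ[k] (t ⊗ₜ[k] y'))) = (A.wrap W).toLin (c ⊗ₜ[k]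
          (DGBimod.free A W).l x ((DGBimod.free A W).r y (x' ⊗ₜ[k] (t ⊗ₜ[k] y'))))) (by simp)
      (fun z w hz hw => by simp only [map_add, TensorProduct.tmul_add, hz, hw])
      (fun m y' hy' => ?_) y'
    rw [tensor_tw, tensor_tw, wrap_tmul _ _ _ _ _ (A.toMod.tw_mem n hy'), DGBimod.free_r,
      DGBimod.free_l, wrap_tmul _ _ _ _ _ (A.mul_mem m n _ hy' _ hy), tw_tw, mul_assoc y,
      A.tw_mul m y, ← A.tw_mul n, A.toMod.tw_tw, A.toMod.tw_of_mem n hy', A.toMod.tw_of_mem m hy,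
      mul_comm m n, smul_mul_assoc, smul_mul_assoc, mul_smul_comm, smul_smul, ← Units.val_mul,
      Int.units_mul_self, Units.val_one, one_smul, mul_assoc c, mul_assoc y']

theorem hochD_wrap (A : DGAlgebra k) (p : ℕ) (c : A) (z : A.barCol (p + 1)) :
    (A.hochD p).toLin ((A.wrap _).toLin (c ⊗ₜ[k] z)) =
      (A.wrap _).toLin (c ⊗ₜ[k] (A.barD p).toLin z) := by
  induction z using DGBimod.free_induction with
  | zero => simp
  | add z w hz hw => simp only [map_add, TensorProduct.tmul_add, hz, hw]
  | tmul x t y =>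
    refine homog_induction A.internal
      (P := fun y => (A.hochD p).toLin ((A.wrap _).toLin (c ⊗ₜ[k] (x ⊗ₜ[k] (t ⊗ₜ[k] y)))) =
        (A.wrap _).toLin (c ⊗ₜ[k] (A.barD p).toLin (x ⊗ₜ[k] (t ⊗ₜ[k] y)))) (by simp)
      (fun z w hz hw => by simp only [map_add, TensorProduct.tmul_add, hz, hw])
      (fun n y hy => ?_) y
    rw [wrap_tmul _ _ _ _ _ hy, hochD_tmul, barD_tmul, (A.beta p).map_tw, wrap_l_r _ _ _ _ hy]

theorem hochD_hochD (A : DGAlgebra k) (p : ℕ) (z : A ⊗[k] (A.tpow (p + 2))) :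
    (A.hochD p).toLin ((A.hochD (p + 1)).toLin z) = 0 := by
  induction z using TensorProduct.induction_on with
  | zero => simp
  | add z w hz hw => rw [map_add, map_add, hz, hw, add_zero]
  | tmul c t =>
    have h := A.barD_barD p ((1 : A) ⊗ₜ[k] (t ⊗ₜ[k] (1 : A)))
    rw [barD_tmul, (DGBimod.free A _).l_one, (DGBimod.free A _).r_one] at h
    rw [hochD_tmul, hochD_wrap, h]
    simp

/-- The degenerate tensors in `A ⊗ A^{⊗p}`. -/
def hochDegen (A : DGAlgebra k) (p : ℕ) : Set (tensor A.toMod (A.tpow p)) :=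
  {z | ∃ m, ∃ x ∈ A.gr m, ∃ t ∈ A.degen p, z = x ⊗ₜ[k] t}

theorem tmul_mem_hochDegen (A : DGAlgebra k) (p : ℕ) (x : A) {t : A.tpow p}
    (ht : t ∈ Submodule.span k (A.degen p)) :
    x ⊗ₜ[k] t ∈ Submodule.span k (A.hochDegen p) := by
  refine homog_induction A.internal
    (P := fun x => x ⊗ₜ[k] t ∈ Submodule.span k (A.hochDegen p))
    (by simp) (fun x y hx hy => by rw [TensorProduct.add_tmul]; exact add_mem hx hy)
    (fun m x hx => ?_) x
  have : Submodule.span k (A.degen p) ≤ (Submodule.span k (A.hochDegen p)).comap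
      (TensorProduct.mk k A (A.tpow p) x) :=
    Submodule.span_le.2 fun t ht => Submodule.subset_span ⟨m, x, hx, t, ht, rfl⟩
  exact this ht

theorem hochDegen_homog (A : DGAlgebra k) (p : ℕ) :
    ∀ z ∈ A.hochDegen p, ∃ n, z ∈ (tensor A.toMod (A.tpow p)).gr n := by
  rintro _ ⟨m, x, hx, t, ht, rfl⟩
  obtain ⟨j, hj⟩ := A.degen_homog p t ht
  exact ⟨m + j, tmul_mem_tensorGr rfl hx hj⟩

theorem hochDegen_d (A : DGAlgebra k) (p : ℕ) : ∀ z ∈ A.hochDegen p,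
    (tensor A.toMod (A.tpow p)).d z ∈ Submodule.span k (A.hochDegen p) := by
  rintro _ ⟨m, x, hx, t, ht, rfl⟩
  rw [tensor_d]
  exact add_mem (A.tmul_mem_hochDegen p _ (Submodule.subset_span ht))
    (A.tmul_mem_hochDegen p _ (A.d_mem_degen p t ht))

theorem hochD_mem_hochDegen (A : DGAlgebra k) (p : ℕ) : ∀ z ∈ A.hochDegen (p + 1),
    (A.hochD p).toLin z ∈ Submodule.span k (A.hochDegen p) := by
  rintro _ ⟨m, c, hc, t, ht, rfl⟩
  rw [hochD_tmul]
  have : Submodule.span k (A.barDegen p) ≤ (Submodule.span k (A.hochDegen p)).comap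
      ((A.wrap (A.tpow p)).toLin.comp (TensorProduct.mk k A _ c)) := by
    refine Submodule.span_le.2 ?_
    rintro _ ⟨m, n, x, hx, t, ht, y, hy, rfl⟩
    obtain ⟨j, hj⟩ := A.degen_homog p t ht
    change (A.wrap (A.tpow p)).toLin (c ⊗ₜ[k] (x ⊗ₜ[k] (t ⊗ₜ[k] y))) ∈
      Submodule.span k (A.hochDegen p)
    rw [wrap_tmul _ _ _ _ _ hy, (A.tpow p).tw_of_mem n hj]
    exact A.tmul_mem_hochDegen p _ (zsmul_mem (Submodule.subset_span ht) _)
  exact this (A.beta_mem_barDegen p t ht)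

/-- The columns `A ⊗ Ā^{⊗p}` of the Hochschild chain complex. -/
noncomputable abbrev hochCol (A : DGAlgebra k) (p : ℕ) : DGMod k :=
  DGMod.quot (tensor A.toMod (A.tpow p)) (A.hochDegen p) (A.hochDegen_homog p) (A.hochDegen_d p)

/-- The Hochschild differential on `A ⊗ Ā^{⊗p}`. -/
noncomputable def nhochD (A : DGAlgebra k) (p : ℕ) :
    DGMod.Hom (A.hochCol (p + 1)) (A.hochCol p) :=
  quotMap (A.hochDegen_homog _) (A.hochDegen_d _) (A.hochDegen_homog _) (A.hochDegen_d _)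
    (A.hochD p) (A.hochD_mem_hochDegen p)

theorem nhochD_nhochD (A : DGAlgebra k) (p : ℕ) (x : A.hochCol (p + 2)) :
    (A.nhochD p).toLin ((A.nhochD (p + 1)).toLin x) = 0 := by
  obtain ⟨x, rfl⟩ := (Submodule.span k (A.hochDegen (p + 2))).mkQ_surjective x
  have h := congrArg (Submodule.span k (A.hochDegen p)).mkQ (A.hochD_hochD p x)
  rw [map_zero] at h
  exact h

/-- The Hochschild chains of `A`: the total complex of the double complex `A ⊗ Ā^{⊗p}`. -/
noncomputable abbrev hochschildChains (A : DGAlgebra k) : DGMod k :=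
  DGMod.total A.hochCol A.nhochD A.nhochD_nhochD

end DGAlgebra

/-- `A` is quasi-free on the graded subspace `V`: as a graded algebra (forgetting the
differential), `A` is the tensor algebra `T V`. -/
structure QuasiFree {k : Type u} [CommRing k] (A : DGAlgebra k) where
  V : Submodule k A
  graded : DirectSum.IsInternal fun n => (A.gr n).comap V.subtype
  free : Function.Bijective (TensorAlgebra.lift k V.subtype)

namespace QuasiFree

open DGMod DGAlgebra

variable {k : Type u} [CommRing k] {A : DGAlgebra k}

/-- The graded space of generators, with zero differential. -/
noncomputable abbrev gen (Q : QuasiFree A) : DGMod k where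
  carrier := Q.V
  gr n := (A.gr n).comap Q.V.subtype
  internal := Q.graded
  d := 0
  d_mem _ _ _ := zero_mem _
  d_sq _ := rfl

/-- The isomorphism `T V ≃ A`. -/
noncomputable def equiv (Q : QuasiFree A) : TensorAlgebra k Q.V ≃ₐ[k] A :=
  AlgEquiv.ofBijective _ Q.free

theorem equiv_ι (Q : QuasiFree A) (v : Q.V) : Q.equiv (TensorAlgebra.ι k v) = v := by
  simp [equiv]

/-- The graded bimodule `A ⊗ V ⊗ A` (with a differential that ignores that of `V ⊆ A`). -/
noncomputable abbrev freeGen (Q : QuasiFree A) : DGBimod A := DGBimod.free A Q.gen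

/-- An auxiliary representation of `T V` on `(A ⊗ V ⊗ A) × A`. -/
noncomputable def derivRep (Q : QuasiFree A) :
    TensorAlgebra k Q.V →ₐ[k] Module.End k (Q.freeGen × A) :=
  TensorAlgebra.lift k
    (LinearMap.mk₂ k (fun (v : Q.V) (p : Q.freeGen × A) =>
      ((Q.freeGen.l v p.1 + (1 : A) ⊗ₜ[k] (v ⊗ₜ[k] p.2), (v : A) * p.2) : Q.freeGen × A))
      (fun v w p => by
        ext
        · simp only [Submodule.coe_add, map_add, LinearMap.add_apply, TensorProduct.add_tmul,
            TensorProduct.tmul_add, Prod.fst_add]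
          abel
        · simp [add_mul])
      (fun c v p => by
        ext
        · simp only [map_smul, LinearMap.smul_apply, Submodule.coe_smul, Prod.smul_fst, smul_add,
            ← TensorProduct.smul_tmul', TensorProduct.tmul_smul]
        · simp)
      (fun v p q => by
        ext
        · simp only [Prod.fst_add, Prod.snd_add, map_add, TensorProduct.tmul_add]
          abel
        · simp [mul_add])
      (fun c v p => by ext <;> simp))

theorem derivRep_ι (Q : QuasiFree A) (v : Q.V) (p : Q.freeGen × A) :
    Q.derivRep (TensorAlgebra.ι k v) p =
      (Q.freeGen.l v p.1 + (1 : A) ⊗ₜ[k] (v ⊗ₜ[k] p.2), (v : A) * p.2) := by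
  simp [derivRep]

/-- The universal derivation `A → A ⊗ V ⊗ A`, i.e. the one with `v ↦ 1 ⊗ v ⊗ 1` for `v ∈ V`, so that
`v₁ ⋯ vₙ ↦ ∑ i, v₁ ⋯ vᵢ₋₁ ⊗ vᵢ ⊗ vᵢ₊₁ ⋯ vₙ`. -/
noncomputable def univD (Q : QuasiFree A) : A →ₗ[k] Q.freeGen :=
  (LinearMap.fst k Q.freeGen A).comp
    (((LinearMap.flip Q.derivRep.toLinearMap) (0, 1)).comp Q.equiv.symm.toLinearMap)

theorem univD_equiv (Q : QuasiFree A) (w : TensorAlgebra k Q.V) :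
    Q.univD (Q.equiv w) = (Q.derivRep w (0, 1)).1 := by
  simp [univD]

theorem derivRep_apply (Q : QuasiFree A) (w : TensorAlgebra k Q.V) :
    ∀ p : Q.freeGen × A, Q.derivRep w p =
      (Q.freeGen.l (Q.equiv w) p.1 + Q.freeGen.r p.2 (Q.univD (Q.equiv w)), Q.equiv w * p.2) := by
  induction w using TensorAlgebra.induction with
  | algebraMap c =>
    intro p
    have h : Q.univD (Q.equiv (algebraMap k _ c)) = 0 := by
      rw [univD_equiv, AlgHom.commutes]
      simp [Algebra.algebraMap_eq_smul_one]
    rw [h, AlgHom.commutes, AlgEquiv.commutes, map_zero, add_zero, Algebra.algebraMap_eq_smul_one,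
      Algebra.algebraMap_eq_smul_one, map_smul, LinearMap.smul_apply, LinearMap.smul_apply,
      Q.freeGen.l_one]
    ext <;> simp
  | ι v =>
    intro p
    rw [univD_equiv, derivRep_ι, derivRep_ι, equiv_ι]
    simp
  | add a b ha hb =>
    intro p
    rw [map_add, LinearMap.add_apply, ha, hb, map_add, map_add, map_add, map_add,
      LinearMap.add_apply, add_mul]
    ext
    · simp only [Prod.fst_add]
      abel
    · simp
  | mul a b ha hb =>
    intro p
    have hD : Q.univD (Q.equiv (a * b)) = Q.freeGen.l (Q.equiv a) (Q.univD (Q.equiv b)) +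
        Q.freeGen.r (Q.equiv b) (Q.univD (Q.equiv a)) := by
      rw [univD_equiv, map_mul, Module.End.mul_apply, hb, ha]
      simp only [map_zero, zero_add, mul_one]
      rw [Q.freeGen.r_one]
    rw [hD, map_mul Q.derivRep, Module.End.mul_apply, hb, ha, map_mul Q.equiv]
    ext
    · simp only
      rw [Q.freeGen.l_mul, map_add, map_add, Q.freeGen.l_r, Q.freeGen.r_mul]
      abel
    · simp [mul_assoc]

theorem univD_gen (Q : QuasiFree A) (v : Q.V) :
    Q.univD v = (1 : A) ⊗ₜ[k] (v ⊗ₜ[k] (1 : A)) := by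
  rw [← equiv_ι, univD_equiv, derivRep_ι]
  simp

theorem univD_mul (Q : QuasiFree A) (a b : A) :
    Q.univD (a * b) = Q.freeGen.l a (Q.univD b) + Q.freeGen.r b (Q.univD a) := by
  obtain ⟨a, rfl⟩ := Q.equiv.surjective a
  obtain ⟨b, rfl⟩ := Q.equiv.surjective b
  rw [← map_mul, univD_equiv, map_mul, Module.End.mul_apply, derivRep_apply, derivRep_apply]
  simp only [map_zero, zero_add, mul_one]
  rw [Q.freeGen.r_one]

theorem univD_one (Q : QuasiFree A) : Q.univD 1 = 0 := by
  have h := Q.univD_mul 1 1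
  rw [Q.freeGen.l_one, Q.freeGen.r_one, mul_one] at h
  simpa using h

/-- Every element of `A` is obtained from `k` and `V` by sums and products. -/
theorem induction (Q : QuasiFree A) {P : A → Prop} (smul_one : ∀ c : k, P (c • 1))
    (gen : ∀ n, ∀ v : Q.V, (v : A) ∈ A.gr n → P v) (add : ∀ a b, P a → P b → P (a + b))
    (mul : ∀ a b, P a → P b → P (a * b)) (a : A) : P a := by
  obtain ⟨w, rfl⟩ := Q.equiv.surjective a
  induction w using TensorAlgebra.induction with
  | algebraMap c => rw [AlgEquiv.commutes, Algebra.algebraMap_eq_smul_one]; exact smul_one c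
  | ι v =>
    rw [equiv_ι]
    exact homog_induction Q.graded (P := fun v : Q.V => P v) (by simpa using smul_one 0)
      (fun x y hx hy => add _ _ hx hy) (fun n v hv => gen n v hv) v
  | add a b ha hb => rw [map_add]; exact add _ _ ha hb
  | mul a b ha hb => rw [map_mul]; exact mul _ _ ha hb

theorem univD_tw (Q : QuasiFree A) (q : ℤ) (a : A) :
    Q.univD (A.toMod.tw q a) = Q.freeGen.tw q (Q.univD a) := by
  induction a using Q.induction with
  | smul_one c => rw [map_smul, map_smul, map_smul, tw_one_elem, univD_one, smul_zero, map_zero]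
  | gen n v hv =>
    rw [A.toMod.tw_of_mem q hv, map_zsmul, univD_gen, (Q.freeGen.toDGMod).tw_of_mem q (n := n)]
    exact tmul_mem_tensorGr (zero_add n) A.one_mem (tmul_mem_tensorGr (add_zero n) hv A.one_mem)
  | add a b ha hb => rw [map_add, map_add, map_add, map_add, ha, hb]
  | mul a b ha hb =>
    rw [A.tw_mul, univD_mul, univD_mul, map_add, ha, hb, DGBimod.tw_l, DGBimod.tw_r]

theorem univD_mem (Q : QuasiFree A) (n : ℤ) (a : A) (ha : a ∈ A.gr n) :
    Q.univD a ∈ Q.freeGen.gr n := by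
  let G : ℤ → Submodule k A := fun n => A.gr n ⊓ (Q.freeGen.gr n).comap Q.univD
  have htop : ∀ a : A, a ∈ ⨆ n, G n := by
    intro a
    induction a using Q.induction with
    | smul_one c =>
      refine Submodule.smul_mem _ _ (Submodule.mem_iSup_of_mem 0 ⟨A.one_mem, ?_⟩)
      rw [SetLike.mem_coe, Submodule.mem_comap, univD_one]
      exact zero_mem _
    | gen n v hv =>
      refine Submodule.mem_iSup_of_mem n ⟨hv, ?_⟩
      rw [SetLike.mem_coe, Submodule.mem_comap, univD_gen]
      exact tmul_mem_tensorGr (zero_add n) A.one_mem (tmul_mem_tensorGr (add_zero n) hv A.one_mem)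
    | add a b ha hb => exact add_mem ha hb
    | mul a b ha hb =>
      induction ha using Submodule.iSup_induction' with
      | zero => simp
      | add x y _ _ hx hy => rw [add_mul]; exact add_mem hx hy
      | mem i x hx =>
        induction hb using Submodule.iSup_induction' with
        | zero => simp
        | add y z _ _ hy hz => rw [mul_add]; exact add_mem hy hz
        | mem j y hy =>
          refine Submodule.mem_iSup_of_mem (i + j) ⟨A.mul_mem i j x hx.1 y hy.1, ?_⟩
          rw [SetLike.mem_coe, Submodule.mem_comap, univD_mul]
          exact add_mem (Q.freeGen.l_mem i j x hx.1 _ hy.2) (Q.freeGen.r_mem j i y hy.1 _ hx.2)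
  have hcomp : ∀ (x : A) (m : ℤ), coaction A.gr A.internal x m ∈ G m := by
    intro x m
    refine Submodule.iSup_induction G (motive := fun x => coaction A.gr A.internal x m ∈ G m)
      (htop x) (fun i y hy => ?_) (by simp) (fun y z hy hz => by
        rw [map_add, Finsupp.add_apply]; exact add_mem hy hz)
    rw [coaction_of_mem A.internal hy.1]
    by_cases him : i = m
    · subst him; rw [Finsupp.single_eq_same]; exact hy
    · rw [Finsupp.single_eq_of_ne (Ne.symm him)]; exact zero_mem _
  have h := hcomp a n
  rw [coaction_of_mem A.internal ha, Finsupp.single_eq_same] at h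
  exact h.2

/-- The part of the differential of `A ⊗ V ⊗ A` that comes from the differential of `V ⊆ A`:
`x ⊗ v ⊗ y ↦ (-1) ^ |x| x D(d v) y`, where `D` is the universal derivation. -/
noncomputable def perturb (Q : QuasiFree A) : Q.freeGen →ₗ[k] Q.freeGen :=
  (DGBimod.extendLin Q.freeGen (Q.univD.comp (A.d.comp Q.V.subtype))).comp
    (LinearMap.rTensor (Q.gen ⊗[k] A) (A.toMod.tw 1))

theorem perturb_tmul (Q : QuasiFree A) (x : A) (v : Q.V) (y : A) :
    Q.perturb (x ⊗ₜ[k] (v ⊗ₜ[k] y)) =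
      Q.freeGen.l (A.toMod.tw 1 x) (Q.freeGen.r y (Q.univD (A.d v))) :=
  DGBimod.extendLin_tmul (W := Q.gen) Q.freeGen _ _ _ _

theorem perturb_l (Q : QuasiFree A) (a : A) (z : Q.freeGen) :
    Q.perturb (Q.freeGen.l a z) = Q.freeGen.l (A.toMod.tw 1 a) (Q.perturb z) := by
  induction z using DGBimod.free_induction with
  | zero => simp
  | add y z hy hz => simp only [map_add] at hy hz ⊢; rw [hy, hz]
  | tmul x v y => rw [DGBimod.free_l, perturb_tmul, perturb_tmul, A.tw_mul, Q.freeGen.l_mul]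

theorem perturb_r (Q : QuasiFree A) (a : A) (z : Q.freeGen) :
    Q.perturb (Q.freeGen.r a z) = Q.freeGen.r a (Q.perturb z) := by
  induction z using DGBimod.free_induction with
  | zero => simp
  | add y z hy hz => simp only [map_add] at hy hz ⊢; rw [hy, hz]
  | tmul x v y =>
    rw [DGBimod.free_r, perturb_tmul, perturb_tmul, Q.freeGen.r_mul, Q.freeGen.l_r]

/-- The differential of `A ⊗ V ⊗ A`:
`x ⊗ v ⊗ y ↦ d x ⊗ v ⊗ y + (-1) ^ |x| x D(d v) y + (-1) ^ (|x| + |v|) x ⊗ v ⊗ d y`. -/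
noncomputable def omegaD (Q : QuasiFree A) : Q.freeGen →ₗ[k] Q.freeGen :=
  Q.freeGen.d + Q.perturb

theorem omegaD_apply (Q : QuasiFree A) (z : Q.freeGen) :
    Q.omegaD z = Q.freeGen.d z + Q.perturb z := rfl

theorem omegaD_l (Q : QuasiFree A) (a : A) (z : Q.freeGen) :
    Q.omegaD (Q.freeGen.l a z) =
      Q.freeGen.l (A.d a) z + Q.freeGen.l (A.toMod.tw 1 a) (Q.omegaD z) := by
  rw [omegaD_apply, omegaD_apply, Q.freeGen.d_l, perturb_l, map_add, add_assoc]

theorem omegaD_r (Q : QuasiFree A) (a : A) (z : Q.freeGen) :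
    Q.omegaD (Q.freeGen.r a z) =
      Q.freeGen.r a (Q.omegaD z) + Q.freeGen.r (A.d a) (Q.freeGen.tw 1 z) := by
  rw [omegaD_apply, omegaD_apply, DGBimod.d_r', perturb_r, map_add]
  abel

theorem omegaD_gen (Q : QuasiFree A) (v : Q.V) :
    Q.omegaD ((1 : A) ⊗ₜ[k] (v ⊗ₜ[k] (1 : A))) = Q.univD (A.d v) := by
  rw [omegaD_apply, perturb_tmul, DGBimod.free_d, A.d_one, A.tw_one_elem,
    Q.freeGen.l_one, Q.freeGen.r_one]
  simp

theorem omegaD_univD (Q : QuasiFree A) (a : A) : Q.omegaD (Q.univD a) = Q.univD (A.d a) := by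
  induction a using Q.induction with
  | smul_one c => rw [map_smul, map_smul, map_smul, map_smul, A.d_one, univD_one, map_zero, map_zero]
  | gen n v hv => rw [univD_gen, omegaD_gen]
  | add a b ha hb => simp only [map_add, ha, hb]
  | mul a b ha hb =>
    rw [A.leibniz', map_add, univD_mul, univD_mul, univD_mul, map_add, omegaD_l, omegaD_r, ha, hb,
      univD_tw]
    abel

theorem omegaD_mem (Q : QuasiFree A) (n : ℤ) (z : Q.freeGen) (hz : z ∈ Q.freeGen.gr n) :
    Q.omegaD z ∈ Q.freeGen.gr (n - 1) := by
  refine add_mem (Q.freeGen.d_mem n z hz) ?_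
  have : tensorGr A.gr (tensorGr Q.gen.gr A.gr) n ≤ (Q.freeGen.gr (n - 1)).comap Q.perturb := by
    refine DGBimod.free_gr_induction fun i j m hn x hx v hv y hy => ?_
    rw [Submodule.mem_comap, perturb_tmul]
    have h := Q.freeGen.l_mem i _ _ (A.toMod.tw_mem 1 hx) _ (Q.freeGen.r_mem m _ y hy _
      (Q.univD_mem _ _ (A.d_mem j v hv)))
    have e : i + (j - 1 + m) = n - 1 := by omega
    rwa [e] at h
  exact this hz

theorem omegaD_sq (Q : QuasiFree A) (z : Q.freeGen) : Q.omegaD (Q.omegaD z) = 0 := by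
  have hl : ∀ (a : A) (z : Q.freeGen),
      Q.omegaD (Q.omegaD (Q.freeGen.l a z)) = Q.freeGen.l a (Q.omegaD (Q.omegaD z)) := by
    intro a z
    rw [omegaD_l, map_add, omegaD_l, omegaD_l, A.d_sq, tw_one_d, tw_one_one]
    simp
  have htw : ∀ z : Q.freeGen, Q.omegaD (Q.freeGen.tw 1 z) = - Q.freeGen.tw 1 (Q.omegaD z) := by
    intro z
    have h := twist_map Q.freeGen.internal Q.freeGen.internal (r := -1) (f := Q.omegaD)
      (fun n x hx => by simpa [sub_eq_add_neg] using Q.omegaD_mem n x hx) 1 z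
    have h' : Q.freeGen.tw 1 (Q.omegaD z) = - Q.omegaD (Q.freeGen.tw 1 z) := by
      simpa [tw] using h
    rw [h', neg_neg]
  have hr : ∀ (a : A) (z : Q.freeGen),
      Q.omegaD (Q.omegaD (Q.freeGen.r a z)) = Q.freeGen.r a (Q.omegaD (Q.omegaD z)) := by
    intro a z
    rw [omegaD_r, map_add, omegaD_r, omegaD_r, A.d_sq, htw]
    simp
  induction z using DGBimod.free_induction with
  | zero => simp
  | add y z hy hz => rw [map_add, map_add, hy, hz, add_zero]
  | tmul x v y =>
    have h : x ⊗ₜ[k] (v ⊗ₜ[k] y) =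
        Q.freeGen.l x (Q.freeGen.r y ((1 : A) ⊗ₜ[k] (v ⊗ₜ[k] (1 : A)))) := by
      rw [DGBimod.free_r, DGBimod.free_l, mul_one, one_mul]
    rw [h, hl, hr, omegaD_gen, omegaD_univD, A.d_sq]
    simp

/-- The dg bimodule `A ⊗ V ⊗ A` of noncommutative Kähler differentials of `A`. -/
noncomputable abbrev omega (Q : QuasiFree A) : DGBimod A where
  toDGMod :=
    { carrier := A ⊗[k] (Q.V ⊗[k] A)
      gr := Q.freeGen.gr
      internal := Q.freeGen.internal
      d := Q.omegaD
      d_mem := Q.omegaD_mem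
      d_sq := Q.omegaD_sq }
  l := Q.freeGen.l
  r := Q.freeGen.r
  l_one := Q.freeGen.l_one
  r_one := Q.freeGen.r_one
  l_mul := Q.freeGen.l_mul
  r_mul := Q.freeGen.r_mul
  l_r := Q.freeGen.l_r
  l_mem := Q.freeGen.l_mem
  r_mem := Q.freeGen.r_mem
  d_l := Q.omegaD_l
  d_r := Q.omegaD_r

/-- `v ↦ v ⊗ 1 - 1 ⊗ v`, with values in `A ⊗ A = A ⊗ k ⊗ A`. -/
noncomputable def genDiff (Q : QuasiFree A) : Q.V →ₗ[k] DGBimod.free A (DGMod.unit k) :=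
  ((TensorProduct.mk k A (k ⊗[k] A)).flip ((1 : k) ⊗ₜ[k] (1 : A)) -
    (TensorProduct.mk k A (k ⊗[k] A) 1).comp (TensorProduct.mk k k A 1)).comp Q.V.subtype

theorem genDiff_apply (Q : QuasiFree A) (v : Q.V) :
    Q.genDiff v = (v : A) ⊗ₜ[k] ((1 : k) ⊗ₜ[k] (1 : A)) - (1 : A) ⊗ₜ[k] ((1 : k) ⊗ₜ[k] (v : A)) :=
  rfl

/-- `x ⊗ v ⊗ y ↦ x v ⊗ y - x ⊗ v y`. -/
noncomputable def extendDiff (Q : QuasiFree A) : Q.freeGen →ₗ[k] DGBimod.free A (DGMod.unit k) :=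
  DGBimod.extendLin (W := Q.gen) (DGBimod.free A (DGMod.unit k)) Q.genDiff

theorem extendDiff_tmul' (Q : QuasiFree A) (x : A) (v : Q.V) (y : A) :
    Q.extendDiff (x ⊗ₜ[k] (v ⊗ₜ[k] y)) = (DGBimod.free A (DGMod.unit k)).l x
      ((DGBimod.free A (DGMod.unit k)).r y (Q.genDiff v)) :=
  DGBimod.extendLin_tmul (W := Q.gen) _ _ _ _ _

theorem extendDiff_tmul (Q : QuasiFree A) (x : A) (v : Q.V) (y : A) :
    Q.extendDiff (x ⊗ₜ[k] (v ⊗ₜ[k] y)) =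
      (x * v) ⊗ₜ[k] ((1 : k) ⊗ₜ[k] y) - x ⊗ₜ[k] ((1 : k) ⊗ₜ[k] (v * y)) := by
  rw [extendDiff_tmul', genDiff_apply, map_sub, map_sub, DGBimod.free_r, DGBimod.free_r,
    DGBimod.free_l, DGBimod.free_l, one_mul, mul_one]

theorem extendDiff_l (Q : QuasiFree A) (a : A) (z : Q.freeGen) :
    Q.extendDiff (Q.freeGen.l a z) =
      (DGBimod.free A (DGMod.unit k)).l a
        (Q.extendDiff z) := by
  induction z using DGBimod.free_induction with
  | zero => simp
  | add y z hy hz => simp only [map_add] at hy hz ⊢; rw [hy, hz]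
  | tmul x v y => rw [DGBimod.free_l, extendDiff_tmul', extendDiff_tmul', DGBimod.l_mul]

theorem extendDiff_r (Q : QuasiFree A) (a : A) (z : Q.freeGen) :
    Q.extendDiff (Q.freeGen.r a z) =
      (DGBimod.free A (DGMod.unit k)).r a
        (Q.extendDiff z) := by
  induction z using DGBimod.free_induction with
  | zero => simp
  | add y z hy hz => simp only [map_add] at hy hz ⊢; rw [hy, hz]
  | tmul x v y =>
    rw [DGBimod.free_r, extendDiff_tmul', extendDiff_tmul', DGBimod.r_mul, DGBimod.l_r]

theorem extendDiff_univD (Q : QuasiFree A) (a : A) :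
    Q.extendDiff (Q.univD a) =
      a ⊗ₜ[k] ((1 : k) ⊗ₜ[k] (1 : A)) - (1 : A) ⊗ₜ[k] ((1 : k) ⊗ₜ[k] a) := by
  induction a using Q.induction with
  | smul_one c =>
    rw [map_smul, univD_one, smul_zero, map_zero, TensorProduct.smul_tmul,
      TensorProduct.tmul_smul c (1 : k) (1 : A), sub_self]
  | gen n v hv => rw [univD_gen, extendDiff_tmul, one_mul, mul_one]
  | add a b ha hb =>
    rw [map_add, map_add, ha, hb, TensorProduct.add_tmul, TensorProduct.tmul_add,
      TensorProduct.tmul_add]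
    abel
  | mul a b ha hb =>
    rw [univD_mul, map_add, extendDiff_l, extendDiff_r, ha, hb, map_sub, map_sub,
      DGBimod.free_l, DGBimod.free_l, DGBimod.free_r, DGBimod.free_r, mul_one, one_mul]
    abel

theorem extendDiff_mem (Q : QuasiFree A) (n : ℤ) (z : Q.freeGen) (hz : z ∈ Q.freeGen.gr n) :
    Q.extendDiff z ∈ (DGBimod.free A (DGMod.unit k)).gr n := by
  have : tensorGr A.gr (tensorGr Q.gen.gr A.gr) n ≤
      ((DGBimod.free A (DGMod.unit k)).gr n).comap
        (Q.extendDiff) := by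
    refine DGBimod.free_gr_induction fun i j m hn x hx v hv y hy => ?_
    have h1 : (1 : k) ∈ (DGMod.unit k).gr 0 := by simp
    rw [Submodule.mem_comap, extendDiff_tmul]
    exact sub_mem
      (tmul_mem_tensorGr (i := i + j) (j := m) (by omega) (A.mul_mem i j x hx v hv)
        (tmul_mem_tensorGr (zero_add m) h1 hy))
      (tmul_mem_tensorGr (i := i) (j := j + m) (by omega) hx
        (tmul_mem_tensorGr (zero_add _) h1 (A.mul_mem j m v hv y hy)))
  exact this hz

theorem extendDiff_d (Q : QuasiFree A) (z : Q.freeGen) :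
    Q.extendDiff (Q.omegaD z) = (DGBimod.free A (DGMod.unit k)).d (Q.extendDiff z) := by
  induction z using DGBimod.free_induction with
  | zero => simp
  | add y z hy hz => simp only [map_add] at hy hz ⊢; rw [hy, hz]
  | tmul x v y =>
    have h : x ⊗ₜ[k] (v ⊗ₜ[k] y) = Q.freeGen.l x (Q.freeGen.r y (Q.univD v)) := by
      rw [univD_gen, DGBimod.free_r, DGBimod.free_l, mul_one, one_mul]
    have h1 : ∀ a : A, (DGBimod.free A (DGMod.unit k)).d (a ⊗ₜ[k] ((1 : k) ⊗ₜ[k] (1 : A))) =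
        A.d a ⊗ₜ[k] ((1 : k) ⊗ₜ[k] (1 : A)) := fun a => by
      rw [DGBimod.free_d, A.d_one]; simp
    have h2 : ∀ a : A, (DGBimod.free A (DGMod.unit k)).d ((1 : A) ⊗ₜ[k] ((1 : k) ⊗ₜ[k] a)) =
        (1 : A) ⊗ₜ[k] ((1 : k) ⊗ₜ[k] A.d a) := fun a => by
      rw [DGBimod.free_d, A.d_one, A.tw_one_elem,
        (DGMod.unit k).tw_of_mem 1 (n := 0) (x := (1 : k)) (by simp)]
      simp
    have h3 : (DGBimod.free A (DGMod.unit k)).tw 1 (Q.extendDiff (Q.univD v)) =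
        Q.extendDiff (Q.univD (A.toMod.tw 1 v)) := by
      rw [univD_tw]
      exact twist_map_zero Q.freeGen.internal (DGBimod.free A (DGMod.unit k)).internal
        Q.extendDiff_mem 1 _
    rw [h, omegaD_l, omegaD_r, omegaD_univD, extendDiff_l, extendDiff_r, map_add, extendDiff_l,
      extendDiff_l, map_add, extendDiff_r, extendDiff_r, extendDiff_r, DGBimod.d_l, DGBimod.d_r',
      h3, ← univD_tw]
    have h4 : Q.extendDiff (Q.univD (A.d v)) =
        (DGBimod.free A (DGMod.unit k)).d (Q.extendDiff (Q.univD v)) := by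
      rw [extendDiff_univD, extendDiff_univD, map_sub, h1, h2]
    rw [h4]

/-- The differential `x ⊗ v ⊗ y ↦ x v ⊗ y - x ⊗ v y` of the small resolution. -/
noncomputable def smallHom (Q : QuasiFree A) :
    DGBimod.Hom Q.omega (DGBimod.free A (DGMod.unit k)) where
  toLin := Q.extendDiff
  map_gr := Q.extendDiff_mem
  map_l := Q.extendDiff_l
  map_r := Q.extendDiff_r
  map_d := Q.extendDiff_d

/-- The columns of the small resolution: `A ⊗ A` (as `A ⊗ k ⊗ A`), `A ⊗ V ⊗ A` and zeros. -/
noncomputable abbrev smallCol (Q : QuasiFree A) : ℕ → DGBimod A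
  | 0 => DGBimod.free A (DGMod.unit k)
  | 1 => Q.omega
  | _ + 2 => DGBimod.zero A

/-- The horizontal differentials of the small resolution. -/
noncomputable abbrev smallD (Q : QuasiFree A) : ∀ p, DGBimod.Hom (Q.smallCol (p + 1)) (Q.smallCol p)
  | 0 => Q.smallHom
  | _ + 1 => DGBimod.zeroHom _ _

/-- The small resolution `S_*(A) : 0 → A ⊗ V ⊗ A → A ⊗ A → 0`. -/
noncomputable abbrev small (Q : QuasiFree A) : DGBimod A :=
  DGBimod.total Q.smallCol Q.smallD (fun _ _ => map_zero _)

end QuasiFree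

namespace DGBimod

open DGMod

variable {k : Type u} [CommRing k] {A : DGAlgebra k}

/-- The relations `c b ⊗ x = c ⊗ b x` and `b c ⊗ x = (-1) ^ (|b| (|c| + |x|)) c ⊗ x b` that define
`A ⊗_{Aᵉ} M` as a quotient of `A ⊗ M`. -/
def coinvRel (M : DGBimod A) : Set (tensor A.toMod M.toDGMod) :=
  {z | ∃ i j m : ℤ, ∃ c ∈ A.gr i, ∃ b ∈ A.gr j, ∃ x ∈ M.gr m,
    z = (c * b) ⊗ₜ[k] x - c ⊗ₜ[k] M.l b x ∨
    z = (b * c) ⊗ₜ[k] x - (((j * (i + m)).negOnePow : ℤˣ) : ℤ) • c ⊗ₜ[k] M.r b x}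

theorem coinvRel_tw (M : DGBimod A) {i j m : ℤ} {c : A} (hc : c ∈ A.gr i) (b : A) {x : M}
    (hx : x ∈ M.gr m) : A.toMod.tw j c ⊗ₜ[k] M.r b (M.tw j x) =
      (((j * (i + m)).negOnePow : ℤˣ) : ℤ) • c ⊗ₜ[k] M.r b x := by
  rw [A.toMod.tw_of_mem j hc, M.tw_of_mem j hx, map_zsmul, ← TensorProduct.smul_tmul',
    TensorProduct.tmul_smul, smul_smul, mul_add, Int.negOnePow_add, Units.val_mul]

theorem coinvRel_left (M : DGBimod A) {i j m : ℤ} {c b : A} {x : M} (hc : c ∈ A.gr i)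
    (hb : b ∈ A.gr j) (hx : x ∈ M.gr m) :
    (c * b) ⊗ₜ[k] x - c ⊗ₜ[k] M.l b x ∈ Submodule.span k M.coinvRel :=
  Submodule.subset_span ⟨i, j, m, c, hc, b, hb, x, hx, Or.inl rfl⟩

theorem coinvRel_right (M : DGBimod A) {i j m : ℤ} {c b : A} {x : M} (hc : c ∈ A.gr i)
    (hb : b ∈ A.gr j) (hx : x ∈ M.gr m) :
    (b * c) ⊗ₜ[k] x - A.toMod.tw j c ⊗ₜ[k] M.r b (M.tw j x) ∈ Submodule.span k M.coinvRel :=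
  Submodule.subset_span ⟨i, j, m, c, hc, b, hb, x, hx, Or.inr (by rw [coinvRel_tw M hc b hx])⟩

theorem coinvRel_homog (M : DGBimod A) :
    ∀ z ∈ M.coinvRel, ∃ n, z ∈ (tensor A.toMod M.toDGMod).gr n := by
  rintro _ ⟨i, j, m, c, hc, b, hb, x, hx, rfl | rfl⟩
  · exact ⟨i + j + m, sub_mem (tmul_mem_tensorGr rfl (A.mul_mem i j c hc b hb) hx)
      (tmul_mem_tensorGr (by omega) hc (M.l_mem j m b hb x hx))⟩
  · exact ⟨j + i + m, sub_mem (tmul_mem_tensorGr rfl (A.mul_mem j i b hb c hc) hx)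
      (zsmul_mem (tmul_mem_tensorGr (by omega) hc (M.r_mem j m b hb x hx)) _)⟩

theorem coinvRel_d (M : DGBimod A) : ∀ z ∈ M.coinvRel,
    (tensor A.toMod M.toDGMod).d z ∈ Submodule.span k M.coinvRel := by
  rintro _ ⟨i, j, m, c, hc, b, hb, x, hx, rfl | rfl⟩
  · have h : (tensor A.toMod M.toDGMod).d ((c * b) ⊗ₜ[k] x - c ⊗ₜ[k] M.l b x) =
        ((A.d c * b) ⊗ₜ[k] x - A.d c ⊗ₜ[k] M.l b x) +
        ((A.toMod.tw 1 c * A.d b) ⊗ₜ[k] x - A.toMod.tw 1 c ⊗ₜ[k] M.l (A.d b) x) +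
        ((A.toMod.tw 1 c * A.toMod.tw 1 b) ⊗ₜ[k] M.d x -
          A.toMod.tw 1 c ⊗ₜ[k] M.l (A.toMod.tw 1 b) (M.d x)) := by
      rw [map_sub, tensor_d, tensor_d, A.leibniz', A.tw_mul, M.d_l, TensorProduct.add_tmul,
        TensorProduct.tmul_add]
      abel
    rw [h]
    exact add_mem (add_mem (M.coinvRel_left (A.d_mem i c hc) hb hx)
      (M.coinvRel_left (A.toMod.tw_mem 1 hc) (A.d_mem j b hb) hx))
      (M.coinvRel_left (A.toMod.tw_mem 1 hc) (A.toMod.tw_mem 1 hb) (M.d_mem m x hx))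
  · rw [← coinvRel_tw M hc b hx]
    have h : (tensor A.toMod M.toDGMod).d
        ((b * c) ⊗ₜ[k] x - A.toMod.tw j c ⊗ₜ[k] M.r b (M.tw j x)) =
        ((A.d b * c) ⊗ₜ[k] x - A.toMod.tw (j - 1) c ⊗ₜ[k] M.r (A.d b) (M.tw (j - 1) x)) +
        ((j.negOnePow : ℤˣ) : ℤ) •
          ((b * A.d c) ⊗ₜ[k] x - A.toMod.tw j (A.d c) ⊗ₜ[k] M.r b (M.tw j x)) +
        ((j.negOnePow : ℤˣ) : ℤ) • ((b * A.toMod.tw 1 c) ⊗ₜ[k] M.d x -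
          A.toMod.tw j (A.toMod.tw 1 c) ⊗ₜ[k] M.r b (M.tw j (M.d x))) := by
      have e1 : A.toMod.tw 1 b = ((j.negOnePow : ℤˣ) : ℤ) • b := by
        rw [A.toMod.tw_of_mem 1 hb, one_mul]
      have e2 : A.toMod.tw (j - 1) c = A.toMod.tw 1 (A.toMod.tw j c) := by
        rw [A.toMod.tw_tw]; exact A.toMod.tw_congr ⟨-1, by ring⟩ c
      have e3 : M.tw (j - 1) x = M.tw 1 (M.tw j x) := by
        rw [M.tw_tw]; exact M.tw_congr ⟨-1, by ring⟩ x
      have e4 : A.toMod.tw j (A.toMod.tw 1 c) = A.toMod.tw 1 (A.toMod.tw j c) := by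
        rw [A.toMod.tw_tw, A.toMod.tw_tw, add_comm]
      have e5 : A.d (A.toMod.tw j c) = ((j.negOnePow : ℤˣ) : ℤ) • A.toMod.tw j (A.d c) :=
        A.toMod.d_tw j c
      rw [map_sub, tensor_d, tensor_d, A.leibniz', A.tw_mul, M.d_r', e2, e3, e4, e5, e1, M.d_tw,
        map_zsmul]
      simp only [smul_mul_assoc, TensorProduct.add_tmul, TensorProduct.tmul_add,
        ← TensorProduct.smul_tmul', TensorProduct.tmul_smul, smul_sub]
      abel
    rw [h]
    exact add_mem (add_mem (M.coinvRel_right hc (A.d_mem j b hb) hx)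
      (zsmul_mem (M.coinvRel_right (A.d_mem i c hc) hb hx) _))
      (zsmul_mem (M.coinvRel_right (A.toMod.tw_mem 1 hc) hb (M.d_mem m x hx)) _)

/-- The dg module `A ⊗_{Aᵉ} M`. -/
noncomputable abbrev coinv (M : DGBimod A) : DGMod k :=
  DGMod.quot (tensor A.toMod M.toDGMod) M.coinvRel M.coinvRel_homog M.coinvRel_d

/-- The bimodule maps `M → N` of cohomological degree `n`, i.e. those that lower the homological
degree by `n`. Such maps satisfy `f (a x) = (-1) ^ (n |a|) a (f x)` and `f (x a) = (f x) a`. -/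
def homGr (M N : DGBimod A) (n : ℤ) : Submodule k (M →ₗ[k] N) where
  carrier := {f | (∀ m, ∀ x ∈ M.gr m, f x ∈ N.gr (m - n)) ∧
    (∀ a x, f (M.l a x) = N.l (A.toMod.tw n a) (f x)) ∧ ∀ a x, f (M.r a x) = N.r a (f x)}
  add_mem' := by
    rintro f g ⟨hf, hfl, hfr⟩ ⟨hg, hgl, hgr⟩
    exact ⟨fun m x hx => add_mem (hf m x hx) (hg m x hx),
      fun a x => by simp [hfl, hgl], fun a x => by simp [hfr, hgr]⟩
  zero_mem' := ⟨fun m x _ => zero_mem _, fun a x => by simp, fun a x => by simp⟩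
  smul_mem' := by
    rintro c f ⟨hf, hfl, hfr⟩
    exact ⟨fun m x hx => Submodule.smul_mem _ c (hf m x hx),
      fun a x => by simp [hfl], fun a x => by simp [hfr]⟩

/-- The differential `f ↦ d ∘ f - (-1) ^ n f ∘ d` on maps of degree `n`. -/
noncomputable def homD (M N : DGBimod A) (n : ℤ) : (M →ₗ[k] N) →ₗ[k] (M →ₗ[k] N) where
  toFun f := N.d.comp f - ((n.negOnePow : ℤˣ) : ℤ) • f.comp M.d
  map_add' f g := by
    ext x
    simp only [LinearMap.sub_apply, LinearMap.add_apply, LinearMap.comp_apply, LinearMap.smul_apply,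
      map_add, smul_add]
    abel
  map_smul' c f := by
    ext x
    simp only [LinearMap.sub_apply, LinearMap.comp_apply, LinearMap.smul_apply, map_smul, smul_sub,
      RingHom.id_apply]
    rw [smul_comm c]

theorem homD_apply (M N : DGBimod A) (n : ℤ) (f : M →ₗ[k] N) (x : M) :
    homD M N n f x = N.d (f x) - ((n.negOnePow : ℤˣ) : ℤ) • f (M.d x) := rfl

theorem homGr_tw {M N : DGBimod A} {n : ℤ} {f : M →ₗ[k] N}
    (hf : ∀ m, ∀ x ∈ M.gr m, f x ∈ N.gr (m - n)) (x : M) :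
    N.tw 1 (f x) = ((n.negOnePow : ℤˣ) : ℤ) • f (M.tw 1 x) := by
  have h := twist_map M.internal N.internal (r := -n) (f := f)
    (fun m x hx => by simpa [sub_eq_add_neg] using hf m x hx) 1 x
  rw [one_mul, Int.negOnePow_neg] at h
  exact h

theorem homD_mem (M N : DGBimod A) (n : ℤ) {f : M →ₗ[k] N} (hf : f ∈ homGr M N n) :
    homD M N n f ∈ homGr M N (n + 1) := by
  obtain ⟨hf, hl, hr⟩ := hf
  refine ⟨fun m x hx => ?_, fun a x => ?_, fun a x => ?_⟩
  · rw [homD_apply]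
    have h1 := N.d_mem _ _ (hf m x hx)
    have h2 := hf _ _ (M.d_mem m x hx)
    have e1 : m - n - 1 = m - (n + 1) := by ring
    have e2 : m - 1 - n = m - (n + 1) := by ring
    rw [e1] at h1
    rw [e2] at h2
    exact sub_mem h1 (zsmul_mem h2 _)
  · have e : A.d (A.toMod.tw n a) = ((n.negOnePow : ℤˣ) : ℤ) • A.toMod.tw n (A.d a) :=
      A.toMod.d_tw n a
    rw [homD_apply, homD_apply, hl, N.d_l, M.d_l, map_add, hl, hl, A.toMod.tw_tw, A.toMod.tw_tw, e,
      map_zsmul, LinearMap.smul_apply, map_sub, map_zsmul, add_comm (1 : ℤ) n, smul_add]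
    abel
  · rw [homD_apply, homD_apply, hr, N.d_r', M.d_r', map_add, hr, hr, homGr_tw hf, map_zsmul,
      map_sub, map_zsmul, smul_add]
    simp only [tw]
    abel

theorem homD_homD (M N : DGBimod A) (n : ℤ) (f : M →ₗ[k] N) :
    homD M N (n + 1) (homD M N n f) = 0 := by
  ext x
  rw [homD_apply, homD_apply, homD_apply, map_sub, N.d_sq, M.d_sq, Int.negOnePow_succ, map_zsmul]
  simp

/-- The cochain complex `Hom_{Aᵉ}(M, N)`. -/
noncomputable def homComplex (M N : DGBimod A) : CochainComplex (ModuleCat.{u} k) ℤ :=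
  CochainComplex.of (fun n => ModuleCat.of k (homGr M N n))
    (fun n => ModuleCat.ofHom ((homD M N n).restrict fun _ hf => homD_mem M N n hf))
    (fun n =>
      ModuleCat.hom_ext (LinearMap.ext fun f => Subtype.ext (homD_homD M N n f.1)))

/-- A homotopy deformation retract `(i, π, h)` of `C` onto `S`, in the category of dg bimodules:
`i` and `π` are morphisms of dg bimodules, `h` is a bimodule map of degree `1`, and one has
`π i = 1` and `i π - 1 = d h + h d`. -/
structure Retract (S C : DGBimod A) where
  i : Hom S C
  π : Hom C S
  h : C →ₗ[k] C
  h_gr : ∀ n, ∀ x ∈ C.gr n, h x ∈ C.gr (n + 1)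
  h_l : ∀ a x, h (C.l a x) = C.l (A.toMod.tw 1 a) (h x)
  h_r : ∀ a x, h (C.r a x) = C.r a (h x)
  π_i : ∀ x, π.toLin (i.toLin x) = x
  htpy : ∀ x, i.toLin (π.toLin x) - x = C.d (h x) + h (C.d x)

end DGBimod

namespace DGAlgebra

open DGMod

variable {k : Type u} [CommRing k]

/-- The families `(f p)` of maps `f p : Ā^{⊗p} → A` of cohomological degree `n`, where `Ā = A / k 1`
is suspended, i.e. `f p` is a map `A^{⊗p} → A` of homological degree `p - n` that vanishes on
degenerate tensors. -/
def cochainGr (A : DGAlgebra k) (n : ℤ) : Submodule k (∀ p, A.tpow p →ₗ[k] A) where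
  carrier := {f | ∀ p, (∀ m, ∀ t ∈ (A.tpow p).gr m, f p t ∈ A.gr (m + p - n)) ∧
    ∀ t ∈ A.degen p, f p t = 0}
  add_mem' := by
    intro f g hf hg p
    exact ⟨fun m t ht => add_mem ((hf p).1 m t ht) ((hg p).1 m t ht), fun t ht => by
      simp [(hf p).2 t ht, (hg p).2 t ht]⟩
  zero_mem' := fun p => ⟨fun m t _ => zero_mem _, fun t _ => rfl⟩
  smul_mem' := by
    intro c f hf p
    exact ⟨fun m t ht => Submodule.smul_mem _ c ((hf p).1 m t ht), fun t ht => by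
      simp [(hf p).2 t ht]⟩

/-- `x ⊗ t ⊗ y ↦ (-1) ^ (q |x|) x f(t) y`. -/
noncomputable def act (A : DGAlgebra k) {p : ℕ} (q : ℤ) (f : A.tpow p →ₗ[k] A) :
    A.barCol p →ₗ[k] A :=
  (DGBimod.extendLin (DGBimod.self A) f).comp ((A.toMod.tw q).rTensor (A.tpow p ⊗[k] A))

theorem act_tmul (A : DGAlgebra k) {p : ℕ} (q : ℤ) (f : A.tpow p →ₗ[k] A) (x : A) (t : A.tpow p)
    (y : A) : A.act q f (x ⊗ₜ[k] (t ⊗ₜ[k] y)) = A.toMod.tw q x * (f t * y) :=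
  DGBimod.extendLin_tmul (DGBimod.self A) f (A.toMod.tw q x) t y

theorem act_add (A : DGAlgebra k) {p : ℕ} (q : ℤ) (f g : A.tpow p →ₗ[k] A) (z : A.barCol p) :
    A.act q (f + g) z = A.act q f z + A.act q g z := by
  induction z using DGBimod.free_induction with
  | zero => simp
  | add y z hy hz => rw [map_add, map_add, map_add, hy, hz]; abel
  | tmul x t y => rw [act_tmul, act_tmul, act_tmul, LinearMap.add_apply, add_mul, mul_add]

theorem act_smul (A : DGAlgebra k) {p : ℕ} (q : ℤ) (c : k) (f : A.tpow p →ₗ[k] A)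
    (z : A.barCol p) : A.act q (c • f) z = c • A.act q f z := by
  induction z using DGBimod.free_induction with
  | zero => simp
  | add y z hy hz => rw [map_add, map_add, hy, hz, smul_add]
  | tmul x t y => rw [act_tmul, act_tmul, LinearMap.smul_apply, smul_mul_assoc, mul_smul_comm]

theorem act_l (A : DGAlgebra k) {p : ℕ} (q : ℤ) (f : A.tpow p →ₗ[k] A) (a : A) (z : A.barCol p) :
    A.act q f ((A.barCol p).l a z) = A.toMod.tw q a * A.act q f z := by
  induction z using DGBimod.free_induction with
  | zero => simp
  | add y z hy hz => rw [map_add, map_add, map_add, hy, hz, mul_add]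
  | tmul x t y => rw [DGBimod.free_l, act_tmul, act_tmul, A.tw_mul, mul_assoc]

theorem act_r (A : DGAlgebra k) {p : ℕ} (q : ℤ) (f : A.tpow p →ₗ[k] A) (a : A) (z : A.barCol p) :
    A.act q f ((A.barCol p).r a z) = A.act q f z * a := by
  induction z using DGBimod.free_induction with
  | zero => simp
  | add y z hy hz => rw [map_add, map_add, map_add, hy, hz, add_mul]
  | tmul x t y => rw [DGBimod.free_r, act_tmul, act_tmul, mul_assoc, mul_assoc]

/-- The vertical differential `f ↦ d ∘ f - (-1) ^ q f ∘ d` on maps of internal cohomological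
degree `q`. -/
noncomputable def cochV (A : DGAlgebra k) {p : ℕ} (q : ℤ) (f : A.tpow p →ₗ[k] A) :
    A.tpow p →ₗ[k] A :=
  A.d.comp f - ((q.negOnePow : ℤˣ) : ℤ) • f.comp (A.tpow p).d

theorem cochV_apply (A : DGAlgebra k) {p : ℕ} (q : ℤ) (f : A.tpow p →ₗ[k] A) (t : A.tpow p) :
    A.cochV q f t = A.d (f t) - ((q.negOnePow : ℤˣ) : ℤ) • f ((A.tpow p).d t) := rfl

/-- The horizontal differential on maps of internal cohomological degree `q`, with
`(b₁ ⊗ ⋯ ⊗ bₚ₊₁) ↦ (-1) ^ (q |b₁|) b₁ f(b₂ ⊗ ⋯ ⊗ bₚ₊₁)`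
`+ ∑ i ∈ [1, p], (-1) ^ i f(b₁ ⊗ ⋯ ⊗ bᵢ bᵢ₊₁ ⊗ ⋯ ⊗ bₚ₊₁) + (-1) ^ (p + 1) f(b₁ ⊗ ⋯ ⊗ bₚ) bₚ₊₁`. -/
noncomputable def cochH (A : DGAlgebra k) {p : ℕ} (q : ℤ) (f : A.tpow p →ₗ[k] A) :
    A.tpow (p + 1) →ₗ[k] A :=
  (A.act q f).comp (A.beta p).toLin

theorem cochH_apply (A : DGAlgebra k) {p : ℕ} (q : ℤ) (f : A.tpow p →ₗ[k] A)
    (t : A.tpow (p + 1)) : A.cochH q f t = A.act q f ((A.beta p).toLin t) := rfl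

theorem cochV_add (A : DGAlgebra k) {p : ℕ} (q : ℤ) (f g : A.tpow p →ₗ[k] A) (t : A.tpow p) :
    A.cochV q (f + g) t = A.cochV q f t + A.cochV q g t := by
  rw [cochV_apply, cochV_apply, cochV_apply, LinearMap.add_apply, LinearMap.add_apply, map_add,
    smul_add]
  abel

theorem cochV_smul (A : DGAlgebra k) {p : ℕ} (q : ℤ) (c : k) (f : A.tpow p →ₗ[k] A)
    (t : A.tpow p) : A.cochV q (c • f) t = c • A.cochV q f t := by
  rw [cochV_apply, cochV_apply, LinearMap.smul_apply, LinearMap.smul_apply, map_smul, smul_sub,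
    smul_comm c]

theorem cochH_add (A : DGAlgebra k) {p : ℕ} (q : ℤ) (f g : A.tpow p →ₗ[k] A)
    (t : A.tpow (p + 1)) : A.cochH q (f + g) t = A.cochH q f t + A.cochH q g t :=
  A.act_add q f g _

theorem cochH_smul (A : DGAlgebra k) {p : ℕ} (q : ℤ) (c : k) (f : A.tpow p →ₗ[k] A)
    (t : A.tpow (p + 1)) : A.cochH q (c • f) t = c • A.cochH q f t :=
  A.act_smul q c f _

theorem cochH_cochH (A : DGAlgebra k) {p : ℕ} (q : ℤ) (f : A.tpow p →ₗ[k] A)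
    (t : A.tpow (p + 2)) : A.cochH q (A.cochH q f) t = 0 := by
  have key : ∀ z : A.barCol (p + 1),
      A.act q (A.cochH q f) z = A.act q f ((A.barD p).toLin z) := by
    intro z
    induction z using DGBimod.free_induction with
    | zero => simp
    | add y z hy hz => rw [map_add, map_add, map_add, hy, hz]
    | tmul x t y => rw [act_tmul, barD_tmul, act_l, act_r, cochH_apply]
  have h := A.barD_barD p ((1 : A) ⊗ₜ[k] (t ⊗ₜ[k] (1 : A)))
  rw [barD_tmul, (DGBimod.free A _).l_one, (DGBimod.free A _).r_one] at h
  rw [cochH_apply, key, h, map_zero]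

theorem cochV_cochV (A : DGAlgebra k) {p : ℕ} (q : ℤ) (f : A.tpow p →ₗ[k] A) (t : A.tpow p) :
    A.cochV (q + 1) (A.cochV q f) t = 0 := by
  rw [cochV_apply, cochV_apply, cochV_apply, map_sub, A.d_sq, (A.tpow p).d_sq, Int.negOnePow_succ,
    map_zsmul]
  simp

/-- The horizontal and vertical differentials commute. -/
theorem cochV_cochH (A : DGAlgebra k) {p : ℕ} (q : ℤ) {f : A.tpow p →ₗ[k] A}
    (hf : ∀ m, ∀ t ∈ (A.tpow p).gr m, f t ∈ A.gr (m - q)) (t : A.tpow (p + 1)) :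
    A.cochV q (A.cochH q f) t = A.cochH (q + 1) (A.cochV q f) t := by
  have htw : ∀ t, A.toMod.tw 1 (f t) = ((q.negOnePow : ℤˣ) : ℤ) • f ((A.tpow p).tw 1 t) := by
    intro t
    have h := twist_map (A.tpow p).internal A.internal (r := -q) (f := f)
      (fun m x hx => by simpa [sub_eq_add_neg] using hf m x hx) 1 t
    rw [one_mul, Int.negOnePow_neg] at h
    exact h
  have key : ∀ z : A.barCol p, A.act (q + 1) (A.cochV q f) z =
      A.d (A.act q f z) - ((q.negOnePow : ℤˣ) : ℤ) • A.act q f ((A.barCol p).d z) := by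
    intro z
    induction z using DGBimod.free_induction with
    | zero => simp
    | add y z hy hz =>
      simp only [map_add, smul_add] at hy hz ⊢
      rw [hy, hz]
      abel
    | tmul x t y =>
      have e : A.d (A.toMod.tw q x) = ((q.negOnePow : ℤˣ) : ℤ) • A.toMod.tw q (A.d x) :=
        A.toMod.d_tw q x
      rw [DGBimod.free_d, TensorProduct.tmul_add, map_add, map_add, act_tmul, act_tmul, act_tmul,
        act_tmul, act_tmul, A.leibniz', A.leibniz', e, htw, cochV_apply, A.toMod.tw_tw,
        A.toMod.tw_tw, add_comm (1 : ℤ) q]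
      simp only [smul_add, sub_mul, mul_sub, mul_add, smul_mul_assoc, mul_smul_comm]
      abel
  rw [cochV_apply, cochH_apply, cochH_apply, cochH_apply, key, (A.beta p).map_d]

/-- The Hochschild differential `horizontal + (-1) ^ p vertical` on cochains of degree `n`. -/
noncomputable def cochFun (A : DGAlgebra k) (n : ℤ) (f : ∀ p, A.tpow p →ₗ[k] A) :
    ∀ p, A.tpow p →ₗ[k] A
  | 0 => A.cochV n (f 0)
  | p + 1 => A.cochH (n - p) (f p) + (-1 : ℤ) ^ (p + 1) • A.cochV (n - (p + 1 : ℕ)) (f (p + 1))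

theorem cochFun_mem (A : DGAlgebra k) (n : ℤ) {f : ∀ p, A.tpow p →ₗ[k] A}
    (hf : f ∈ A.cochainGr n) : A.cochFun n f ∈ A.cochainGr (n + 1) := by
  have hV : ∀ p, (∀ m, ∀ t ∈ (A.tpow p).gr m,
      A.cochV (n - p) (f p) t ∈ A.gr (m + p - (n + 1))) ∧
      ∀ t ∈ A.degen p, A.cochV (n - p) (f p) t = 0 := by
    intro p
    refine ⟨fun m t ht => ?_, fun t ht => ?_⟩
    · have h1 := A.d_mem _ _ ((hf p).1 m t ht)
      have h2 := (hf p).1 _ _ ((A.tpow p).d_mem m t ht)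
      have e1 : m + p - n - 1 = m + p - (n + 1) := by ring
      have e2 : m - 1 + p - n = m + p - (n + 1) := by ring
      rw [e1] at h1
      rw [e2] at h2
      exact sub_mem h1 (zsmul_mem h2 _)
    · have h1 : Submodule.span k (A.degen p) ≤ LinearMap.ker (f p) :=
        Submodule.span_le.2 (hf p).2
      have h2 : f p ((A.tpow p).d t) = 0 := h1 (A.d_mem_degen p t ht)
      rw [cochV_apply, (hf p).2 t ht, h2]
      simp
  have hH : ∀ p, (∀ m, ∀ t ∈ (A.tpow (p + 1)).gr m,
      A.cochH (n - p) (f p) t ∈ A.gr (m + (p + 1 : ℕ) - (n + 1))) ∧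
      ∀ t ∈ A.degen (p + 1), A.cochH (n - p) (f p) t = 0 := by
    intro p
    refine ⟨fun m t ht => ?_, fun t ht => ?_⟩
    · have h1 : (A.barCol p).gr m ≤ (A.gr (m + (p + 1 : ℕ) - (n + 1))).comap
          (A.act (n - p) (f p)) := by
        refine DGBimod.free_gr_induction fun i j l hn x hx t ht y hy => ?_
        rw [Submodule.mem_comap, act_tmul]
        have h2 := A.mul_mem _ _ _ (A.toMod.tw_mem (n - p) hx) _
          (A.mul_mem _ _ _ ((hf p).1 j t ht) y hy)
        have e : i + (j + p - n + l) = m + (p + 1 : ℕ) - (n + 1) := by push_cast; omega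
        rwa [e] at h2
      exact h1 ((A.beta p).map_gr m t ht)
    · have h1 : Submodule.span k (A.barDegen p) ≤ LinearMap.ker (A.act (n - p) (f p)) := by
        refine Submodule.span_le.2 ?_
        rintro _ ⟨a, b, x, hx, t, ht, y, hy, rfl⟩
        have h2 : A.act (n - p) (f p) (x ⊗ₜ[k] (t ⊗ₜ[k] y)) = 0 := by
          rw [act_tmul, (hf p).2 t ht, zero_mul, mul_zero]
        exact h2
      exact h1 (A.beta_mem_barDegen p t ht)
  intro p
  cases p with
  | zero => simpa [cochFun] using hV 0
  | succ p =>
    refine ⟨fun m t ht => ?_, fun t ht => ?_⟩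
    · exact add_mem ((hH p).1 m t ht) (zsmul_mem ((hV (p + 1)).1 m t ht) _)
    · have h1 := (hH p).2 t ht
      have h2 := (hV (p + 1)).2 t ht
      change A.cochH (n - p) (f p) t +
        (-1 : ℤ) ^ (p + 1) • A.cochV (n - (p + 1 : ℕ)) (f (p + 1)) t = 0
      rw [h1, h2, smul_zero, add_zero]

/-- The Hochschild differential on cochains of degree `n`. -/
noncomputable def cochD (A : DGAlgebra k) (n : ℤ) : A.cochainGr n →ₗ[k] A.cochainGr (n + 1) where
  toFun f := ⟨A.cochFun n f.1, A.cochFun_mem n f.2⟩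
  map_add' f g := by
    refine Subtype.ext (funext fun p => LinearMap.ext fun t => ?_)
    cases p with
    | zero => exact A.cochV_add n (f.1 0) (g.1 0) t
    | succ p =>
      change A.cochH _ (f.1 p + g.1 p) t + (-1 : ℤ) ^ (p + 1) • A.cochV _ (f.1 (p + 1) + g.1 (p + 1)) t
        = (A.cochH _ (f.1 p) t + (-1 : ℤ) ^ (p + 1) • A.cochV _ (f.1 (p + 1)) t) +
          (A.cochH _ (g.1 p) t + (-1 : ℤ) ^ (p + 1) • A.cochV _ (g.1 (p + 1)) t)
      rw [cochH_add, cochV_add, smul_add]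
      abel
  map_smul' c f := by
    refine Subtype.ext (funext fun p => LinearMap.ext fun t => ?_)
    cases p with
    | zero => exact A.cochV_smul n c (f.1 0) t
    | succ p =>
      change A.cochH _ (c • f.1 p) t + (-1 : ℤ) ^ (p + 1) • A.cochV _ (c • f.1 (p + 1)) t
        = c • (A.cochH _ (f.1 p) t + (-1 : ℤ) ^ (p + 1) • A.cochV _ (f.1 (p + 1)) t)
      rw [cochH_smul, cochV_smul, smul_add, smul_comm c]

theorem cochFun_cochFun (A : DGAlgebra k) (n : ℤ) {f : ∀ p, A.tpow p →ₗ[k] A}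
    (hf : f ∈ A.cochainGr n) : A.cochFun (n + 1) (A.cochFun n f) = 0 := by
  have hc : ∀ (p : ℕ) (t : A.tpow (p + 1)), A.cochV (n - p) (A.cochH (n - p) (f p)) t =
      A.cochH (n - p + 1) (A.cochV (n - p) (f p)) t := fun p t =>
    A.cochV_cochH (n - p) (fun m t ht => by
      have h := (hf p).1 m t ht
      have e : m + p - n = m - (n - p) := by ring
      rwa [e] at h) t
  have e1 : ∀ p : ℕ, n + 1 - (p : ℤ) = n - p + 1 := fun p => by ring
  have e2 : ∀ p : ℕ, n + 1 - ((p + 1 : ℕ) : ℤ) = n - p := fun p => by push_cast; ring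
  have hV : ∀ (p : ℕ) (a b : ℤ) (g h : A.tpow p →ₗ[k] A) (t : A.tpow p),
      A.cochV a (g + b • h) t = A.cochV a g t + b • A.cochV a h t := by
    intro p a b g h t
    have e : b • h = (b : k) • h := (Int.cast_smul_eq_zsmul k b h).symm
    rw [e, cochV_add, cochV_smul, Int.cast_smul_eq_zsmul]
  have hH : ∀ (p : ℕ) (a b : ℤ) (g h : A.tpow p →ₗ[k] A) (t : A.tpow (p + 1)),
      A.cochH a (g + b • h) t = A.cochH a g t + b • A.cochH a h t := by
    intro p a b g h t
    have e : b • h = (b : k) • h := (Int.cast_smul_eq_zsmul k b h).symm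
    rw [e, cochH_add, cochH_smul, Int.cast_smul_eq_zsmul]
  have hVV : ∀ (p : ℕ) (g : A.tpow p →ₗ[k] A) (t : A.tpow p),
      A.cochV (n + 1 - p) (A.cochV (n - p) g) t = 0 := fun p g t => by
    rw [e1]; exact A.cochV_cochV _ g t
  funext p
  ext1 t
  rcases p with _ | _ | p
  · simpa [cochFun] using hVV 0 (f 0) t
  · change A.cochH (n + 1 - (0 : ℕ)) (A.cochV n (f 0)) t + (-1 : ℤ) ^ (0 + 1) •
      A.cochV (n + 1 - (0 + 1 : ℕ)) (A.cochH (n - (0 : ℕ)) (f 0) + (-1 : ℤ) ^ (0 + 1) •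
        A.cochV (n - (0 + 1 : ℕ)) (f (0 + 1))) t = 0
    have h := hc 0 t
    rw [hV, hVV, e1, e2, h]
    simp
  · change A.cochH (n + 1 - (p + 1 : ℕ)) (A.cochH (n - p) (f p) + (-1 : ℤ) ^ (p + 1) •
        A.cochV (n - (p + 1 : ℕ)) (f (p + 1))) t + (-1 : ℤ) ^ (p + 1 + 1) •
      A.cochV (n + 1 - (p + 1 + 1 : ℕ)) (A.cochH (n - (p + 1 : ℕ)) (f (p + 1)) +
        (-1 : ℤ) ^ (p + 1 + 1) • A.cochV (n - (p + 1 + 1 : ℕ)) (f (p + 1 + 1))) t = 0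
    have h := hc (p + 1) t
    have h0 := A.cochH_cochH (n - p) (f p) t
    rw [hV, hVV, hH, e2 p, h0, e2 (p + 1), h]
    have e3 : n - ((p + 1 : ℕ) : ℤ) + 1 = n - p := by push_cast; ring
    rw [e3, pow_succ (-1 : ℤ) (p + 1)]
    simp

/-- The Hochschild cochain complex of `A`: the (product) total complex of the double complex
`Hom(Ā^{⊗p}, A)`, where `Ā = A / k 1`. -/
noncomputable def hochschildCochains (A : DGAlgebra k) : CochainComplex (ModuleCat.{u} k) ℤ :=
  CochainComplex.of (fun n => ModuleCat.of k (A.cochainGr n))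
    (fun n => ModuleCat.ofHom (A.cochD n))
    (fun n =>
      ModuleCat.hom_ext (LinearMap.ext fun f => Subtype.ext (A.cochFun_cochFun n f.2)))

end DGAlgebra

namespace QuasiFree

variable {k : Type u} [CommRing k] {A : DGAlgebra k}

/-- The noncommutative differential forms `A ⊗_{Aᵉ} S_*(A)`. -/
noncomputable abbrev forms (Q : QuasiFree A) : DGMod k := Q.small.coinv

/-- The noncommutative polyvector fields `Hom_{Aᵉ}(S_*(A), A)`. -/
noncomputable abbrev fields (Q : QuasiFree A) : CochainComplex (ModuleCat.{u} k) ℤ :=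
  DGBimod.homComplex Q.small (DGBimod.self A)

end QuasiFree

end DGHoch

/-!
For a quasi-free `B = TV`, both the bar resolution and the small resolution `S` are total complexes
whose columns are free graded bimodules, on `B^{⊗p}`, and on `k` and `V` respectively. The extra
degeneracy `b₀ ⊗ ⋯ ⊗ bₚ₊₁ ↦ 1 ⊗ b₀ ⊗ ⋯ ⊗ bₚ₊₁` commutes with the vertical differentials and
contracts the part of the bar resolution in columns `≥ 1`, even for the total differential
(`d_extraDeg`). This gives a lifting lemma (`exists_homD_eq`): a cocycle of `Hom_{Bᵉ}(M, Bar)` with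
values in the columns `≥ 1`, where `M` is free as a graded bimodule, is a coboundary of a map with
values in the columns `≥ 2`. The solution is built degree by degree on the generators, and it
exists because all gradings are bounded below.

The projection `π` is the identity on `B ⊗ B` and is the universal derivation `B → B ⊗ V ⊗ B` on
the generators of column `1`; the Leibniz rule and the definition of the differential of `S` make
it a morphism (`homD_projLin`). The obvious bimodule map `S → Bar` with `1 ⊗ v ⊗ 1 ↦ 1 ⊗ v ⊗ 1`
fails to commute with the differentials only by terms in columns `≥ 1`; the lifting lemma corrects
it by terms in columns `≥ 2`, which `π` kills, and so yields `i` with `π i = 1`. The difference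
`i π - 1` again takes values in columns `≥ 1`, and the lifting lemma yields `h`
(`exists_retract_bar`). As the lifting procedure only uses the extra degeneracy, the cocycle
`i π - 1` and the differential, `h` preserves the degenerate tensors, and the retraction descends to the
normalized bar resolution (`exists_retract_nbar`).

Finally `B ⊗_{Bᵉ} -` and `Hom_{Bᵉ}(-, B)` carry deformation retractions to homotopy equivalences,
and applied to the normalized bar resolution they give, up to isomorphisms with suitable signs
(`unwind`, `restrictIso`), the Hochschild chains and cochains.
-/

namespace DGHoch

/-! ### Free bimodules and the lifting lemma -/

namespace DGBimod

open DGMod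

variable {k : Type u} [CommRing k] {A : DGAlgebra k}

/-- The graded bimodule underlying `M` is free on the generators `ι w`, where `w` runs through a
graded `k`-module `W`: linear maps out of `W` extend to bimodule maps of any cohomological degree
`n` (with the Koszul sign `(-1) ^ (n |a|)` for the left action), and the homogeneous elements of
`M` are sums of products `a (ι w) b` with homogeneous factors. The differential of `M` plays no
role. -/
structure FreeOn (M : DGBimod A) where
  W : Type u
  [addCommGroup : AddCommGroup W]
  [module : Module k W]
  gr : ℤ → Submodule k W
  ι : W →ₗ[k] M
  ι_mem : ∀ m, ∀ w ∈ gr m, ι w ∈ M.gr m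
  lift : ∀ (N : DGBimod A), ℤ → (W →ₗ[k] N) → (M →ₗ[k] N)
  lift_ι : ∀ N n φ w, lift N n φ (ι w) = φ w
  lift_l : ∀ N n φ a x, lift N n φ (M.l a x) = N.l (A.toMod.tw n a) (lift N n φ x)
  lift_r : ∀ N n φ a x, lift N n φ (M.r a x) = N.r a (lift N n φ x)
  span : ∀ m, M.gr m ≤ Submodule.span k {z | ∃ i j l : ℤ, i + (l + j) = m ∧ ∃ a ∈ A.gr i,
    ∃ b ∈ A.gr j, ∃ w ∈ gr l, z = M.l a (M.r b (ι w))}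

attribute [instance] FreeOn.addCommGroup FreeOn.module

namespace FreeOn

variable {M N : DGBimod A}

theorem gr_induction (F : FreeOn M) {m : ℤ} {S : Submodule k M}
    (hS : ∀ i j l : ℤ, i + (l + j) = m → ∀ a ∈ A.gr i, ∀ b ∈ A.gr j, ∀ w ∈ F.gr l,
      M.l a (M.r b (F.ι w)) ∈ S) : M.gr m ≤ S := by
  refine (F.span m).trans (Submodule.span_le.2 ?_)
  rintro _ ⟨i, j, l, h, a, ha, b, hb, w, hw, rfl⟩
  exact hS i j l h a ha b hb w hw

theorem induction (F : FreeOn M) {S : Submodule k M}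
    (hS : ∀ a b w, M.l a (M.r b (F.ι w)) ∈ S) (x : M) : x ∈ S :=
  homog_induction M.internal (P := fun x => x ∈ S) (zero_mem _) (fun _ _ => add_mem)
    (fun _ _ hx => F.gr_induction (fun _ _ _ _ a _ b _ w _ => hS a b w) hx) x

theorem lift_mem (F : FreeOn M) {n : ℤ} {φ : F.W →ₗ[k] N}
    (hφ : ∀ m, ∀ w ∈ F.gr m, φ w ∈ N.gr (m - n)) : F.lift N n φ ∈ homGr M N n := by
  refine ⟨fun m x hx => ?_, F.lift_l N n φ, F.lift_r N n φ⟩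
  refine F.gr_induction (S := (N.gr (m - n)).comap (F.lift N n φ))
    (fun i j l h a ha b hb w hw => ?_) hx
  rw [Submodule.mem_comap, F.lift_l, F.lift_r, F.lift_ι]
  have h1 := N.l_mem i _ _ (A.toMod.tw_mem n ha) _ (N.r_mem j _ b hb _ (hφ l w hw))
  have e : i + (l - n + j) = m - n := by omega
  rwa [e] at h1

theorem hom_mem (F : FreeOn M) {n : ℤ} {f : M →ₗ[k] N} (hf : f ∈ homGr M N n)
    {E : Submodule k N} (hl : ∀ a, ∀ x ∈ E, N.l a x ∈ E) (hr : ∀ a, ∀ x ∈ E, N.r a x ∈ E)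
    (h : ∀ w, f (F.ι w) ∈ E) (x : M) : f x ∈ E := by
  refine F.induction (S := E.comap f) (fun a b w => ?_) x
  rw [Submodule.mem_comap, hf.2.1, hf.2.2]
  exact hl _ _ (hr _ _ (h w))

end FreeOn

/-- A sequence of linear maps that is pointwise eventually constant has a linear limit. -/
theorem exists_eventual_limit {M N : Type*} [AddCommGroup M] [Module k M] [AddCommGroup N]
    [Module k N] (f : ℕ → M →ₗ[k] N) (hf : ∀ x, ∃ n₀, ∀ n ≥ n₀, f (n + 1) x = f n x) :
    ∃ g : M →ₗ[k] N, ∀ x, ∃ n₀, ∀ n ≥ n₀, f n x = g x := by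
  choose n₀ h₀ using hf
  have hc : ∀ x, ∀ n ≥ n₀ x, f n x = f (n₀ x) x := by
    intro x n hn
    induction n, hn using Nat.le_induction with
    | base => rfl
    | succ n hn ih => rw [h₀ x n hn, ih]
  refine ⟨{ toFun := fun x => f (n₀ x) x, map_add' := fun x y => ?_, map_smul' := fun c x => ?_ },
    fun x => ⟨n₀ x, hc x⟩⟩
  · let n := n₀ (x + y) + n₀ x + n₀ y
    rw [← hc (x + y) n (by omega), ← hc x n (by omega), ← hc y n (by omega), map_add]
  · let n := n₀ (c • x) + n₀ x
    rw [← hc (c • x) n (by omega), ← hc x n (by omega), map_smul, RingHom.id_apply]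

/-- Let `M` be free as a graded bimodule and let `E` be a sub-bimodule of `C` whose cycles are
bounded by a linear operator `s`. Then every cocycle `g` of `Hom(M, C)` with values in `E` is the
coboundary of some `f`. On generators `f` solves `f w = s (g w ± f (d w))`; as all gradings are
non-negative, the iteration of this equation is eventually constant on each element. The last
clause says that `f` respects sub-complexes generated by a part of the generators. -/
theorem exists_homD_eq (hA : ∀ n : ℤ, n < 0 → A.gr n = ⊥) {M C : DGBimod A} (F : FreeOn M)
    (hM : ∀ n : ℤ, n < 0 → M.gr n = ⊥) (s : C →ₗ[k] C) (hs : ∀ n, ∀ x ∈ C.gr n, s x ∈ C.gr (n + 1))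
    {E E' : Submodule k C} (hE : E' ≤ E) (hl : ∀ a, ∀ x ∈ E', C.l a x ∈ E')
    (hr : ∀ a, ∀ x ∈ E', C.r a x ∈ E') (hsE : ∀ x ∈ E, s x ∈ E')
    (hds : ∀ x ∈ E, C.d x = 0 → C.d (s x) = x) {m n : ℤ} (hmn : m = n + 1) {g : M →ₗ[k] C}
    (hg : g ∈ homGr M C m) (hdg : homD M C m g = 0) (hgE : ∀ x, g x ∈ E) :
    ∃ f ∈ homGr M C n, homD M C n f = g ∧ (∀ x, f x ∈ E') ∧
      ∀ (T : Submodule k M) (D : Submodule k C),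
        T ≤ Submodule.span k {z | ∃ a b w, F.ι w ∈ T ∧ z = M.l a (M.r b (F.ι w))} →
        (∀ x ∈ T, M.d x ∈ T) → (∀ a, ∀ x ∈ D, C.l a x ∈ D) → (∀ a, ∀ x ∈ D, C.r a x ∈ D) →
        (∀ x ∈ D, s x ∈ D) → (∀ x ∈ T, g x ∈ D) → ∀ x ∈ T, f x ∈ D := by
  subst hmn
  let step (f : M →ₗ[k] C) : M →ₗ[k] C :=
    F.lift C n (s.comp ((g + ((n.negOnePow : ℤˣ) : ℤ) • f.comp M.d).comp F.ι))
  have step_ι : ∀ f w, step f (F.ι w) =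
      s (g (F.ι w) + ((n.negOnePow : ℤˣ) : ℤ) • f (M.d (F.ι w))) := fun f w => F.lift_ι C n _ w
  let f : ℕ → M →ₗ[k] C := fun j => step^[j] 0
  have f_succ : ∀ j, f (j + 1) = step (f j) := fun j => Function.iterate_succ_apply' step j 0
  have step_mem : ∀ f ∈ homGr M C n, step f ∈ homGr M C n := by
    intro f hf
    refine F.lift_mem fun m w hw => ?_
    have h1 := hg.1 m _ (F.ι_mem m w hw)
    have h2 := hf.1 _ _ (M.d_mem m _ (F.ι_mem m w hw))
    have e1 : m - 1 - n = m - (n + 1) := by ring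
    have e2 : m - (n + 1) + 1 = m - n := by ring
    rw [e1] at h2
    have h3 := hs _ _ (add_mem h1 (zsmul_mem h2 ((n.negOnePow : ℤˣ) : ℤ)))
    rw [e2] at h3
    exact h3
  have f_mem : ∀ j, f j ∈ homGr M C n := by
    intro j
    induction j with
    | zero => exact zero_mem _
    | succ j ih => rw [f_succ]; exact step_mem _ ih
  have f_E : ∀ j x, f j x ∈ E' := by
    intro j
    induction j with
    | zero => intro x; exact zero_mem _
    | succ j ih =>
      refine F.hom_mem (f_mem _) hl hr fun w => ?_
      rw [f_succ, step_ι]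
      exact hsE _ (add_mem (hgE _) (zsmul_mem (hE (ih _)) _))
  -- an element of degree `m` involves only generators of degree at most `m`
  have low : ∀ (S : Submodule k M) (j : ℕ) (m : ℤ), m < j →
      (∀ a b w (l : ℤ), l < j → w ∈ F.gr l → M.l a (M.r b (F.ι w)) ∈ S) → M.gr m ≤ S := by
    intro S j m hm h
    refine F.gr_induction fun i i' l hi a ha b hb w hw => ?_
    by_cases h1 : i < 0
    · rw [hA i h1, Submodule.mem_bot] at ha
      rw [ha, map_zero]; exact zero_mem _
    by_cases h2 : i' < 0
    · rw [hA i' h2, Submodule.mem_bot] at hb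
      rw [hb, map_zero, LinearMap.zero_apply, map_zero]; exact zero_mem _
    exact h a b w l (by omega) hw
  -- on elements of degree `< j` the approximation `f j` is final: `f` on a generator of degree `l`
  -- only depends on `f` in degree `l - 1`
  have stable : ∀ (j : ℕ) (m : ℤ), m < j → ∀ x ∈ M.gr m, f (j + 1) x = f j x := by
    intro j
    induction j with
    | zero =>
      intro m hm x hx
      rw [hM m (by simpa using hm), Submodule.mem_bot] at hx
      rw [hx, map_zero, map_zero]
    | succ j ih =>
      intro m hm x hx
      refine LinearMap.mem_eqLocus.1 (low (LinearMap.eqLocus (f (j + 1 + 1)) (f (j + 1))) _ m hm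
        (fun a b w l hl hw => ?_) hx)
      rw [LinearMap.mem_eqLocus, (f_mem _).2.1, (f_mem _).2.1, (f_mem _).2.2, (f_mem _).2.2,
        f_succ (j + 1), f_succ j, step_ι, step_ι, ← f_succ,
        ih (l - 1) (by push_cast at hl; omega) _ (M.d_mem l _ (F.ι_mem l w hw))]
  have solves : ∀ (j : ℕ) (m : ℤ), m < j → ∀ x ∈ M.gr m, homD M C n (f j) x = g x := by
    intro j
    induction j with
    | zero =>
      intro m hm x hx
      rw [hM m (by simpa using hm), Submodule.mem_bot] at hx
      rw [hx, map_zero, map_zero]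
    | succ j ih =>
      intro m hm x hx
      refine LinearMap.mem_eqLocus.1 (low (LinearMap.eqLocus (homD M C n (f (j + 1))) g) _ m hm
        (fun a b w l hl hw => ?_) hx)
      have hD := homD_mem M C n (f_mem (j + 1))
      have hd := M.d_mem l _ (F.ι_mem l w hw)
      have hl' : l - 1 < j := by push_cast at hl; omega
      rw [LinearMap.mem_eqLocus, hD.2.1, hD.2.2, hg.2.1, hg.2.2]
      have hgd : C.d (g (F.ι w)) = - ((n.negOnePow : ℤˣ) : ℤ) • g (M.d (F.ι w)) := by
        have h := LinearMap.congr_fun hdg (F.ι w)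
        rw [homD_apply, Int.negOnePow_succ, LinearMap.zero_apply, sub_eq_zero] at h
        simpa using h
      -- the argument of `s` is a cycle because `f j` already solves the equation below degree `l`
      have hcyc : C.d (g (F.ι w) + ((n.negOnePow : ℤˣ) : ℤ) • f j (M.d (F.ι w))) = 0 := by
        have h := ih (l - 1) hl' _ hd
        rw [homD_apply, M.d_sq, map_zero, smul_zero, sub_zero] at h
        rw [map_add, map_zsmul, h, hgd, neg_smul, neg_add_cancel]
      have h : homD M C n (f (j + 1)) (F.ι w) = g (F.ι w) := by
        rw [homD_apply, stable j (l - 1) hl' _ hd, f_succ, step_ι,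
          hds _ (add_mem (hgE _) (zsmul_mem (hE (f_E _ _)) _)) hcyc, add_sub_cancel_right]
      rw [h]
  obtain ⟨f', hf'⟩ := exists_eventual_limit f fun x => by
    refine homog_induction M.internal
      (P := fun x => ∃ n₀, ∀ n ≥ n₀, f (n + 1) x = f n x) ⟨0, fun j _ => by simp⟩
      (fun x y ⟨n₁, h₁⟩ ⟨n₂, h₂⟩ => ⟨n₁ + n₂, fun j hj => by
        rw [map_add, map_add, h₁ j (by omega), h₂ j (by omega)]⟩) (fun m x hx => ?_) x
    exact ⟨(m + 1).toNat, fun j hj => stable j m (by omega) x hx⟩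
  refine ⟨f', ⟨fun m x hx => ?_, fun a x => ?_, fun a x => ?_⟩, ?_, fun x => ?_, ?_⟩
  · obtain ⟨j, hj⟩ := hf' x
    rw [← hj j le_rfl]; exact (f_mem j).1 m x hx
  · obtain ⟨j, hj⟩ := hf' x
    obtain ⟨j', hj'⟩ := hf' (M.l a x)
    rw [← hj (j + j') (by omega), ← hj' (j + j') (by omega), (f_mem _).2.1]
  · obtain ⟨j, hj⟩ := hf' x
    obtain ⟨j', hj'⟩ := hf' (M.r a x)
    rw [← hj (j + j') (by omega), ← hj' (j + j') (by omega), (f_mem _).2.2]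
  · ext x
    refine homog_ext M.internal (fun m x hx => ?_) x
    obtain ⟨j, hj⟩ := hf' x
    obtain ⟨j', hj'⟩ := hf' (M.d x)
    rw [← solves (j + j' + (m + 1).toNat) m (by omega) x hx, homD_apply, homD_apply,
      hj _ (by omega), hj' _ (by omega)]
  · obtain ⟨j, hj⟩ := hf' x
    rw [← hj j le_rfl]; exact f_E j x
  · intro T D hT hTd hDl hDr hDs hgD x hx
    obtain ⟨j, hj⟩ := hf' x
    rw [← hj j le_rfl]
    clear hj
    revert x
    induction j with
    | zero => intro x _; exact zero_mem _
    | succ j ih =>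
      intro x hx
      refine Submodule.span_le (p := D.comap (f (j + 1))).2 ?_ (hT hx)
      rintro _ ⟨a, b, w, hw, rfl⟩
      rw [SetLike.mem_coe, Submodule.mem_comap, (f_mem _).2.1, (f_mem _).2.2, f_succ, step_ι]
      exact hDl _ _ (hDr _ _ (hDs _ (add_mem (hgD _ hw) (zsmul_mem (ih _ (hTd _ hw)) _))))

end DGBimod

/-! ### Free columns and free total complexes -/

namespace DGBimod

open DGMod

variable {k : Type u} [CommRing k] {A : DGAlgebra k}

/-- The bimodule map `x ⊗ w ⊗ y ↦ (-1) ^ (n |x|) x φ(w) y` of cohomological degree `n`. -/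
noncomputable def twExtend {W : DGMod k} (N : DGBimod A) (n : ℤ) (φ : W →ₗ[k] N) :
    A ⊗[k] (W ⊗[k] A) →ₗ[k] N :=
  (extendLin N φ).comp (LinearMap.rTensor (W ⊗[k] A) (A.toMod.tw n))

theorem twExtend_tmul {W : DGMod k} (N : DGBimod A) (n : ℤ) (φ : W →ₗ[k] N) (x : A) (w : W)
    (y : A) : twExtend N n φ (x ⊗ₜ[k] (w ⊗ₜ[k] y)) = N.l (A.toMod.tw n x) (N.r y (φ w)) :=
  extendLin_tmul N φ _ w y

theorem twExtend_l {W : DGMod k} (N : DGBimod A) (n : ℤ) (φ : W →ₗ[k] N) (a : A)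
    (z : free A W) :
    twExtend N n φ ((free A W).l a z) = N.l (A.toMod.tw n a) (twExtend N n φ z) := by
  induction z using free_induction with
  | zero => simp
  | add x y hx hy => simp only [map_add] at hx hy ⊢; rw [hx, hy]
  | tmul x w y => rw [free_l, twExtend_tmul, twExtend_tmul, A.tw_mul, N.l_mul]

theorem twExtend_r {W : DGMod k} (N : DGBimod A) (n : ℤ) (φ : W →ₗ[k] N) (a : A)
    (z : free A W) :
    twExtend N n φ ((free A W).r a z) = N.r a (twExtend N n φ z) := by
  induction z using free_induction with
  | zero => simp
  | add x y hx hy => simp only [map_add] at hx hy ⊢; rw [hx, hy]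
  | tmul x w y => rw [free_r, twExtend_tmul, twExtend_tmul, N.r_mul, N.l_r]

/-- The generator `1 ⊗ w ⊗ 1` of `A ⊗ W ⊗ A`. -/
noncomputable def freeι (A : DGAlgebra k) (W : DGMod k) : W →ₗ[k] A ⊗[k] (W ⊗[k] A) :=
  (TensorProduct.mk k A (W ⊗[k] A) 1).comp ((TensorProduct.mk k W A).flip 1)

theorem freeι_apply (W : DGMod k) (w : W) :
    freeι A W w = (1 : A) ⊗ₜ[k] (w ⊗ₜ[k] (1 : A)) := rfl

theorem freeι_mem (W : DGMod k) {n : ℤ} {w : W} (hw : w ∈ W.gr n) :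
    freeι A W w ∈ (free A W).gr n :=
  tmul_mem_tensorGr (zero_add n) A.one_mem (tmul_mem_tensorGr (add_zero n) hw A.one_mem)

theorem l_r_freeι (W : DGMod k) (x y : A) (w : W) :
    (free A W).l x ((free A W).r y (freeι A W w)) = x ⊗ₜ[k] (w ⊗ₜ[k] y) := by
  rw [freeι_apply, free_r, free_l, mul_one, one_mul]

theorem free_span (W : DGMod k) (m : ℤ) :
    (free A W).gr m ≤ Submodule.span k {z | ∃ i j l : ℤ, i + (l + j) = m ∧ ∃ a ∈ A.gr i,
      ∃ b ∈ A.gr j, ∃ w ∈ W.gr l,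
        z = (free A W).l a ((free A W).r b (freeι A W w))} :=
  free_gr_induction fun i j l h x hx w hw y hy => Submodule.subset_span
    ⟨i, l, j, h, x, hx, y, hy, w, hw, (l_r_freeι W x y w).symm⟩

/-- `A ⊗ W ⊗ A` is free on `W`. -/
noncomputable def freeOnFree (A : DGAlgebra k) (W : DGMod k) : FreeOn (free A W) where
  W := W
  gr := W.gr
  ι := freeι A W
  ι_mem _ _ := freeι_mem W
  lift N n φ := twExtend N n φ
  lift_ι N n φ w := by
    rw [freeι_apply, twExtend_tmul, A.tw_one_elem, N.l_one, N.r_one]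
  lift_l N n φ := twExtend_l N n φ
  lift_r N n φ := twExtend_r N n φ
  span := free_span W

/-- The zero bimodule is free on `0`. -/
noncomputable def freeOnZero (A : DGAlgebra k) : FreeOn (zero A) where
  W := PUnit
  gr _ := ⊤
  ι := 0
  ι_mem _ _ _ := Submodule.mem_top
  lift N n φ := 0
  lift_ι N n φ w := by rw [Subsingleton.elim w 0, map_zero, map_zero]
  lift_l N n φ a x := by simp
  lift_r N n φ a x := by simp
  span m x _ := by rw [Subsingleton.elim x 0]; exact zero_mem _

/-- The extension to a total complex of maps on the generators of its columns. A generator of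
column `p` is suspended `p` times, whence the degree `n + p` in column `p`. -/
noncomputable def totalLift {M : ℕ → DGBimod A} (F : ∀ p, FreeOn (M p)) (N : DGBimod A) (n : ℤ)
    (φ : (⨁ p, (F p).W) →ₗ[k] N) : (⨁ p, (M p).toDGMod) →ₗ[k] N :=
  DirectSum.toModule k ℕ N fun p =>
    (F p).lift N (n + p) (φ.comp (DirectSum.lof k ℕ (fun p => (F p).W) p))

theorem totalLift_col {M : ℕ → DGBimod A} (F : ∀ p, FreeOn (M p)) (N : DGBimod A) (n : ℤ)
    (φ : (⨁ p, (F p).W) →ₗ[k] N) (p : ℕ) (x : M p) :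
    totalLift F N n φ (col M p x) =
      (F p).lift N (n + p) (φ.comp (DirectSum.lof k ℕ (fun p => (F p).W) p)) x := by
  simp [totalLift]

theorem totalLift_toModule_col {M : ℕ → DGBimod A} (F : ∀ p, FreeOn (M p)) (N : DGBimod A) (n : ℤ)
    (φ : ∀ p, (F p).W →ₗ[k] N) (p : ℕ) (x : M p) :
    totalLift F N n (DirectSum.toModule k ℕ N φ) (col M p x) =
      (F p).lift N (n + p) (φ p) x := by
  have h : (DirectSum.toModule k ℕ N φ).comp (DirectSum.lof k ℕ (fun p => (F p).W) p) = φ p :=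
    LinearMap.ext fun w => by rw [LinearMap.comp_apply, DirectSum.toModule_lof]
  rw [totalLift_col, h]

/-- The generators of a total complex with free columns. -/
noncomputable def totalι {M : ℕ → DGBimod A} (F : ∀ p, FreeOn (M p)) :
    (⨁ p, (F p).W) →ₗ[k] ⨁ p, (M p).toDGMod :=
  DirectSum.toModule k ℕ _ fun p => (col M p).comp (F p).ι

theorem totalι_lof {M : ℕ → DGBimod A} (F : ∀ p, FreeOn (M p)) (p : ℕ) (w : (F p).W) :
    totalι F (DirectSum.lof k ℕ (fun p => (F p).W) p w) = col M p ((F p).ι w) := by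
  simp [totalι]

/-- The grading on the generators of a total complex. -/
def totalGenGr {M : ℕ → DGBimod A} (F : ∀ p, FreeOn (M p)) (n : ℤ) :
    Submodule k (⨁ p, (F p).W) :=
  ⨆ p : ℕ, ((F p).gr (n - p)).map (DirectSum.lof k ℕ (fun p => (F p).W) p)

theorem totalGenGr_induction {M : ℕ → DGBimod A} {F : ∀ p, FreeOn (M p)} {n : ℤ}
    {S : Submodule k (⨁ p, (F p).W)}
    (hS : ∀ (p : ℕ), ∀ w ∈ (F p).gr (n - p), DirectSum.lof k ℕ (fun p => (F p).W) p w ∈ S) :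
    totalGenGr F n ≤ S := by
  refine iSup_le fun p => ?_
  rintro _ ⟨w, hw, rfl⟩
  exact hS p w hw

theorem totalι_mem {M : ℕ → DGBimod A} (F : ∀ p, FreeOn (M p)) (n : ℤ) :
    ∀ w ∈ totalGenGr F n, totalι F w ∈ totalGr (fun p => (M p).toDGMod) n := by
  intro w hw
  rw [← Submodule.mem_comap (f := totalι F)]
  refine totalGenGr_induction (fun p w hw => ?_) hw
  rw [Submodule.mem_comap, totalι_lof]
  exact lof_mem_totalGr (M := fun p => (M p).toDGMod) p (by omega) ((F p).ι_mem _ w hw)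

theorem totalι_span {M : ℕ → DGBimod A} (F : ∀ p, FreeOn (M p)) (m : ℤ) :
    totalGr (fun p => (M p).toDGMod) m ≤
      Submodule.span k {z | ∃ i j l : ℤ, i + (l + j) = m ∧ ∃ a ∈ A.gr i, ∃ b ∈ A.gr j,
        ∃ w ∈ totalGenGr F l, z = totalL M a (totalR M b (totalι F w))} := by
  refine totalGr_induction fun p m' hm x hx => ?_
  refine (F p).gr_induction (S := Submodule.comap (col M p) (Submodule.span k _))
    (fun i j l h a ha b hb w hw => Submodule.mem_comap.2 (Submodule.subset_span ?_)) hx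
  refine ⟨i, j, p + l, by omega, A.toMod.tw p a, A.toMod.tw_mem _ ha, b, hb,
    DirectSum.lof k ℕ (fun p => (F p).W) p w, ?_, ?_⟩
  · exact Submodule.mem_iSup_of_mem p ⟨w, by rwa [add_sub_cancel_left], rfl⟩
  · rw [totalι_lof, totalR_col, totalL_col, A.toMod.tw_tw, A.toMod.tw_even ⟨p, rfl⟩]

/-- A total complex with free columns is free. -/
noncomputable def freeOnTotal {M : ℕ → DGBimod A} (F : ∀ p, FreeOn (M p))
    (D : ∀ p, Hom (M (p + 1)) (M p)) (hD : ∀ p x, (D p).toLin ((D (p + 1)).toLin x) = 0) :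
    FreeOn (total M D hD) where
  W := ⨁ p, (F p).W
  gr := totalGenGr F
  ι := totalι F
  ι_mem := totalι_mem F
  lift N n φ := totalLift F N n φ
  lift_ι N n φ w := by
    induction w using DirectSum.induction_on with
    | zero => simp
    | add x y hx hy => rw [map_add, map_add, hx, hy, map_add]
    | of p w =>
      have h := totalLift_col F N n φ p ((F p).ι w)
      rw [(F p).lift_ι] at h
      rw [← DirectSum.lof_eq_of k, totalι_lof]
      exact h
  lift_l N n φ a x := by
    induction x using total_induction with
    | zero => simp
    | add x y hx hy => simp only [map_add] at hx hy ⊢; rw [hx, hy]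
    | col p x =>
      rw [totalL_col, totalLift_col, totalLift_col, (F p).lift_l, A.toMod.tw_tw,
        A.toMod.tw_congr (p := n + p + p) (q := n) ⟨p, by ring⟩]
  lift_r N n φ a x := by
    induction x using total_induction with
    | zero => simp
    | add x y hx hy => simp only [map_add] at hx hy ⊢; rw [hx, hy]
    | col p x => rw [totalR_col, totalLift_col, totalLift_col, (F p).lift_r]
  span := totalι_span F

/-- A map out of a total complex has degree `n` if it does so on the generators of the columns; a
generator of internal degree `m - p` in column `p` has total degree `m`. -/
theorem total_lift_mem {M : ℕ → DGBimod A} (F : ∀ p, FreeOn (M p))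
    (D : ∀ p, Hom (M (p + 1)) (M p)) (hD : ∀ p x, (D p).toLin ((D (p + 1)).toLin x) = 0)
    {N : DGBimod A} {n : ℤ} {φ : ∀ p, (F p).W →ₗ[k] N}
    (hφ : ∀ (p : ℕ) (m : ℤ), ∀ w ∈ (F p).gr (m - p), φ p w ∈ N.gr (m - n)) :
    totalLift F N n (DirectSum.toModule k ℕ N φ) ∈ homGr (total M D hD) N n := by
  refine (freeOnTotal F D hD).lift_mem fun m w hw => ?_
  refine totalGenGr_induction (S := Submodule.comap (DirectSum.toModule k ℕ N φ) _)
    (fun p w hw => ?_) hw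
  rw [Submodule.mem_comap, DirectSum.toModule_lof]
  exact hφ p m w hw

theorem total_hom_mem {M : ℕ → DGBimod A} (F : ∀ p, FreeOn (M p))
    {D : ∀ p, Hom (M (p + 1)) (M p)} {hD : ∀ p x, (D p).toLin ((D (p + 1)).toLin x) = 0}
    {N : DGBimod A} {n : ℤ} {f : total M D hD →ₗ[k] N} (hf : f ∈ homGr (total M D hD) N n)
    {E : Submodule k N} (hl : ∀ a, ∀ x ∈ E, N.l a x ∈ E) (hr : ∀ a, ∀ x ∈ E, N.r a x ∈ E)
    (h : ∀ p w, f (col M p ((F p).ι w)) ∈ E) (x : total M D hD) : f x ∈ E := by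
  refine (freeOnTotal F D hD).hom_mem hf hl hr (fun w => ?_) x
  change f (totalι F w) ∈ E
  change (⨁ p, (F p).W) at w
  induction w using DirectSum.induction_on with
  | zero => rw [map_zero, map_zero]; exact zero_mem E
  | add x y hx hy => rw [map_add, map_add]; exact add_mem hx hy
  | of p w => rw [← DirectSum.lof_eq_of k, totalι_lof]; exact h p w

theorem total_hom_ext {M : ℕ → DGBimod A} (F : ∀ p, FreeOn (M p))
    {D : ∀ p, Hom (M (p + 1)) (M p)} {hD : ∀ p x, (D p).toLin ((D (p + 1)).toLin x) = 0}
    {N : DGBimod A} {n : ℤ} {f g : total M D hD →ₗ[k] N} (hf : f ∈ homGr (total M D hD) N n)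
    (hg : g ∈ homGr (total M D hD) N n)
    (h : ∀ p w, f (col M p ((F p).ι w)) = g (col M p ((F p).ι w))) : f = g := by
  refine LinearMap.ext fun x => ?_
  have h0 := total_hom_mem F (sub_mem hf hg) (E := ⊥) (fun a x hx => by simp_all)
    (fun a x hx => by simp_all) (fun p w => by simp [h]) x
  exact sub_eq_zero.1 ((Submodule.mem_bot k).1 h0)

/-- The part of a total complex in columns `≥ j`. -/
noncomputable def colsGE (M : ℕ → DGBimod A) (j : ℕ) : Submodule k (⨁ p, (M p).toDGMod) :=
  ⨆ p, LinearMap.range (col M (p + j))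

theorem col_mem_colsGE (M : ℕ → DGBimod A) {j p : ℕ} (h : j ≤ p) (x : M p) :
    col M p x ∈ colsGE M j := by
  obtain ⟨p, rfl⟩ := Nat.exists_eq_add_of_le' h
  exact Submodule.mem_iSup_of_mem p ⟨x, rfl⟩

theorem colsGE_induction {M : ℕ → DGBimod A} {j : ℕ} {S : Submodule k (⨁ p, (M p).toDGMod)}
    (h : ∀ p (x : M (p + j)), col M (p + j) x ∈ S) : colsGE M j ≤ S := by
  refine iSup_le fun p => ?_
  rintro _ ⟨x, rfl⟩
  exact h p x

theorem colsGE_anti (M : ℕ → DGBimod A) {i j : ℕ} (h : i ≤ j) : colsGE M j ≤ colsGE M i :=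
  colsGE_induction fun p x => col_mem_colsGE M (by omega) x

theorem totalL_mem_colsGE (M : ℕ → DGBimod A) (j : ℕ) (a : A) :
    ∀ x ∈ colsGE M j, totalL M a x ∈ colsGE M j := by
  intro x hx
  refine colsGE_induction (S := (colsGE M j).comap (totalL M a)) (fun p x => ?_) hx
  rw [Submodule.mem_comap, totalL_col]
  exact col_mem_colsGE M (by omega) _

theorem totalR_mem_colsGE (M : ℕ → DGBimod A) (j : ℕ) (a : A) :
    ∀ x ∈ colsGE M j, totalR M a x ∈ colsGE M j := by
  intro x hx
  refine colsGE_induction (S := (colsGE M j).comap (totalR M a)) (fun p x => ?_) hx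
  rw [Submodule.mem_comap, totalR_col]
  exact col_mem_colsGE M (by omega) _

theorem total_d_col_zero (M : ℕ → DGBimod A) (D : ∀ p, Hom (M (p + 1)) (M p))
    (hD : ∀ p x, (D p).toLin ((D (p + 1)).toLin x) = 0) (x : M 0) :
    (total M D hD).d (col M 0 x) = col M 0 ((M 0).d x) := by
  have h := totalD_lof (fun p => (M p).toDGMod) (fun p => (D p).toHom) 0 x
  rw [pow_zero, one_smul] at h
  exact h.trans (zero_add _)

theorem total_d_col_succ (M : ℕ → DGBimod A) (D : ∀ p, Hom (M (p + 1)) (M p))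
    (hD : ∀ p x, (D p).toLin ((D (p + 1)).toLin x) = 0) (p : ℕ) (x : M (p + 1)) :
    (total M D hD).d (col M (p + 1) x) =
      col M p ((D p).toLin x) + (-1 : ℤ) ^ (p + 1) • col M (p + 1) ((M (p + 1)).d x) :=
  totalD_lof (fun p => (M p).toDGMod) (fun p => (D p).toHom) (p + 1) x

theorem col_mem_gr (M : ℕ → DGBimod A) {m n : ℤ} (p : ℕ) (hn : p + m = n) {x : M p}
    (hx : x ∈ (M p).gr m) : col M p x ∈ totalGr (fun p => (M p).toDGMod) n :=
  lof_mem_totalGr (M := fun p => (M p).toDGMod) p hn hx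

theorem totalGr_neg {M : ℕ → DGMod k} (h : ∀ p, ∀ n : ℤ, n < 0 → (M p).gr n = ⊥) (n : ℤ)
    (hn : n < 0) : totalGr M n = ⊥ := by
  refine eq_bot_iff.2 (totalGr_induction fun p m hm x hx => ?_)
  rw [h p m (by omega), Submodule.mem_bot] at hx
  rw [hx, map_zero]; exact zero_mem _

theorem tensorGr_neg {M N : DGMod k} (hM : ∀ n : ℤ, n < 0 → M.gr n = ⊥)
    (hN : ∀ n : ℤ, n < 0 → N.gr n = ⊥) (n : ℤ) (hn : n < 0) : (tensor M N).gr n = ⊥ := by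
  refine eq_bot_iff.2 (tensorGr_induction fun i j h x hx y hy => ?_)
  rcases lt_or_ge i 0 with hi | hi
  · rw [hM i hi, Submodule.mem_bot] at hx
    rw [hx, TensorProduct.zero_tmul]; exact zero_mem _
  · rw [hN j (by omega), Submodule.mem_bot] at hy
    rw [hy, TensorProduct.tmul_zero]; exact zero_mem _

end DGBimod

/-! ### The bar resolution and the small resolution as free bimodules -/

namespace DGAlgebra

open DGMod DGBimod

variable {k : Type u} [CommRing k] {A : DGAlgebra k}

/-- The bar resolution is free on the tensors `1 ⊗ b₁ ⊗ ⋯ ⊗ bₚ ⊗ 1`. -/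
noncomputable def barFree (A : DGAlgebra k) : FreeOn A.bar :=
  freeOnTotal (fun p => freeOnFree A (A.tpow p)) A.barD A.barD_barD

theorem barFree_ι (p : ℕ) (t : A.tpow p) :
    A.barFree.ι (DirectSum.lof k ℕ (fun p => A.tpow p) p t) =
      col A.barCol p ((1 : A) ⊗ₜ[k] (t ⊗ₜ[k] (1 : A))) :=
  totalι_lof (fun p => freeOnFree A (A.tpow p)) p t

theorem tpow_neg (hA : ∀ n : ℤ, n < 0 → A.gr n = ⊥) :
    ∀ p, ∀ n : ℤ, n < 0 → (A.tpow p).gr n = ⊥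
  | 0, _, hn => if_neg hn.ne
  | p + 1, n, hn => tensorGr_neg (M := A.toMod) hA (tpow_neg hA p) n hn

theorem free_neg (hA : ∀ n : ℤ, n < 0 → A.gr n = ⊥) {W : DGMod k}
    (hW : ∀ n : ℤ, n < 0 → W.gr n = ⊥) (n : ℤ) (hn : n < 0) : (free A W).gr n = ⊥ :=
  tensorGr_neg (M := A.toMod) hA (tensorGr_neg (N := A.toMod) hW hA) n hn

theorem bar_neg (hA : ∀ n : ℤ, n < 0 → A.gr n = ⊥) (n : ℤ) (hn : n < 0) : A.bar.gr n = ⊥ :=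
  totalGr_neg (M := fun p => (A.barCol p).toDGMod) (fun p => free_neg hA (tpow_neg hA p)) n hn

/-- The extra degeneracy `b₀ ⊗ ⋯ ⊗ bₚ₊₁ ↦ 1 ⊗ b₀ ⊗ ⋯ ⊗ bₚ₊₁` of the bar resolution. -/
noncomputable def extraDeg (A : DGAlgebra k) : A.bar →ₗ[k] A.bar :=
  DirectSum.toModule k ℕ _ fun p =>
    (col A.barCol (p + 1)).comp ((A.iota p).toLin.comp (TensorProduct.mk k A (A.barCol p) 1))

theorem extraDeg_col (p : ℕ) (z : A.barCol p) :
    A.extraDeg (col A.barCol p z) =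
      col A.barCol (p + 1) ((A.iota p).toLin ((1 : A) ⊗ₜ[k] z)) := by
  simp [extraDeg]

theorem extraDeg_mem (n : ℤ) (x : A.bar) (hx : x ∈ A.bar.gr n) :
    A.extraDeg x ∈ A.bar.gr (n + 1) := by
  refine totalGr_induction (M := fun p => (A.barCol p).toDGMod)
    (S := (A.bar.gr (n + 1)).comap A.extraDeg) (fun p m hm x hx => ?_) hx
  have h := (A.iota p).map_gr m _ (tmul_mem_tensorGr (zero_add m) A.one_mem hx)
  have h2 := col_mem_gr A.barCol (n := n + 1) (p + 1) (by push_cast; omega) h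
  rw [← extraDeg_col] at h2
  exact h2

/-- The extra degeneracy contracts the columns `≥ 1`, for the total differential: it commutes with
the vertical differentials, which enter with opposite signs in adjacent columns. -/
theorem d_extraDeg (x : A.bar) (hx : x ∈ colsGE A.barCol 1) :
    A.bar.d (A.extraDeg x) + A.extraDeg (A.bar.d x) = x := by
  refine LinearMap.mem_eqLocus.1 (colsGE_induction (S := LinearMap.eqLocus
    (A.bar.d.comp A.extraDeg + A.extraDeg.comp A.bar.d) LinearMap.id) (fun p z => ?_) hx)
  rw [LinearMap.mem_eqLocus, LinearMap.add_apply, LinearMap.comp_apply, LinearMap.comp_apply,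
    LinearMap.id_apply, extraDeg_col]
  have h1 := total_d_col_succ A.barCol A.barD A.barD_barD (p + 1)
    ((A.iota (p + 1)).toLin ((1 : A) ⊗ₜ[k] z))
  have h2 := total_d_col_succ A.barCol A.barD A.barD_barD p z
  have h3 : (A.barCol (p + 2)).d ((A.iota (p + 1)).toLin ((1 : A) ⊗ₜ[k] z)) =
      (A.iota (p + 1)).toLin ((1 : A) ⊗ₜ[k] (A.barCol (p + 1)).d z) := by
    have h := (A.iota (p + 1)).map_d ((1 : A) ⊗ₜ[k] z)
    rw [tensor_d, A.d_one, A.tw_one_elem, TensorProduct.zero_tmul, zero_add] at h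
    exact h.symm
  rw [h3, A.barD_iota, (A.barCol (p + 1)).l_one, map_sub] at h1
  erw [h1, h2]
  rw [map_add, map_zsmul, extraDeg_col, extraDeg_col, pow_succ (-1 : ℤ) (p + 1),
    mul_neg_one, neg_smul]
  abel

end DGAlgebra

namespace QuasiFree

open DGMod DGBimod DGAlgebra

variable {k : Type u} [CommRing k] {A : DGAlgebra k}

/-- The columns of the small resolution are free, on `k`, `V` and `0`. -/
noncomputable def smallColFree (Q : QuasiFree A) : ∀ p, FreeOn (Q.smallCol p)
  | 0 => freeOnFree A (DGMod.unit k)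
  | 1 =>
    { W := Q.V
      gr := Q.gen.gr
      ι := freeι A Q.gen
      ι_mem := (freeOnFree A Q.gen).ι_mem
      lift := fun N n φ => twExtend (W := Q.gen) N n φ
      lift_ι := (freeOnFree A Q.gen).lift_ι
      lift_l := (freeOnFree A Q.gen).lift_l
      lift_r := (freeOnFree A Q.gen).lift_r
      span := (freeOnFree A Q.gen).span }
  | _ + 2 => freeOnZero A

/-- The small resolution is free on `1 ⊗ 1` and the elements `1 ⊗ v ⊗ 1`. -/
noncomputable def smallFree (Q : QuasiFree A) : FreeOn Q.small :=
  freeOnTotal Q.smallColFree Q.smallD (fun _ _ => map_zero _)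

theorem small_neg (Q : QuasiFree A) (hA : ∀ n : ℤ, n < 0 → A.gr n = ⊥) (n : ℤ) (hn : n < 0) :
    Q.small.gr n = ⊥ := by
  refine totalGr_neg (M := fun p => (Q.smallCol p).toDGMod) (fun p => ?_) n hn
  rcases p with _ | _ | p
  · exact free_neg hA (W := DGMod.unit k) fun n hn => if_neg hn.ne
  · refine free_neg hA (W := Q.gen) fun n hn => ?_
    refine eq_bot_iff.2 fun v hv => ?_
    have h : (v : A) ∈ A.gr n := hv
    rw [hA n hn, Submodule.mem_bot] at h
    exact (Submodule.mem_bot k).2 (Subtype.ext h)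
  · exact fun n _ => eq_bot_iff.2 fun x _ => (Submodule.mem_bot k).2 rfl

/-- Two bimodule maps out of the small resolution agree if they agree on `1 ⊗ 1` and on the
elements `1 ⊗ v ⊗ 1`. -/
theorem small_hom_ext (Q : QuasiFree A) {N : DGBimod A} {n : ℤ} {f g : Q.small →ₗ[k] N}
    (hf : f ∈ homGr Q.small N n) (hg : g ∈ homGr Q.small N n)
    (h0 : f (col Q.smallCol 0 ((1 : A) ⊗ₜ[k] ((1 : k) ⊗ₜ[k] (1 : A)))) =
      g (col Q.smallCol 0 ((1 : A) ⊗ₜ[k] ((1 : k) ⊗ₜ[k] (1 : A)))))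
    (h1 : ∀ v : Q.V, f (col Q.smallCol 1 ((1 : A) ⊗ₜ[k] (v ⊗ₜ[k] (1 : A)))) =
      g (col Q.smallCol 1 ((1 : A) ⊗ₜ[k] (v ⊗ₜ[k] (1 : A))))) : f = g := by
  refine total_hom_ext Q.smallColFree hf hg fun p w => ?_
  rcases p with _ | _ | p
  · change k at w
    have e : (Q.smallColFree 0).ι w =
        w • ((1 : A) ⊗ₜ[k] ((1 : k) ⊗ₜ[k] (1 : A)) : A ⊗[k] (k ⊗[k] A)) := by
      rw [← TensorProduct.tmul_smul, TensorProduct.smul_tmul', smul_eq_mul, mul_one]; rfl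
    rw [e]
    erw [map_smul (col Q.smallCol 0), map_smul f, map_smul g]
    rw [h0]
  · exact h1 w
  · have e : (Q.smallColFree (p + 2)).ι w = 0 := rfl
    rw [e, map_zero, map_zero, map_zero]

end QuasiFree

/-! ### The deformation retraction of the bar resolution -/

namespace DGBimod

open DGMod

variable {k : Type u} [CommRing k] {A : DGAlgebra k} {M N P : DGBimod A}

/-- A cocycle of degree `0` in `Hom(M, N)` is a morphism of dg bimodules. -/
noncomputable def homOfCocycle (f : M →ₗ[k] N) (hf : f ∈ homGr M N 0) (hd : homD M N 0 f = 0) :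
    Hom M N where
  toLin := f
  map_gr n x hx := by simpa using hf.1 n x hx
  map_d x := by
    have h := LinearMap.congr_fun hd x
    rw [homD_apply, Int.negOnePow_zero, Units.val_one, one_smul, LinearMap.zero_apply,
      sub_eq_zero] at h
    exact h.symm
  map_l a x := by rw [hf.2.1, A.toMod.tw_even (by decide)]
  map_r := hf.2.2

theorem Hom.mem_homGr (f : Hom M N) : f.toLin ∈ homGr M N 0 :=
  ⟨fun m x hx => by simpa using f.map_gr m x hx,
    fun a x => by rw [f.map_l, A.toMod.tw_even (by decide)], f.map_r⟩

theorem Hom.homD_eq_zero (f : Hom M N) : homD M N 0 f.toLin = 0 := by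
  ext x
  rw [homD_apply, f.map_d]
  simp

/-- Composition of morphisms of dg bimodules. -/
noncomputable def Hom.comp (g : Hom N P) (f : Hom M N) : Hom M P where
  toHom := g.toHom.comp f.toHom
  map_l a x := by
    change g.toLin (f.toLin _) = P.l a (g.toLin (f.toLin x))
    rw [f.map_l, g.map_l]
  map_r a x := by
    change g.toLin (f.toLin _) = P.r a (g.toLin (f.toLin x))
    rw [f.map_r, g.map_r]

/-- The identity morphism. -/
noncomputable def Hom.id (M : DGBimod A) : Hom M M where
  toLin := LinearMap.id
  map_gr _ _ hx := hx
  map_d _ := rfl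
  map_l _ _ := rfl
  map_r _ _ := rfl

end DGBimod

namespace QuasiFree

open DGMod DGBimod DGAlgebra

variable {k : Type u} [CommRing k] {A : DGAlgebra k} (Q : QuasiFree A)

/-- The values of the projection of the bar resolution onto the small resolution on the generators
`1 ⊗ b₁ ⊗ ⋯ ⊗ bₚ ⊗ 1`: it is `1 ⊗ 1` for `p = 0`, the universal derivation for `p = 1`, and zero
for `p ≥ 2`. -/
noncomputable def projGen : ∀ p, A.tpow p →ₗ[k] Q.small
  | 0 => (col Q.smallCol 0).comp (freeι A (DGMod.unit k))
  | 1 => (col Q.smallCol 1).comp (Q.univD.comp (TensorProduct.rid k A).toLinearMap)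
  | _ + 2 => 0

/-- The projection of the bar resolution onto the small resolution. -/
noncomputable def projLin : A.bar →ₗ[k] Q.small :=
  totalLift (fun p => freeOnFree A (A.tpow p)) Q.small 0 (DirectSum.toModule k ℕ _ Q.projGen)

theorem projLin_col (p : ℕ) (x : A) (t : A.tpow p) (y : A) :
    Q.projLin (col A.barCol p (x ⊗ₜ[k] (t ⊗ₜ[k] y))) =
      Q.small.l (A.toMod.tw p x) (Q.small.r y (Q.projGen p t)) := by
  have h := totalLift_toModule_col (fun p => freeOnFree A (A.tpow p)) Q.small 0 Q.projGen p
    (x ⊗ₜ[k] (t ⊗ₜ[k] y))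
  rw [zero_add] at h
  exact h.trans (twExtend_tmul Q.small p (Q.projGen p) x t y)

theorem projLin_zero (z : A.barCol 0) : Q.projLin (col A.barCol 0 z) = col Q.smallCol 0 z := by
  induction z using free_induction with
  | zero => rw [map_zero, map_zero, map_zero]
  | add x y hx hy => rw [map_add, map_add, hx, hy, map_add]
  | tmul x t y =>
    rw [projLin_col]
    have h1 : Q.small.r y (Q.projGen 0 t) =
        col Q.smallCol 0 ((Q.smallCol 0).r y (freeι A (DGMod.unit k) t)) :=
      totalR_col Q.smallCol 0 y _
    rw [h1]
    refine (totalL_col Q.smallCol 0 _ _).trans ?_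
    rw [A.toMod.tw_tw, A.toMod.tw_even (by decide)]
    exact congrArg _ (l_r_freeι _ x y t)

theorem projLin_one (x : A) (t : A.tpow 1) (y : A) :
    Q.projLin (col A.barCol 1 (x ⊗ₜ[k] (t ⊗ₜ[k] y))) = col Q.smallCol 1
      (Q.freeGen.l x (Q.freeGen.r y (Q.univD (TensorProduct.rid k A t)))) := by
  rw [projLin_col]
  have h1 : Q.small.r y (Q.projGen 1 t) =
      col Q.smallCol 1 ((Q.smallCol 1).r y (Q.univD (TensorProduct.rid k A t))) :=
    totalR_col Q.smallCol 1 y _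
  rw [h1]
  refine (totalL_col Q.smallCol 1 _ _).trans ?_
  rw [A.toMod.tw_tw, A.toMod.tw_even (by decide)]

theorem projLin_add_two (p : ℕ) (z : A.barCol (p + 2)) :
    Q.projLin (col A.barCol (p + 2) z) = 0 := by
  induction z using free_induction with
  | zero => rw [map_zero, map_zero]
  | add x y hx hy => rw [map_add, map_add, hx, hy, add_zero]
  | tmul x t y =>
    rw [projLin_col]
    have h1 : Q.projGen (p + 2) t = 0 := rfl
    rw [h1, map_zero, map_zero]

theorem projLin_mem : Q.projLin ∈ homGr A.bar Q.small 0 := by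
  refine total_lift_mem (fun p => freeOnFree A (A.tpow p)) A.barD A.barD_barD fun p m t ht => ?_
  rw [sub_zero]
  rcases p with _ | _ | p
  · exact col_mem_gr Q.smallCol 0 (by simp) (freeι_mem (DGMod.unit k) ht)
  · refine col_mem_gr Q.smallCol 1 (m := m - 1) (by simp) (Q.univD_mem _ _ ?_)
    have h : (A.tpow 1).gr (m - 1) ≤ (A.gr (m - 1)).comap (TensorProduct.rid k A).toLinearMap := by
      refine tensorGr_induction fun i j hij a ha c hc => ?_
      rw [Submodule.mem_comap, LinearEquiv.coe_coe, TensorProduct.rid_tmul]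
      by_cases hj : j = 0
      · rw [← hij, hj, add_zero]
        exact Submodule.smul_mem _ _ ha
      · have hc' : c ∈ (if j = 0 then ⊤ else ⊥ : Submodule k k) := hc
        rw [if_neg hj, Submodule.mem_bot] at hc'
        rw [hc', zero_smul]; exact zero_mem _
    exact h ht
  · exact zero_mem _

theorem projLin_colsGE (z : A.bar) (hz : z ∈ colsGE A.barCol 2) : Q.projLin z = 0 :=
  colsGE_induction (S := LinearMap.ker Q.projLin) (fun p x => Q.projLin_add_two p x) hz

theorem freeι_d (W : DGMod k) (w : W) :
    (DGBimod.free A W).d (freeι A W w) = freeι A W (W.d w) := by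
  rw [freeι_apply, free_d, A.d_one, A.tw_one_elem, TensorProduct.zero_tmul, zero_add,
    TensorProduct.tmul_zero, add_zero, freeι_apply]

theorem barD_freeι (p : ℕ) (t : A.tpow (p + 1)) :
    (A.barD p).toLin (freeι A (A.tpow (p + 1)) t) = (A.beta p).toLin t := by
  rw [freeι_apply, barD_tmul, (DGBimod.free A _).l_one, (DGBimod.free A _).r_one]

theorem bar_d_freeι_zero (t : A.tpow 0) :
    A.bar.d (col A.barCol 0 (freeι A (A.tpow 0) t)) = 0 := by
  have h := total_d_col_zero A.barCol A.barD A.barD_barD (freeι A (A.tpow 0) t)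
  rw [freeι_d] at h
  exact h.trans (by rw [LinearMap.zero_apply, map_zero, map_zero])

theorem bar_d_freeι (p : ℕ) (t : A.tpow (p + 1)) :
    A.bar.d (col A.barCol (p + 1) (freeι A (A.tpow (p + 1)) t)) =
      col A.barCol p ((A.beta p).toLin t) +
        (-1 : ℤ) ^ (p + 1) • col A.barCol (p + 1) (freeι A _ ((A.tpow (p + 1)).d t)) := by
  have h := total_d_col_succ A.barCol A.barD A.barD_barD p (freeι A (A.tpow (p + 1)) t)
  rw [freeι_d, barD_freeι] at h
  exact h

theorem small_d_zero (c : k) :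
    Q.small.d (col Q.smallCol 0 (freeι A (DGMod.unit k) c)) = 0 := by
  have h1 := freeι_d (A := A) (DGMod.unit k) c
  rw [LinearMap.zero_apply, map_zero] at h1
  have h2 := total_d_col_zero Q.smallCol Q.smallD (fun _ _ => map_zero _)
    (freeι A (DGMod.unit k) c)
  exact h2.trans ((congrArg (col Q.smallCol 0) h1).trans (map_zero _))

theorem small_d_one (z : Q.freeGen) :
    Q.small.d (col Q.smallCol 1 z) =
      col Q.smallCol 0 (Q.extendDiff z) + (-1 : ℤ) ^ 1 • col Q.smallCol 1 (Q.omegaD z) :=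
  total_d_col_succ Q.smallCol Q.smallD (fun _ _ => map_zero _) 0 z

theorem projLin_freeι_one (t : A.tpow 1) :
    Q.projLin (col A.barCol 1 (freeι A (A.tpow 1) t)) = col Q.smallCol 1
      (Q.univD (TensorProduct.rid k A t)) := by
  rw [freeι_apply, projLin_one, Q.freeGen.l_one, Q.freeGen.r_one]

/-- The projection commutes with the differentials. On generators of column `2` this is the Leibniz
rule of the universal derivation; in the columns `≤ 1` it is its compatibility with the
differentials of the small resolution. -/
theorem homD_projLin : homD A.bar Q.small 0 Q.projLin = 0 := by
  refine total_hom_ext (fun p => freeOnFree A (A.tpow p)) (homD_mem _ _ 0 Q.projLin_mem)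
    (zero_mem _) fun p t => ?_
  change A.tpow p at t
  rw [homD_apply, Int.negOnePow_zero, Units.val_one, one_smul, LinearMap.zero_apply, sub_eq_zero]
  change Q.small.d (Q.projLin (col A.barCol p (freeι A _ t))) =
    Q.projLin (A.bar.d (col A.barCol p (freeι A _ t)))
  rcases p with _ | _ | _ | p
  · rw [bar_d_freeι_zero, map_zero, projLin_zero]
    exact Q.small_d_zero t
  · induction t using TensorProduct.induction_on with
    | zero => simp only [map_zero]
    | add x y hx hy => simp only [map_add, hx, hy]
    | tmul a c =>
      have hd : (A.tpow 1).d (a ⊗ₜ[k] c) = A.d a ⊗ₜ[k] c := by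
        rw [tensor_d, LinearMap.zero_apply, TensorProduct.tmul_zero, add_zero]
      have e1 : (c • a) ⊗ₜ[k] ((1 : k) ⊗ₜ[k] (1 : A)) = a ⊗ₜ[k] (c ⊗ₜ[k] (1 : A)) := by
        rw [TensorProduct.smul_tmul, TensorProduct.smul_tmul', smul_eq_mul, mul_one]
      have e2 : (1 : k) ⊗ₜ[k] (c • a) = c ⊗ₜ[k] a := by
        rw [← TensorProduct.smul_tmul, smul_eq_mul, mul_one]
      rw [projLin_freeι_one, bar_d_freeι, map_add, map_zsmul, projLin_zero, projLin_freeι_one, hd,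
        TensorProduct.rid_tmul, TensorProduct.rid_tmul, beta_zero, small_d_one, extendDiff_univD,
        omegaD_univD, map_smul A.d, e1, e2]
  · have h0 : Q.projLin (col A.barCol 1 ((A.beta 1).toLin t)) = 0 := by
      induction t using TensorProduct.induction_on with
      | zero => simp only [map_zero]
      | add x y hx hy => simp only [map_add, hx, hy, add_zero]
      | tmul a t =>
        induction t using TensorProduct.induction_on with
        | zero => simp only [TensorProduct.tmul_zero, map_zero]
        | add x y hx hy => simp only [TensorProduct.tmul_add, map_add, hx, hy, add_zero]
        | tmul b c =>
          rw [beta_succ, beta_zero, TensorProduct.tmul_sub, map_sub (A.iota 0).toLin, iota_tmul,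
            iota_tmul, map_sub, map_sub, map_sub, map_sub, projLin_one, projLin_one, projLin_one,
            TensorProduct.rid_tmul, TensorProduct.rid_tmul, TensorProduct.rid_tmul, Q.freeGen.r_one,
            Q.freeGen.r_one, Q.freeGen.l_one, Q.freeGen.l_one, mul_one]
          have hm : Q.univD (c • (a * b)) =
              Q.freeGen.l a (Q.univD (c • b)) + Q.freeGen.r b (Q.univD (c • a)) := by
            rw [map_smul, map_smul, map_smul, univD_mul, smul_add, map_smul, map_smul]
          rw [hm, map_add, add_sub_cancel_right, sub_self]
    rw [bar_d_freeι, map_add, map_zsmul, projLin_add_two, projLin_add_two, h0, map_zero, smul_zero,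
      add_zero]
  · rw [bar_d_freeι, map_add, map_zsmul, projLin_add_two, projLin_add_two, projLin_add_two,
      map_zero, smul_zero, add_zero]

/-- The projection of the bar resolution onto the small resolution is a morphism of dg bimodules. -/
noncomputable def proj : DGBimod.Hom A.bar Q.small :=
  homOfCocycle Q.projLin Q.projLin_mem Q.homD_projLin

/-- The values on generators of the inclusion of the small resolution, up to columns `≥ 2`. -/
noncomputable def inclGen : ∀ p, (Q.smallColFree p).W →ₗ[k] A.bar
  | 0 => (col A.barCol 0).comp (freeι A (DGMod.unit k))
  | 1 => (col A.barCol 1).comp ((freeι A (A.tpow 1)).comp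
      (((TensorProduct.mk k A k).flip 1).comp Q.V.subtype))
  | _ + 2 => 0

/-- The bimodule map with `1 ⊗ 1 ↦ 1 ⊗ 1` and `1 ⊗ v ⊗ 1 ↦ 1 ⊗ v ⊗ 1`. It commutes with the
horizontal differentials, but not with the vertical ones. -/
noncomputable def inclLin : Q.small →ₗ[k] A.bar :=
  totalLift Q.smallColFree A.bar 0 (DirectSum.toModule k ℕ _ Q.inclGen)

theorem inclLin_mem : Q.inclLin ∈ homGr Q.small A.bar 0 := by
  refine total_lift_mem Q.smallColFree Q.smallD (fun _ _ => map_zero _) fun p m w hw => ?_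
  rw [sub_zero]
  rcases p with _ | _ | p
  · exact col_mem_gr A.barCol 0 (by simp) (freeι_mem (DGMod.unit k) hw)
  · have h1 : (1 : k) ∈ (DGMod.unit k).gr 0 := by simp
    exact col_mem_gr A.barCol 1 (m := m - 1) (by simp) (freeι_mem (A.tpow 1)
      (tmul_mem_tensorGr (add_zero _) hw h1))
  · exact zero_mem _

theorem twExtend_col_freeι (p : ℕ) (z : A.barCol p) :
    twExtend A.bar p ((col A.barCol p).comp (freeι A (A.tpow p))) z = col A.barCol p z := by
  induction z using free_induction with
  | zero => rw [map_zero, map_zero]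
  | add x y hx hy => rw [map_add, map_add, hx, hy]
  | tmul x t y =>
    rw [twExtend_tmul, LinearMap.comp_apply]
    have h1 : A.bar.r y (col A.barCol p (freeι A (A.tpow p) t)) =
        col A.barCol p ((A.barCol p).r y (freeι A (A.tpow p) t)) := totalR_col A.barCol p y _
    rw [h1]
    refine (totalL_col A.barCol p _ _).trans ?_
    rw [A.toMod.tw_tw, A.toMod.tw_even ⟨p, rfl⟩]
    exact congrArg _ (l_r_freeι _ x y t)

theorem inclLin_zero (z : A.barCol 0) : Q.inclLin (col Q.smallCol 0 z) = col A.barCol 0 z :=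
  (totalLift_toModule_col Q.smallColFree A.bar 0 Q.inclGen 0 z).trans (twExtend_col_freeι 0 z)

theorem inclLin_one_gen (v : Q.V) :
    Q.inclLin (col Q.smallCol 1 ((1 : A) ⊗ₜ[k] (v ⊗ₜ[k] (1 : A)))) =
      col A.barCol 1 (freeι A (A.tpow 1) ((v : A) ⊗ₜ[k] (1 : k))) := by
  have h := totalLift_toModule_col Q.smallColFree A.bar 0 Q.inclGen 1
    ((1 : A) ⊗ₜ[k] (v ⊗ₜ[k] (1 : A)))
  exact h.trans ((Q.smallColFree 1).lift_ι A.bar _ (Q.inclGen 1) v)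

theorem inclLin_one_mem (z : Q.smallCol 1) :
    Q.inclLin (col Q.smallCol 1 z) ∈ colsGE A.barCol 1 := by
  have h2 : ∀ (n : ℤ) (φ : Q.gen →ₗ[k] A.bar), (∀ v, φ v ∈ colsGE A.barCol 1) →
      ∀ z : A ⊗[k] (Q.gen ⊗[k] A), twExtend A.bar n φ z ∈ colsGE A.barCol 1 := by
    intro n φ hφ z
    induction z using free_induction with
    | zero => rw [map_zero]; exact zero_mem _
    | add x y hx hy => rw [map_add]; exact add_mem hx hy
    | tmul x v y =>
      rw [twExtend_tmul]
      exact totalL_mem_colsGE _ _ _ _ (totalR_mem_colsGE _ _ _ _ (hφ v))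
  exact Set.mem_of_eq_of_mem (totalLift_toModule_col Q.smallColFree A.bar 0 Q.inclGen 1 z)
    (h2 (0 + (1 : ℕ)) (Q.inclGen 1) (fun v => col_mem_colsGE _ le_rfl _) z)

theorem extraDeg_mem_colsGE {j : ℕ} (x : A.bar) (hx : x ∈ colsGE A.barCol j) :
    A.extraDeg x ∈ colsGE A.barCol (j + 1) := by
  refine colsGE_induction (S := (colsGE A.barCol (j + 1)).comap A.extraDeg) (fun p z => ?_) hx
  rw [Submodule.mem_comap, extraDeg_col]
  exact col_mem_colsGE _ (by omega) _

theorem homD_inclLin_one_gen (v : Q.V) :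
    A.bar.d (Q.inclLin (col Q.smallCol 1 ((1 : A) ⊗ₜ[k] (v ⊗ₜ[k] (1 : A))))) -
      Q.inclLin (Q.small.d (col Q.smallCol 1 ((1 : A) ⊗ₜ[k] (v ⊗ₜ[k] (1 : A))))) ∈
        colsGE A.barCol 1 := by
  rw [small_d_one, map_add, map_zsmul, inclLin_zero, inclLin_one_gen, bar_d_freeι, beta_zero,
    extendDiff_tmul, one_mul, mul_one, add_sub_add_left_eq_sub]
  exact sub_mem (zsmul_mem (col_mem_colsGE _ le_rfl _) _) (zsmul_mem (Q.inclLin_one_mem _) _)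

theorem homD_inclLin_zero_gen (c : k) :
    A.bar.d (Q.inclLin (col Q.smallCol 0 (freeι A (DGMod.unit k) c))) -
      Q.inclLin (Q.small.d (col Q.smallCol 0 (freeι A (DGMod.unit k) c))) ∈
        colsGE A.barCol 1 := by
  have h : A.bar.d (col A.barCol 0 (freeι A (DGMod.unit k) c)) = 0 := bar_d_freeι_zero c
  rw [small_d_zero, inclLin_zero, h, map_zero, sub_zero]
  exact zero_mem _

/-- The failure of `inclLin` to be a chain map lies in the columns `≥ 1`, which the extra degeneracy
contracts. -/
theorem homD_inclLin_mem (x : Q.small) :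
    homD Q.small A.bar 0 Q.inclLin x ∈ colsGE A.barCol 1 := by
  refine total_hom_mem Q.smallColFree (homD_mem _ _ 0 Q.inclLin_mem)
    (totalL_mem_colsGE A.barCol 1) (totalR_mem_colsGE A.barCol 1) (fun p w => ?_) x
  rw [homD_apply, Int.negOnePow_zero, Units.val_one, one_smul]
  rcases p with _ | _ | p
  · exact Q.homD_inclLin_zero_gen w
  · exact Q.homD_inclLin_one_gen w
  · have h : (Q.smallColFree (p + 2)).ι w = 0 := rfl
    rw [h, map_zero, map_zero, map_zero, map_zero, map_zero, sub_zero]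
    exact zero_mem _

/-- The inclusion of the small resolution into the bar resolution, whose components in the columns
`≥ 2` correct the failure of `inclLin` to commute with the vertical differentials. -/
theorem exists_incl (hA : ∀ n : ℤ, n < 0 → A.gr n = ⊥) :
    ∃ i : DGBimod.Hom Q.small A.bar, ∀ x, i.toLin x - Q.inclLin x ∈ colsGE A.barCol 2 := by
  obtain ⟨f, hf, hfd, hfE, -⟩ := exists_homD_eq hA Q.smallFree (Q.small_neg hA) A.extraDeg
    extraDeg_mem (E := colsGE A.barCol 1) (E' := colsGE A.barCol 2) (colsGE_anti _ one_le_two)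
    (totalL_mem_colsGE _ 2) (totalR_mem_colsGE _ 2) extraDeg_mem_colsGE
    (fun x hx hd => by
      have h := d_extraDeg x hx
      rwa [hd, map_zero, add_zero] at h)
    (m := 1) (n := 0) rfl (g := - homD Q.small A.bar 0 Q.inclLin)
    (neg_mem (homD_mem _ _ 0 Q.inclLin_mem))
    (by
      rw [map_neg]
      exact neg_eq_zero.2 (homD_homD _ _ 0 _))
    (fun x => neg_mem (Q.homD_inclLin_mem x))
  refine ⟨homOfCocycle (Q.inclLin + f) (add_mem Q.inclLin_mem hf)
    (by rw [map_add, hfd, add_neg_cancel]), fun x => ?_⟩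
  change Q.inclLin x + f x - Q.inclLin x ∈ _
  rw [add_sub_cancel_left]
  exact hfE x

/-- The correction terms of the inclusion lie in columns that the projection kills. -/
theorem proj_incl {i : DGBimod.Hom Q.small A.bar}
    (hi : ∀ x, i.toLin x - Q.inclLin x ∈ colsGE A.barCol 2) (x : Q.small) :
    Q.proj.toLin (i.toLin x) = x := by
  have h1 : ∀ x, Q.projLin (i.toLin x) = Q.projLin (Q.inclLin x) := fun x => by
    rw [← sub_eq_zero, ← map_sub]
    exact Q.projLin_colsGE _ (hi x)
  refine LinearMap.congr_fun (Q.small_hom_ext (f := (Q.proj.comp i).toLin)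
    (g := (DGBimod.Hom.id Q.small).toLin) (DGBimod.Hom.mem_homGr _) (DGBimod.Hom.mem_homGr _)
    ?_ fun v => ?_) x
  · refine (h1 _).trans ?_
    rw [inclLin_zero, projLin_zero]
    rfl
  · refine (h1 _).trans ?_
    rw [inclLin_one_gen, projLin_freeι_one, TensorProduct.rid_tmul, one_smul, univD_gen]
    rfl

/-- The span of the degenerate tensors in the bar resolution. -/
noncomputable def barDegenTotal (A : DGAlgebra k) : Submodule k A.bar :=
  ⨆ p, (Submodule.span k (A.barDegen p)).map (col A.barCol p)

theorem barDegenTotal_induction {S : Submodule k A.bar}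
    (h : ∀ p, ∀ z ∈ A.barDegen p, col A.barCol p z ∈ S) : barDegenTotal A ≤ S :=
  iSup_le fun p => Submodule.map_le_iff_le_comap.2 (Submodule.span_le.2 (h p))

theorem col_mem_barDegenTotal (p : ℕ) {z : A.barCol p} (hz : z ∈ Submodule.span k (A.barDegen p)) :
    col A.barCol p z ∈ barDegenTotal A :=
  Submodule.mem_iSup_of_mem p ⟨z, hz, rfl⟩

theorem barDegenTotal_l (a : A) : ∀ x ∈ barDegenTotal A, A.bar.l a x ∈ barDegenTotal A := by
  intro x hx
  refine barDegenTotal_induction (S := (barDegenTotal A).comap (A.bar.l a))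
    (fun p z hz => Submodule.mem_comap.2 ?_) hx
  exact Set.mem_of_eq_of_mem (totalL_col A.barCol p a z)
    (col_mem_barDegenTotal p (A.barDegen_l p _ z hz))

theorem barDegenTotal_r (a : A) : ∀ x ∈ barDegenTotal A, A.bar.r a x ∈ barDegenTotal A := by
  intro x hx
  refine barDegenTotal_induction (S := (barDegenTotal A).comap (A.bar.r a))
    (fun p z hz => Submodule.mem_comap.2 ?_) hx
  exact Set.mem_of_eq_of_mem (totalR_col A.barCol p a z)
    (col_mem_barDegenTotal p (A.barDegen_r p _ z hz))

theorem barDegenTotal_d : ∀ x ∈ barDegenTotal A, A.bar.d x ∈ barDegenTotal A := by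
  intro x hx
  refine barDegenTotal_induction (S := (barDegenTotal A).comap A.bar.d)
    (fun p z hz => Submodule.mem_comap.2 ?_) hx
  cases p with
  | zero =>
    exact Set.mem_of_eq_of_mem (total_d_col_zero A.barCol A.barD A.barD_barD z)
      (col_mem_barDegenTotal 0 (A.barDegen_d 0 z hz))
  | succ p =>
    exact Set.mem_of_eq_of_mem (total_d_col_succ A.barCol A.barD A.barD_barD p z)
      (add_mem (col_mem_barDegenTotal p (A.barD_mem_barDegen p z hz))
        (zsmul_mem (col_mem_barDegenTotal _ (A.barDegen_d _ z hz)) _))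

theorem barDegenTotal_extraDeg : ∀ x ∈ barDegenTotal A, A.extraDeg x ∈ barDegenTotal A := by
  intro x hx
  refine barDegenTotal_induction (S := (barDegenTotal A).comap A.extraDeg) (fun p z hz => ?_) hx
  rw [Submodule.mem_comap, extraDeg_col]
  exact col_mem_barDegenTotal _ (A.iota_mem_barDegen p 1 (Submodule.subset_span hz))

/-- The degenerate tensors are generated by degenerate generators `1 ⊗ t ⊗ 1`. -/
theorem barDegenTotal_span : barDegenTotal A ≤ Submodule.span k {z | ∃ a b w,
    A.barFree.ι w ∈ barDegenTotal A ∧ z = A.bar.l a (A.bar.r b (A.barFree.ι w))} := by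
  refine barDegenTotal_induction ?_
  rintro p _ ⟨m, n, x, hx, t, ht, y, hy, rfl⟩
  refine Submodule.subset_span ⟨A.toMod.tw p x, y,
    DirectSum.lof k ℕ (fun p => A.tpow p) p t, ?_, ?_⟩
  · exact Set.mem_of_eq_of_mem (barFree_ι p t)
      (col_mem_barDegenTotal p (A.tmul_mem_barDegen p _ _ (Submodule.subset_span ht)))
  · have h1 : A.bar.r y (col A.barCol p (freeι A (A.tpow p) t)) =
        col A.barCol p ((A.barCol p).r y (freeι A (A.tpow p) t)) := totalR_col A.barCol p y _
    have h2 := totalL_col A.barCol p (A.toMod.tw p x) ((A.barCol p).r y (freeι A (A.tpow p) t))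
    rw [A.toMod.tw_tw, A.toMod.tw_even ⟨p, rfl⟩, l_r_freeι] at h2
    rw [← h2, ← h1]
    exact congrArg (fun z => A.bar.l _ (A.bar.r y z)) (barFree_ι p t).symm

theorem projLin_barDegenTotal : ∀ x ∈ barDegenTotal A, Q.projLin x = 0 := by
  intro x hx
  refine barDegenTotal_induction (S := LinearMap.ker Q.projLin) ?_ hx
  rintro p _ ⟨m, n, x, hx, t, ht, y, hy, rfl⟩
  rw [LinearMap.mem_ker]
  rcases p with _ | _ | p
  · exact ht.elim
  · rcases ht with ⟨j, c, hc, rfl⟩ | ⟨j, a, ha, t, ht, rfl⟩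
    · rw [projLin_one, TensorProduct.rid_tmul, map_smul, univD_one, smul_zero, map_zero, map_zero,
        map_zero]
    · exact ht.elim
  · exact Q.projLin_add_two p _

/-- The bar resolution retracts onto the small resolution, by a homotopy that preserves the
degenerate tensors. -/
theorem exists_retract_bar (hA : ∀ n : ℤ, n < 0 → A.gr n = ⊥) :
    ∃ R : Retract Q.small A.bar, R.π = Q.proj ∧ ∀ x ∈ barDegenTotal A, R.h x ∈ barDegenTotal A := by
  obtain ⟨i, hi⟩ := Q.exists_incl hA
  let ip : DGBimod.Hom A.bar A.bar := i.comp Q.proj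
  have hip : ∀ x, ip.toLin x = i.toLin (Q.projLin x) := fun x => rfl
  -- on column `0` the maps `i π` and `1` agree up to terms in columns `≥ 2`, and both send the
  -- columns `≥ 1` to columns `≥ 1`
  have hE : ∀ x, ip.toLin x - x ∈ colsGE A.barCol 1 := by
    intro x
    have hmem : ∀ x, i.toLin x - Q.inclLin x ∈ colsGE A.barCol 1 :=
      fun x => colsGE_anti _ one_le_two (hi x)
    induction x using total_induction with
    | zero => rw [map_zero, sub_zero]; exact zero_mem _
    | add x y hx hy => rw [map_add, add_sub_add_comm]; exact add_mem hx hy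
    | col p z =>
      rw [hip]
      rcases p with _ | _ | p
      · have h := hmem (col Q.smallCol 0 z)
        rw [inclLin_zero] at h
        rwa [projLin_zero]
      · refine sub_mem ?_ (col_mem_colsGE _ le_rfl _)
        have h1 : ∀ z : A.barCol 1, Q.projLin (col A.barCol 1 z) ∈
            LinearMap.range (col Q.smallCol 1) := by
          intro z
          induction z using free_induction with
          | zero => rw [map_zero, map_zero]; exact zero_mem _
          | add x y hx hy => rw [map_add, map_add]; exact add_mem hx hy
          | tmul x t y => rw [projLin_one]; exact ⟨_, rfl⟩
        obtain ⟨u, hu⟩ := h1 z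
        rw [← hu, ← sub_add_cancel (i.toLin (col Q.smallCol 1 u)) (Q.inclLin (col Q.smallCol 1 u))]
        exact add_mem (hmem _) (Q.inclLin_one_mem u)
      · rw [projLin_add_two, map_zero, zero_sub]
        exact neg_mem (col_mem_colsGE _ (by omega) _)
  obtain ⟨f, hf, hfd, hfE, hfT⟩ := exists_homD_eq hA A.barFree (bar_neg hA) A.extraDeg
    extraDeg_mem (E := colsGE A.barCol 1) (E' := colsGE A.barCol 2) (colsGE_anti _ one_le_two)
    (totalL_mem_colsGE _ 2) (totalR_mem_colsGE _ 2) extraDeg_mem_colsGE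
    (fun x hx hd => by
      have h := d_extraDeg x hx
      rwa [hd, map_zero, add_zero] at h)
    (m := 0) (n := -1) rfl (g := ip.toLin - (DGBimod.Hom.id A.bar).toLin)
    (sub_mem ip.mem_homGr (DGBimod.Hom.mem_homGr _))
    (by rw [map_sub, ip.homD_eq_zero, DGBimod.Hom.homD_eq_zero, sub_zero])
    hE
  refine ⟨
    { i := i
      π := Q.proj
      h := f
      h_gr := fun n x hx => by simpa using hf.1 n x hx
      h_l := fun a x => by rw [hf.2.1, A.toMod.tw_congr (p := -1) (q := 1) (by decide)]
      h_r := hf.2.2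
      π_i := Q.proj_incl hi
      htpy := fun x => by
        have h := LinearMap.congr_fun hfd x
        rw [homD_apply] at h
        rw [Int.negOnePow_neg, Int.negOnePow_one, Units.val_neg, Units.val_one, neg_smul, one_smul,
          sub_neg_eq_add] at h
        exact h.symm }, rfl, ?_⟩
  refine hfT _ _ barDegenTotal_span barDegenTotal_d barDegenTotal_l barDegenTotal_r
    barDegenTotal_extraDeg fun x hx => ?_
  change i.toLin (Q.projLin x) - x ∈ _
  rw [Q.projLin_barDegenTotal x hx, map_zero, zero_sub]
  exact neg_mem hx

end QuasiFree

/-! ### Descent to the normalized bar resolution -/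

namespace QuasiFree

open DGMod DGBimod DGAlgebra

variable {k : Type u} [CommRing k] {A : DGAlgebra k} (Q : QuasiFree A)

/-- The universal derivation on a product of generators. -/
theorem univD_prod_ofFn (n : ℕ) (v : Fin n → Q.V) :
    Q.univD (List.ofFn fun i => (v i : A)).prod =
      ∑ i : Fin n, ((List.ofFn fun j => (v j : A)).take i).prod ⊗ₜ[k]
        (v i ⊗ₜ[k] ((List.ofFn fun j => (v j : A)).drop (i + 1)).prod) := by
  induction n with
  | zero => simpa using Q.univD_one
  | succ n ih =>
    have h := ih fun i => v i.succ
    rw [List.ofFn_succ, List.prod_cons, univD_mul, h, univD_gen, free_r, one_mul,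
      Fin.sum_univ_succ, map_sum, add_comm]
    simp only [Fin.val_zero, List.take_zero, List.prod_nil, Fin.val_succ,
      List.take_succ_cons, List.prod_cons, List.drop_succ_cons, List.drop_zero]
    rfl

/-- The value of the projection on `1 ⊗ v₁ ⋯ vₙ ⊗ 1`. -/
theorem projLin_prod (n : ℕ) (v : Fin n → Q.V) :
    Q.projLin (col A.barCol 1
      ((1 : A) ⊗ₜ[k] (((List.ofFn fun i => (v i : A)).prod ⊗ₜ[k] (1 : k)) ⊗ₜ[k] (1 : A)))) =
    ∑ i : Fin n, col Q.smallCol 1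
      (((List.ofFn fun j => (v j : A)).take i).prod ⊗ₜ[k]
        (v i ⊗ₜ[k] ((List.ofFn fun j => (v j : A)).drop (i + 1)).prod)) := by
  rw [projLin_one, Q.freeGen.l_one, Q.freeGen.r_one, TensorProduct.rid_tmul, one_smul,
    univD_prod_ofFn, map_sum]

end QuasiFree

namespace DGAlgebra

open DGMod DGBimod QuasiFree

variable {k : Type u} [CommRing k] {A : DGAlgebra k}

/-- The projection of the bar resolution onto the normalized bar resolution. -/
noncomputable def barToNbar (A : DGAlgebra k) : A.bar →ₗ[k] A.nbar :=
  DirectSum.toModule k ℕ _ fun p => (col A.nbarCol p).comp (A.nbarMk p)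

theorem barToNbar_col (p : ℕ) (z : A.barCol p) :
    A.barToNbar (col A.barCol p z) = col A.nbarCol p (A.nbarMk p z) := by
  simp [barToNbar]

theorem nbar_gr_le (n : ℤ) : A.nbar.gr n ≤ (A.bar.gr n).map A.barToNbar := by
  refine totalGr_induction (M := fun p => (A.nbarCol p).toDGMod) fun p m hm x hx => ?_
  obtain ⟨z, hz, rfl⟩ := hx
  exact ⟨col A.barCol p z, col_mem_gr A.barCol p hm hz, barToNbar_col p z⟩

theorem barToNbar_surjective : Function.Surjective A.barToNbar := by
  intro x
  refine homog_induction A.nbar.internal (P := fun x => ∃ y, A.barToNbar y = x) ⟨0, map_zero _⟩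
    (fun x y ⟨x', hx⟩ ⟨y', hy⟩ => ⟨x' + y', by rw [map_add, hx, hy]⟩) (fun n x hx => ?_) x
  obtain ⟨y, -, hy⟩ := nbar_gr_le n hx
  exact ⟨y, hy⟩

theorem barToNbar_mem (n : ℤ) (x : A.bar) (hx : x ∈ A.bar.gr n) : A.barToNbar x ∈ A.nbar.gr n := by
  refine totalGr_induction (M := fun p => (A.barCol p).toDGMod)
    (S := (A.nbar.gr n).comap A.barToNbar) (fun p m hm z hz => Submodule.mem_comap.2 ?_) hx
  exact Set.mem_of_eq_of_mem (barToNbar_col p z) (col_mem_gr A.nbarCol p hm ⟨z, hz, rfl⟩)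

theorem barToNbar_d (x : A.bar) : A.barToNbar (A.bar.d x) = A.nbar.d (A.barToNbar x) := by
  induction x using total_induction with
  | zero => simp only [map_zero]
  | add x y hx hy => rw [map_add, map_add, hx, hy, map_add, map_add]
  | col p z =>
    rw [barToNbar_col]
    cases p with
    | zero =>
      have h1 := total_d_col_zero A.barCol A.barD A.barD_barD z
      have h2 := total_d_col_zero A.nbarCol A.nbarD A.nbarD_nbarD (A.nbarMk 0 z)
      exact (congrArg A.barToNbar h1).trans ((barToNbar_col 0 _).trans h2.symm)
    | succ p =>
      have h1 := total_d_col_succ A.barCol A.barD A.barD_barD p z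
      have h2 := total_d_col_succ A.nbarCol A.nbarD A.nbarD_nbarD p (A.nbarMk (p + 1) z)
      refine (congrArg A.barToNbar h1).trans (Eq.trans ?_ h2.symm)
      rw [map_add, map_zsmul, barToNbar_col, barToNbar_col]
      rfl

theorem barToNbar_l (a : A) (x : A.bar) :
    A.barToNbar (A.bar.l a x) = A.nbar.l a (A.barToNbar x) := by
  induction x using total_induction with
  | zero => simp only [map_zero]
  | add x y hx hy => rw [map_add, map_add, hx, hy, map_add, map_add]
  | col p z =>
    rw [barToNbar_col]
    exact (congrArg A.barToNbar (totalL_col A.barCol p a z)).trans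
      ((barToNbar_col p _).trans (totalL_col A.nbarCol p a (A.nbarMk p z)).symm)

theorem barToNbar_r (a : A) (x : A.bar) :
    A.barToNbar (A.bar.r a x) = A.nbar.r a (A.barToNbar x) := by
  induction x using total_induction with
  | zero => simp only [map_zero]
  | add x y hx hy => rw [map_add, map_add, hx, hy, map_add, map_add]
  | col p z =>
    rw [barToNbar_col]
    exact (congrArg A.barToNbar (totalR_col A.barCol p a z)).trans
      ((barToNbar_col p _).trans (totalR_col A.nbarCol p a (A.nbarMk p z)).symm)

theorem barToNbar_barDegenTotal (x : A.bar) (hx : x ∈ barDegenTotal A) : A.barToNbar x = 0 := by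
  refine barDegenTotal_induction (S := LinearMap.ker A.barToNbar) (fun p z hz => ?_) hx
  have h : A.nbarMk p z = 0 :=
    (Submodule.Quotient.mk_eq_zero _).2 (Submodule.subset_span hz)
  rw [LinearMap.mem_ker, barToNbar_col, h, map_zero]

/-- Linear maps that vanish on degenerate tensors factor through the normalized bar resolution. -/
theorem exists_comp_barToNbar {N : Type u} [AddCommGroup N] [Module k N] (f : A.bar →ₗ[k] N)
    (hf : ∀ x ∈ barDegenTotal A, f x = 0) :
    ∃ g : A.nbar →ₗ[k] N, ∀ x, g (A.barToNbar x) = f x := by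
  refine ⟨DirectSum.toModule k ℕ _ fun p => (Submodule.span k (A.barDegen p)).liftQ
    (f.comp (col A.barCol p)) (Submodule.span_le.2 fun z hz =>
      hf _ (col_mem_barDegenTotal p (Submodule.subset_span hz))), fun x => ?_⟩
  induction x using total_induction with
  | zero => simp only [map_zero]
  | add x y hx hy => rw [map_add, map_add, hx, hy, map_add]
  | col p z =>
    rw [barToNbar_col, DirectSum.toModule_lof]
    rfl

end DGAlgebra

namespace QuasiFree

open DGMod DGBimod DGAlgebra

variable {k : Type u} [CommRing k] {A : DGAlgebra k}

/-- A retraction of the bar resolution that respects degenerate tensors induces one of the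
normalized bar resolution. -/
theorem exists_retract_nbar {S : DGBimod A} (R : Retract S A.bar)
    (hπ : ∀ x ∈ barDegenTotal A, R.π.toLin x = 0)
    (hh : ∀ x ∈ barDegenTotal A, R.h x ∈ barDegenTotal A) :
    ∃ R' : Retract S A.nbar, ∀ x, R'.π.toLin (A.barToNbar x) = R.π.toLin x := by
  obtain ⟨π, π_q⟩ := exists_comp_barToNbar R.π.toLin hπ
  obtain ⟨h, h_q⟩ := exists_comp_barToNbar (A.barToNbar.comp R.h) fun x hx =>
    barToNbar_barDegenTotal _ (hh x hx)
  simp only [LinearMap.comp_apply] at h_q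
  refine ⟨
    { i :=
        { toLin := A.barToNbar.comp R.i.toLin
          map_gr := fun n x hx => barToNbar_mem n _ (R.i.map_gr n x hx)
          map_d := fun x => by
            rw [LinearMap.comp_apply, LinearMap.comp_apply, R.i.map_d, barToNbar_d]
          map_l := fun a x => by
            rw [LinearMap.comp_apply, LinearMap.comp_apply, R.i.map_l, barToNbar_l]
          map_r := fun a x => by
            rw [LinearMap.comp_apply, LinearMap.comp_apply, R.i.map_r, barToNbar_r] }
      π :=
        { toLin := π
          map_gr := fun n x hx => ?_
          map_d := fun x => ?_
          map_l := fun a x => ?_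
          map_r := fun a x => ?_ }
      h := h
      h_gr := fun n x hx => ?_
      h_l := fun a x => ?_
      h_r := fun a x => ?_
      π_i := fun x => ?_
      htpy := fun x => ?_ }, π_q⟩
  · obtain ⟨y, hy, rfl⟩ := nbar_gr_le n hx
    rw [π_q]; exact R.π.map_gr n y hy
  · obtain ⟨y, rfl⟩ := barToNbar_surjective x
    rw [← barToNbar_d, π_q, π_q, R.π.map_d]
  · obtain ⟨y, rfl⟩ := barToNbar_surjective x
    rw [← barToNbar_l, π_q, π_q, R.π.map_l]
  · obtain ⟨y, rfl⟩ := barToNbar_surjective x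
    rw [← barToNbar_r, π_q, π_q, R.π.map_r]
  · obtain ⟨y, hy, rfl⟩ := nbar_gr_le n hx
    rw [h_q]; exact barToNbar_mem _ _ (R.h_gr n y hy)
  · obtain ⟨y, rfl⟩ := barToNbar_surjective x
    rw [← barToNbar_l, h_q, h_q, R.h_l, barToNbar_l]
  · obtain ⟨y, rfl⟩ := barToNbar_surjective x
    rw [← barToNbar_r, h_q, h_q, R.h_r, barToNbar_r]
  · exact (π_q _).trans (R.π_i x)
  · obtain ⟨y, rfl⟩ := barToNbar_surjective x
    change A.barToNbar (R.i.toLin (π (A.barToNbar y))) - _ = _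
    rw [π_q, h_q, ← barToNbar_d, ← barToNbar_d, h_q, ← map_sub, R.htpy, map_add]

end QuasiFree

/-! ### Homotopy equivalences of complexes of homogeneous parts -/

namespace DGMod

open CategoryTheory

variable {k : Type u} [CommRing k] {M N : DGMod k}

/-- The component `i → j` of the differential. -/
noncomputable def dComponent (M : DGMod k) (i j : ℤ) (e : j + 1 = i) :
    M.toComplex.X i ⟶ M.toComplex.X j :=
  ModuleCat.ofHom (X := M.gr i) (Y := M.gr j) (M.d.restrict fun x hx => by
    have h := M.d_mem i x hx
    rwa [← e, add_sub_cancel_right] at h)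

theorem toComplex_d (M : DGMod k) {i j : ℤ} (e : j + 1 = i) :
    M.toComplex.d i j = dComponent M i j e := by
  subst e
  exact ChainComplex.of_d (fun n => ModuleCat.of k (M.gr n))
    (fun n => M.dComponent (n + 1) n rfl) j

/-- The component of degree `n` of a morphism of dg modules. -/
noncomputable def homComponent (f : Hom M N) (n : ℤ) : M.toComplex.X n ⟶ N.toComplex.X n :=
  ModuleCat.ofHom (X := M.gr n) (Y := N.gr n) (f.toLin.restrict (f.map_gr n))

/-- The chain map induced by a morphism of dg modules. -/
noncomputable def Hom.toComplexMap (f : Hom M N) : M.toComplex ⟶ N.toComplex where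
  f n := homComponent f n
  comm' i j e := by
    rw [toComplex_d N e, toComplex_d M e]
    exact ModuleCat.hom_ext (LinearMap.ext fun x => Subtype.ext (f.map_d _).symm)

/-- The component `i → j` of a map of degree `1`. -/
noncomputable def homotopyComponent (h : M →ₗ[k] M) (h_gr : ∀ n, ∀ x ∈ M.gr n, h x ∈ M.gr (n + 1))
    (i j : ℤ) (e : i + 1 = j) : M.toComplex.X i ⟶ M.toComplex.X j :=
  ModuleCat.ofHom (X := M.gr i) (Y := M.gr j) (h.restrict fun x hx => e ▸ h_gr i x hx)

/-- A deformation retraction of dg modules `M → N` induces a homotopy equivalence of complexes. -/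
theorem nonempty_homotopyEquiv (f : Hom M N) (g : Hom N M) (h : M →ₗ[k] M)
    (h_gr : ∀ n, ∀ x ∈ M.gr n, h x ∈ M.gr (n + 1)) (hfg : ∀ y, f.toLin (g.toLin y) = y)
    (hgf : ∀ x, g.toLin (f.toLin x) - x = M.d (h x) + h (M.d x)) :
    Nonempty (HomotopyEquiv M.toComplex N.toComplex) := by
  refine ⟨{ hom := f.toComplexMap, inv := g.toComplexMap, homotopyHomInvId := ?_,
            homotopyInvHomId := Homotopy.ofEq ?_ }⟩
  · refine
      { hom := fun i j => if e : i + 1 = j then homotopyComponent h h_gr i j e else 0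
        zero := fun i j hij => dif_neg hij
        comm := fun i => ?_ }
    have h1 : (ComplexShape.down ℤ).Rel i (i - 1) := sub_add_cancel i 1
    have h2 : (ComplexShape.down ℤ).Rel (i + 1) i := rfl
    rw [dNext_eq _ h1, prevD_eq _ h2, dif_pos (sub_add_cancel i 1), dif_pos rfl,
      toComplex_d M (sub_add_cancel i 1), toComplex_d M rfl]
    refine ModuleCat.hom_ext (LinearMap.ext fun (x : M.gr i) => Subtype.ext ?_)
    change g.toLin (f.toLin (x : M)) = h (M.d x) + M.d (h x) + x
    rw [add_comm (h _), ← hgf, sub_add_cancel]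
  · refine HomologicalComplex.hom_ext _ _ fun i =>
      ModuleCat.hom_ext (LinearMap.ext fun (x : N.gr i) => Subtype.ext ?_)
    exact hfg _

end DGMod

/-! ### Coinvariants -/

namespace DGBimod

open DGMod

variable {k : Type u} [CommRing k] {A : DGAlgebra k} {M N : DGBimod A}

/-- The class of `c ⊗ x` in `A ⊗_{Aᵉ} M`. -/
noncomputable def coinvMk (M : DGBimod A) : A ⊗[k] M →ₗ[k] M.coinv :=
  (Submodule.span k M.coinvRel).mkQ

theorem coinv_induction {P : M.coinv → Prop} (zero : P 0) (add : ∀ x y, P x → P y → P (x + y))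
    (tmul : ∀ i m, ∀ c ∈ A.gr i, ∀ x ∈ M.gr m, P (M.coinvMk (c ⊗ₜ[k] x))) (z : M.coinv) : P z := by
  obtain ⟨z, rfl⟩ := (Submodule.span k M.coinvRel).mkQ_surjective z
  refine tensor_homog_induction A.internal M.internal
    (P := fun z => P ((Submodule.span k M.coinvRel).mkQ z)) (by rwa [map_zero])
    (fun x y hx hy => by rw [map_add]; exact add _ _ hx hy) (fun i m c hc x hx => ?_) z
  exact tmul i m c hc x hx

theorem coinvMk_left (M : DGBimod A) (c b : A) (x : M) :
    M.coinvMk ((c * b) ⊗ₜ[k] x) = M.coinvMk (c ⊗ₜ[k] M.l b x) := by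
  refine homog_induction A.internal
    (P := fun c => M.coinvMk ((c * b) ⊗ₜ[k] x) = M.coinvMk (c ⊗ₜ[k] M.l b x)) (by simp)
    (fun c c' h h' => by simp only [add_mul, TensorProduct.add_tmul, map_add, h, h'])
    (fun i c hc => ?_) c
  refine homog_induction A.internal
    (P := fun b => M.coinvMk ((c * b) ⊗ₜ[k] x) = M.coinvMk (c ⊗ₜ[k] M.l b x)) (by simp)
    (fun c c' h h' => by
      simp only [mul_add, TensorProduct.add_tmul, TensorProduct.tmul_add, map_add, h, h',
        LinearMap.add_apply]) (fun j b hb => ?_) b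
  refine homog_induction M.internal
    (P := fun x => M.coinvMk ((c * b) ⊗ₜ[k] x) = M.coinvMk (c ⊗ₜ[k] M.l b x)) (by simp)
    (fun c c' h h' => by simp only [TensorProduct.tmul_add, map_add, h, h']) (fun m x hx => ?_) x
  exact (Submodule.Quotient.eq _).2 (M.coinvRel_left hc hb hx)

theorem coinvMk_right (M : DGBimod A) {j : ℤ} {b : A} (hb : b ∈ A.gr j) (c : A) (x : M) :
    M.coinvMk ((b * c) ⊗ₜ[k] x) = M.coinvMk (A.toMod.tw j c ⊗ₜ[k] M.r b (M.tw j x)) := by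
  refine homog_induction A.internal
    (P := fun c => M.coinvMk ((b * c) ⊗ₜ[k] x) =
      M.coinvMk (A.toMod.tw j c ⊗ₜ[k] M.r b (M.tw j x))) (by simp)
    (fun c c' h h' => by simp only [mul_add, TensorProduct.add_tmul, map_add, h, h'])
    (fun i c hc => ?_) c
  refine homog_induction M.internal
    (P := fun x => M.coinvMk ((b * c) ⊗ₜ[k] x) =
      M.coinvMk (A.toMod.tw j c ⊗ₜ[k] M.r b (M.tw j x))) (by simp)
    (fun c c' h h' => by simp only [TensorProduct.tmul_add, map_add, h, h']) (fun m x hx => ?_) x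
  exact (Submodule.Quotient.eq _).2 (M.coinvRel_right hc hb hx)

theorem coinv_d_mk (M : DGBimod A) (c : A) (x : M) :
    M.coinv.d (M.coinvMk (c ⊗ₜ[k] x)) =
      M.coinvMk (A.d c ⊗ₜ[k] x) + M.coinvMk (A.toMod.tw 1 c ⊗ₜ[k] M.d x) := by
  rw [← map_add]
  exact congrArg M.coinvMk (tensor_d A.toMod M.toDGMod c x)

theorem coinvMk_mem {M : DGBimod A} {i m n : ℤ} (h : i + m = n) {c : A} (hc : c ∈ A.gr i) {x : M}
    (hx : x ∈ M.gr m) : M.coinvMk (c ⊗ₜ[k] x) ∈ M.coinv.gr n :=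
  ⟨_, tmul_mem_tensorGr h hc hx, rfl⟩

theorem coinv_gr_induction {n : ℤ} {S : Submodule k M.coinv}
    (h : ∀ i m, i + m = n → ∀ c ∈ A.gr i, ∀ x ∈ M.gr m, M.coinvMk (c ⊗ₜ[k] x) ∈ S) :
    M.coinv.gr n ≤ S :=
  Submodule.map_le_iff_le_comap.2 (tensorGr_induction fun i m hn c hc x hx => h i m hn c hc x hx)

/-- A linear map out of `A ⊗ M` that is compatible with the relations descends to
`A ⊗_{Aᵉ} M`. -/
noncomputable def coinvLift {X : Type u} [AddCommGroup X] [Module k X] (f : A ⊗[k] M →ₗ[k] X)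
    (hl : ∀ c b x, f ((c * b) ⊗ₜ[k] x) = f (c ⊗ₜ[k] M.l b x))
    (hr : ∀ j, ∀ b ∈ A.gr j, ∀ c x,
      f ((b * c) ⊗ₜ[k] x) = f (A.toMod.tw j c ⊗ₜ[k] M.r b (M.tw j x))) : M.coinv →ₗ[k] X :=
  (Submodule.span k M.coinvRel).liftQ f (Submodule.span_le.2 (by
    rintro _ ⟨i, j, m, c, hc, b, hb, x, hx, rfl | rfl⟩
    · rw [SetLike.mem_coe, LinearMap.mem_ker, map_sub, hl, sub_self]
    · rw [SetLike.mem_coe, LinearMap.mem_ker, ← coinvRel_tw M hc b hx, map_sub, hr j b hb,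
        sub_self]))

theorem coinvLift_mk {X : Type u} [AddCommGroup X] [Module k X] (f : A ⊗[k] M →ₗ[k] X)
    (hl : ∀ c b x, f ((c * b) ⊗ₜ[k] x) = f (c ⊗ₜ[k] M.l b x))
    (hr : ∀ j, ∀ b ∈ A.gr j, ∀ c x,
      f ((b * c) ⊗ₜ[k] x) = f (A.toMod.tw j c ⊗ₜ[k] M.r b (M.tw j x))) (z : A ⊗[k] M) :
    coinvLift f hl hr (M.coinvMk z) = f z := rfl

/-- The map `A ⊗_{Aᵉ} M → A ⊗_{Aᵉ} N` induced by a morphism of dg bimodules. -/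
noncomputable def coinvMap (f : Hom M N) : DGMod.Hom M.coinv N.coinv where
  toLin := coinvLift (N.coinvMk.comp (f.toLin.lTensor A))
    (fun c b x => by
      rw [LinearMap.comp_apply, LinearMap.comp_apply, LinearMap.lTensor_tmul,
        LinearMap.lTensor_tmul, f.map_l, coinvMk_left])
    (fun j b hb c x => by
      rw [LinearMap.comp_apply, LinearMap.comp_apply, LinearMap.lTensor_tmul,
        LinearMap.lTensor_tmul, f.map_r, f.map_tw, coinvMk_right _ hb])
  map_gr n x hx := by
    rw [← Submodule.mem_comap]
    refine coinv_gr_induction (fun i m h c hc x hx => Submodule.mem_comap.2 ?_) hx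
    rw [coinvLift_mk]
    exact coinvMk_mem h hc (f.map_gr m x hx)
  map_d z := by
    induction z using coinv_induction with
    | zero => simp only [map_zero]
    | add x y hx hy => rw [map_add, map_add, hx, hy, map_add, map_add]
    | tmul i m c hc x hx =>
      rw [coinv_d_mk, map_add, coinvLift_mk, coinvLift_mk, coinvLift_mk, LinearMap.comp_apply,
      LinearMap.comp_apply, LinearMap.comp_apply, LinearMap.lTensor_tmul, LinearMap.lTensor_tmul,
      LinearMap.lTensor_tmul, coinv_d_mk, f.map_d]

theorem coinvMap_mk (f : Hom M N) (c : A) (x : M) :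
    (coinvMap f).toLin (M.coinvMk (c ⊗ₜ[k] x)) = N.coinvMk (c ⊗ₜ[k] f.toLin x) := rfl

section Homotopy

variable {S C : DGBimod A} (R : Retract S C)

theorem Retract.h_tw (q : ℤ) (x : C) :
    C.tw q (R.h x) = ((q.negOnePow : ℤˣ) : ℤ) • R.h (C.tw q x) := by
  have h := twist_map C.internal C.internal (r := 1) (f := R.h) R.h_gr q x
  rwa [mul_one] at h

/-- The homotopy `c ⊗ x ↦ (-1) ^ |c| c ⊗ h x` on `A ⊗_{Aᵉ} C`. -/
noncomputable def Retract.coinvHomotopy : C.coinv →ₗ[k] C.coinv :=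
  coinvLift (C.coinvMk.comp (TensorProduct.map (A.toMod.tw 1) R.h))
    (fun c b x => by
      rw [LinearMap.comp_apply, LinearMap.comp_apply, TensorProduct.map_tmul,
        TensorProduct.map_tmul, A.tw_mul, R.h_l, coinvMk_left])
    (fun j b hb c x => by
      have e : A.toMod.tw 1 b = ((j.negOnePow : ℤˣ) : ℤ) • b := by
        rw [A.toMod.tw_of_mem 1 hb, one_mul]
      have e2 : A.toMod.tw 1 (A.toMod.tw j c) = A.toMod.tw j (A.toMod.tw 1 c) := by
        rw [A.toMod.tw_tw, A.toMod.tw_tw, add_comm]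
      rw [LinearMap.comp_apply, LinearMap.comp_apply, TensorProduct.map_tmul,
        TensorProduct.map_tmul, A.tw_mul, R.h_r, e, smul_mul_assoc, ← TensorProduct.smul_tmul',
        map_zsmul, coinvMk_right _ hb, R.h_tw, map_zsmul, TensorProduct.tmul_smul, map_zsmul,
        smul_smul, ← Units.val_mul, Int.units_mul_self, Units.val_one, one_smul, e2])

theorem Retract.coinvHomotopy_mk (c : A) (x : C) :
    R.coinvHomotopy (C.coinvMk (c ⊗ₜ[k] x)) = C.coinvMk (A.toMod.tw 1 c ⊗ₜ[k] R.h x) := rfl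

theorem Retract.coinvHomotopy_mem (n : ℤ) (z : C.coinv) (hz : z ∈ C.coinv.gr n) :
    R.coinvHomotopy z ∈ C.coinv.gr (n + 1) := by
  rw [← Submodule.mem_comap (f := R.coinvHomotopy)]
  refine coinv_gr_induction (fun i m h c hc x hx => Submodule.mem_comap.2 ?_) hz
  rw [coinvHomotopy_mk]
  exact coinvMk_mem (by omega) (A.toMod.tw_mem 1 hc) (R.h_gr m x hx)

theorem Retract.coinv_htpy (z : C.coinv) :
    (coinvMap R.i).toLin ((coinvMap R.π).toLin z) - z =
      C.coinv.d (R.coinvHomotopy z) + R.coinvHomotopy (C.coinv.d z) := by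
  refine coinv_induction (P := fun z => (coinvMap R.i).toLin ((coinvMap R.π).toLin z) - z =
      C.coinv.d (R.coinvHomotopy z) + R.coinvHomotopy (C.coinv.d z)) (by simp only [map_zero]; simp)
    (fun x y hx hy => by
      simp only [map_add]
      rw [add_sub_add_comm, hx, hy]
      abel) (fun i m c hc x hx => ?_) z
  have e : A.d (A.toMod.tw 1 c) = - A.toMod.tw 1 (A.d c) := by
    have h := A.toMod.tw_one_d c
    rw [h, neg_neg]
  rw [coinvHomotopy_mk, coinv_d_mk, coinv_d_mk, map_add, coinvHomotopy_mk, coinvHomotopy_mk,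
    A.toMod.tw_one_one, e, TensorProduct.neg_tmul, map_neg, coinvMap_mk, coinvMap_mk, ← map_sub,
    ← TensorProduct.tmul_sub, R.htpy, TensorProduct.tmul_add, map_add]
  abel

theorem Retract.coinv_π_i (z : S.coinv) :
    (coinvMap R.π).toLin ((coinvMap R.i).toLin z) = z := by
  refine coinv_induction (P := fun z => (coinvMap R.π).toLin ((coinvMap R.i).toLin z) = z)
    (by simp only [map_zero]) (fun x y hx hy => by rw [map_add, map_add, hx, hy])
    (fun i m c hc x hx => ?_) z
  rw [coinvMap_mk, coinvMap_mk, R.π_i]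

end Homotopy

end DGBimod

/-! ### Hochschild chains as coinvariants of the normalized bar resolution -/

namespace DGAlgebra

open DGMod DGBimod

variable {k : Type u} [CommRing k] {A : DGAlgebra k}

theorem wrap_left (W : DGMod k) (c b : A) (z : DGBimod.free A W) :
    (A.wrap W).toLin ((c * b) ⊗ₜ[k] z) =
      (A.wrap W).toLin (c ⊗ₜ[k] (DGBimod.free A W).l b z) := by
  have h := A.wrap_l_r W c b A.one_mem z
  rwa [one_mul, A.toMod.tw_even (by decide), tw_even _ (by decide),
    (DGBimod.free A W).r_one] at h

theorem wrap_right (W : DGMod k) {n : ℤ} {b : A} (hb : b ∈ A.gr n) (c : A)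
    (z : DGBimod.free A W) :
    (A.wrap W).toLin ((b * c) ⊗ₜ[k] z) = (A.wrap W).toLin
      (A.toMod.tw n c ⊗ₜ[k] (DGBimod.free A W).r b ((DGBimod.free A W).tw n z)) := by
  have h := A.wrap_l_r W (A.toMod.tw n c) 1 hb ((DGBimod.free A W).tw n z)
  rwa [mul_one, A.toMod.tw_tw, tw_tw, A.toMod.tw_even ⟨n, rfl⟩, tw_even _ ⟨n, rfl⟩,
    (DGBimod.free A W).l_one] at h

theorem wrap_mem_hochDegen (p : ℕ) (c : A) {z : A.barCol p}
    (hz : z ∈ Submodule.span k (A.barDegen p)) :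
    (A.wrap (A.tpow p)).toLin (c ⊗ₜ[k] z) ∈ Submodule.span k (A.hochDegen p) := by
  have : Submodule.span k (A.barDegen p) ≤ (Submodule.span k (A.hochDegen p)).comap
      ((A.wrap (A.tpow p)).toLin.comp (TensorProduct.mk k A _ c)) := by
    refine Submodule.span_le.2 ?_
    rintro _ ⟨m, n, x, hx, t, ht, y, hy, rfl⟩
    obtain ⟨j, hj⟩ := A.degen_homog p t ht
    change (A.wrap (A.tpow p)).toLin (c ⊗ₜ[k] (x ⊗ₜ[k] (t ⊗ₜ[k] y))) ∈
      Submodule.span k (A.hochDegen p)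
    rw [wrap_tmul _ _ _ _ _ hy, (A.tpow p).tw_of_mem n hj]
    exact A.tmul_mem_hochDegen p _ (zsmul_mem (Submodule.subset_span ht) _)
  exact this hz

/-- The class in `A ⊗ Ā^{⊗p}` of an element of `A ⊗ A^{⊗p}`. -/
noncomputable def hochMk (A : DGAlgebra k) (p : ℕ) : A ⊗[k] A.tpow p →ₗ[k] A.hochCol p :=
  (Submodule.span k (A.hochDegen p)).mkQ

/-- The element `x` of column `p` of the Hochschild chain complex. -/
noncomputable def chainCol (A : DGAlgebra k) (p : ℕ) : A.hochCol p →ₗ[k] A.hochschildChains :=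
  DirectSum.lof k ℕ (fun p => A.hochCol p) p

/-- The map `z ↦ c ↦ wrap ((-1) ^ (p |c|) c ⊗ z)` on column `p`. -/
noncomputable def unwindCol (A : DGAlgebra k) (p : ℕ) :
    A.nbarCol p →ₗ[k] A →ₗ[k] A.hochschildChains :=
  (Submodule.span k (A.barDegen p)).liftQ
    (LinearMap.flip (((TensorProduct.curry (A.wrap (A.tpow p)).toLin).comp
      (A.toMod.tw p)).compr₂ ((A.chainCol p).comp (A.hochMk p))))
    (Submodule.span_le.2 fun z hz => LinearMap.ext fun c => by
      have h : A.hochMk p ((A.wrap (A.tpow p)).toLin (A.toMod.tw p c ⊗ₜ[k] z)) = 0 :=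
        (Submodule.Quotient.mk_eq_zero _).2
          (wrap_mem_hochDegen p _ (Submodule.subset_span hz))
      exact (congrArg (A.chainCol p) h).trans (map_zero _))

theorem unwindCol_mk (p : ℕ) (z : A.barCol p) (c : A) :
    A.unwindCol p (A.nbarMk p z) c =
      A.chainCol p (A.hochMk p ((A.wrap (A.tpow p)).toLin (A.toMod.tw p c ⊗ₜ[k] z))) := rfl

/-- The map `c ⊗ z ↦ wrap ((-1) ^ (p |c|) c ⊗ z)`, for `z` in column `p`. -/
noncomputable def unwindLin (A : DGAlgebra k) : A ⊗[k] A.nbar →ₗ[k] A.hochschildChains :=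
  TensorProduct.lift (LinearMap.flip (DirectSum.toModule k ℕ _ A.unwindCol))

theorem unwindLin_tmul (p : ℕ) (c : A) (z : A.barCol p) :
    A.unwindLin (c ⊗ₜ[k] col A.nbarCol p (A.nbarMk p z)) =
      A.chainCol p (A.hochMk p ((A.wrap (A.tpow p)).toLin (A.toMod.tw p c ⊗ₜ[k] z))) := by
  rw [← unwindCol_mk]
  simp [unwindLin]

theorem nbar_induction {P : A.nbar → Prop} (zero : P 0) (add : ∀ x y, P x → P y → P (x + y))
    (mk : ∀ p z, P (col A.nbarCol p (A.nbarMk p z))) (x : A.nbar) : P x := by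
  induction x using total_induction with
  | zero => exact zero
  | add x y hx hy => exact add x y hx hy
  | col p x =>
    obtain ⟨z, rfl⟩ := (Submodule.span k (A.barDegen p)).mkQ_surjective x
    exact mk p z

theorem nbar_tw (q : ℤ) (p : ℕ) (z : A.barCol p) :
    A.nbar.tw q (col A.nbarCol p (A.nbarMk p z)) = (((q * p).negOnePow : ℤˣ) : ℤ) •
      col A.nbarCol p (A.nbarMk p ((A.barCol p).tw q z)) := by
  refine (total_tw A.nbarCol q p (A.nbarMk p z)).trans ?_
  congr 2
  exact twist_map_zero (A.barCol p).internal (A.nbarCol p).internal (f := A.nbarMk p)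
    (fun n x hx => ⟨x, hx, rfl⟩) q z

theorem nbar_l (b : A) (p : ℕ) (z : A.barCol p) :
    A.nbar.l b (col A.nbarCol p (A.nbarMk p z)) =
      col A.nbarCol p (A.nbarMk p ((A.barCol p).l (A.toMod.tw p b) z)) :=
  totalL_col A.nbarCol p b (A.nbarMk p z)

theorem nbar_r (b : A) (p : ℕ) (z : A.barCol p) :
    A.nbar.r b (col A.nbarCol p (A.nbarMk p z)) =
      col A.nbarCol p (A.nbarMk p ((A.barCol p).r b z)) :=
  totalR_col A.nbarCol p b (A.nbarMk p z)

theorem nbar_d_zero (z : A.barCol 0) :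
    A.nbar.d (col A.nbarCol 0 (A.nbarMk 0 z)) =
      col A.nbarCol 0 (A.nbarMk 0 ((A.barCol 0).d z)) :=
  total_d_col_zero A.nbarCol A.nbarD A.nbarD_nbarD (A.nbarMk 0 z)

theorem nbar_d_succ (p : ℕ) (z : A.barCol (p + 1)) :
    A.nbar.d (col A.nbarCol (p + 1) (A.nbarMk (p + 1) z)) =
      col A.nbarCol p (A.nbarMk p ((A.barD p).toLin z)) + (-1 : ℤ) ^ (p + 1) •
        col A.nbarCol (p + 1) (A.nbarMk (p + 1) ((A.barCol (p + 1)).d z)) :=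
  total_d_col_succ A.nbarCol A.nbarD A.nbarD_nbarD p (A.nbarMk (p + 1) z)

theorem chains_d_zero (z : A ⊗[k] A.tpow 0) :
    A.hochschildChains.d (A.chainCol 0 (A.hochMk 0 z)) =
      A.chainCol 0 (A.hochMk 0 ((tensor A.toMod (A.tpow 0)).d z)) := by
  have h := totalD_lof A.hochCol A.nhochD 0 (A.hochMk 0 z)
  rw [pow_zero, one_smul] at h
  exact h.trans (zero_add _)

theorem chains_d_succ (p : ℕ) (z : A ⊗[k] A.tpow (p + 1)) :
    A.hochschildChains.d (A.chainCol (p + 1) (A.hochMk (p + 1) z)) =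
      A.chainCol p (A.hochMk p ((A.hochD p).toLin z)) + (-1 : ℤ) ^ (p + 1) •
        A.chainCol (p + 1) (A.hochMk (p + 1) ((tensor A.toMod (A.tpow (p + 1))).d z)) :=
  totalD_lof A.hochCol A.nhochD (p + 1) (A.hochMk (p + 1) z)

theorem unwindLin_left (c b : A) (x : A.nbar) :
    A.unwindLin ((c * b) ⊗ₜ[k] x) = A.unwindLin (c ⊗ₜ[k] A.nbar.l b x) := by
  induction x using nbar_induction with
  | zero => simp only [map_zero, TensorProduct.tmul_zero]
  | add x y hx hy => rw [map_add, TensorProduct.tmul_add, TensorProduct.tmul_add, map_add, map_add,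
      hx, hy]
  | mk p z => rw [nbar_l, unwindLin_tmul, unwindLin_tmul, A.tw_mul, wrap_left]

theorem unwindLin_right (j : ℤ) (b : A) (hb : b ∈ A.gr j) (c : A) (x : A.nbar) :
    A.unwindLin ((b * c) ⊗ₜ[k] x) =
      A.unwindLin (A.toMod.tw j c ⊗ₜ[k] A.nbar.r b (A.nbar.tw j x)) := by
  induction x using nbar_induction with
  | zero => simp only [map_zero, TensorProduct.tmul_zero]
  | add x y hx hy => rw [map_add, map_add, TensorProduct.tmul_add, TensorProduct.tmul_add, map_add,
      map_add, hx, hy]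
  | mk p z =>
    have e : A.toMod.tw j (A.toMod.tw p c) = A.toMod.tw p (A.toMod.tw j c) := by
      rw [A.toMod.tw_tw, A.toMod.tw_tw, add_comm]
    rw [nbar_tw, map_zsmul, TensorProduct.tmul_smul, map_zsmul, nbar_r, unwindLin_tmul,
      unwindLin_tmul, A.tw_mul, A.toMod.tw_of_mem p hb, smul_mul_assoc, ← TensorProduct.smul_tmul',
      map_zsmul, map_zsmul, map_zsmul, wrap_right _ hb, e, mul_comm j]

theorem wrap_d (W : DGMod k) (c : A) (z : DGBimod.free A W) :
    (tensor A.toMod W).d ((A.wrap W).toLin (c ⊗ₜ[k] z)) =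
      (A.wrap W).toLin (A.d c ⊗ₜ[k] z) +
        (A.wrap W).toLin (A.toMod.tw 1 c ⊗ₜ[k] (DGBimod.free A W).d z) := by
  rw [← (A.wrap W).map_d, tensor_d, map_add]

/-- The morphism, invertible by `unwind_rewindLin` and `rewindLin_unwind`, that is
`A ⊗_{Aᵉ} (A ⊗ Ā^{⊗p} ⊗ A) → A ⊗ Ā^{⊗p}` in column `p`. The sign `(-1) ^ (p |c|)` for moving `c` past the `p`
suspensions makes it compatible with the signs of the bimodule structure of the bar resolution. -/
noncomputable def unwind (A : DGAlgebra k) : DGMod.Hom A.nbar.coinv A.hochschildChains where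
  toLin := coinvLift A.unwindLin unwindLin_left unwindLin_right
  map_gr n x hx := by
    rw [← Submodule.mem_comap]
    refine coinv_gr_induction (fun i m h c hc x hx => Submodule.mem_comap.2 ?_) hx
    rw [coinvLift_mk]
    obtain ⟨y, hy, rfl⟩ := nbar_gr_le m hx
    have h2 : A.bar.gr m ≤ (A.hochschildChains.gr n).comap
        ((A.unwindLin.comp (TensorProduct.mk k A A.nbar c)).comp A.barToNbar) := by
      refine totalGr_induction (M := fun p => (A.barCol p).toDGMod) fun p j hj z hz => ?_
      have h3 : A.barToNbar (DirectSum.lof k ℕ (fun p => (A.barCol p).toDGMod) p z) =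
          col A.nbarCol p (A.nbarMk p z) := barToNbar_col p z
      rw [Submodule.mem_comap, LinearMap.comp_apply, LinearMap.comp_apply, h3,
        TensorProduct.mk_apply, unwindLin_tmul]
      have h4 := (A.wrap (A.tpow p)).map_gr _ _
        (tmul_mem_tensorGr (rfl : i + j = i + j) (A.toMod.tw_mem p hc) hz)
      exact lof_mem_totalGr (M := A.hochCol) p (by omega) ⟨_, h4, rfl⟩
    exact h2 hy
  map_d z := by
    induction z using coinv_induction with
    | zero => simp only [map_zero]
    | add x y hx hy => rw [map_add, map_add, hx, hy, map_add, map_add]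
    | tmul i m c hc x hx =>
      clear hx
      rw [coinv_d_mk, map_add, coinvLift_mk, coinvLift_mk, coinvLift_mk]
      have e : ∀ p : ℕ, A.d (A.toMod.tw p c) = (-1 : ℤ) ^ p • A.toMod.tw p (A.d c) := fun p => by
        rw [← negOnePow_natCast]
        exact A.toMod.d_tw p c
      have e2 : ∀ p : ℤ,
          A.toMod.tw p (A.toMod.tw 1 c) = A.toMod.tw 1 (A.toMod.tw p c) := fun p => by
        rw [A.toMod.tw_tw, A.toMod.tw_tw, add_comm]
      induction x using nbar_induction with
      | zero => simp only [map_zero, TensorProduct.tmul_zero, add_zero]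
      | add x y hx hy =>
        rw [map_add, TensorProduct.tmul_add, TensorProduct.tmul_add, TensorProduct.tmul_add,
          map_add, map_add, map_add, map_add, ← hx, ← hy]
        abel
      | mk p z =>
        cases p with
        | zero =>
          have e0 := e 0
          rw [pow_zero, one_smul] at e0
          rw [nbar_d_zero, unwindLin_tmul, unwindLin_tmul, unwindLin_tmul, chains_d_zero, wrap_d,
            e0, e2, map_add, map_add]
        | succ p =>
          have e3 : A.toMod.tw p (A.toMod.tw 1 c) = A.toMod.tw (p + 1 : ℕ) c := by
            rw [A.toMod.tw_tw]; rfl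
          rw [nbar_d_succ, TensorProduct.tmul_add, TensorProduct.tmul_smul, map_add, map_zsmul,
            unwindLin_tmul, unwindLin_tmul, unwindLin_tmul, unwindLin_tmul, chains_d_succ, wrap_d,
            e, e3, e2, map_add, map_add, hochD_wrap, smul_add, ← TensorProduct.smul_tmul',
            map_zsmul, map_zsmul, map_zsmul, smul_smul, ← mul_pow]
          simp only [mul_neg, mul_one, neg_neg, one_pow, one_smul]
          abel

theorem unwind_mk (p : ℕ) (c : A) (z : A.barCol p) :
    A.unwind.toLin (A.nbar.coinvMk (c ⊗ₜ[k] col A.nbarCol p (A.nbarMk p z))) =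
      A.chainCol p (A.hochMk p ((A.wrap (A.tpow p)).toLin (A.toMod.tw p c ⊗ₜ[k] z))) :=
  unwindLin_tmul p c z

/-- The inverse `c ⊗ t ↦ (-1) ^ (p |c|) c ⊗ (1 ⊗ t ⊗ 1)` of `unwind`. -/
noncomputable def rewindLin (A : DGAlgebra k) : A.hochschildChains →ₗ[k] A.nbar.coinv :=
  DirectSum.toModule k ℕ _ fun p => (Submodule.span k (A.hochDegen p)).liftQ
    (A.nbar.coinvMk.comp (TensorProduct.map (A.toMod.tw p)
      ((col A.nbarCol p).comp ((A.nbarMk p).comp (freeι A (A.tpow p))))))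
    (Submodule.span_le.2 (by
      rintro _ ⟨m, c, hc, t, ht, rfl⟩
      have h : A.nbarMk p (freeι A (A.tpow p) t) = 0 :=
        (Submodule.Quotient.mk_eq_zero _).2 (A.tmul_mem_barDegen p 1 1 (Submodule.subset_span ht))
      rw [SetLike.mem_coe, LinearMap.mem_ker, LinearMap.comp_apply, TensorProduct.map_tmul,
        LinearMap.comp_apply, LinearMap.comp_apply, h, map_zero, TensorProduct.tmul_zero,
        map_zero]))

theorem rewindLin_col (p : ℕ) (c : A) (t : A.tpow p) :
    A.rewindLin (A.chainCol p (A.hochMk p (c ⊗ₜ[k] t))) = A.nbar.coinvMk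
      (A.toMod.tw p c ⊗ₜ[k] col A.nbarCol p (A.nbarMk p (freeι A (A.tpow p) t))) := by
  refine (DirectSum.toModule_lof k p _).trans ?_
  rfl

theorem chains_induction {P : A.hochschildChains → Prop} (zero : P 0)
    (add : ∀ x y, P x → P y → P (x + y))
    (tmul : ∀ p c t, P (A.chainCol p (A.hochMk p (c ⊗ₜ[k] t)))) (x : A.hochschildChains) : P x := by
  induction x using DirectSum.induction_on with
  | zero => exact zero
  | add x y hx hy => exact add x y hx hy
  | of p x =>
    obtain ⟨z, rfl⟩ := (Submodule.span k (A.hochDegen p)).mkQ_surjective x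
    induction z using TensorProduct.induction_on with
    | zero => rw [map_zero, map_zero]; exact zero
    | add x y hx hy => rw [map_add, map_add]; exact add _ _ hx hy
    | tmul c t => exact tmul p c t

theorem unwind_rewindLin (x : A.hochschildChains) : A.unwind.toLin (A.rewindLin x) = x := by
  induction x using chains_induction with
  | zero => simp only [map_zero]
  | add x y hx hy => rw [map_add, map_add, hx, hy]
  | tmul p c t =>
    rw [rewindLin_col, unwind_mk, A.toMod.tw_tw, A.toMod.tw_even ⟨p, rfl⟩, freeι_apply,
      wrap_tmul _ _ _ _ _ A.one_mem, one_mul, mul_one, A.toMod.tw_even (by decide),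
      tw_even _ (by decide)]

theorem rewindLin_unwind (x : A.nbar.coinv) : A.rewindLin (A.unwind.toLin x) = x := by
  induction x using coinv_induction with
  | zero => simp only [map_zero]
  | add x y hx hy => rw [map_add, map_add, hx, hy]
  | tmul i m c hc x hx =>
    clear hx
    induction x using nbar_induction with
    | zero => simp only [map_zero, TensorProduct.tmul_zero]
    | add x y hx hy => rw [TensorProduct.tmul_add, map_add, map_add, map_add, hx, hy]
    | mk p z =>
      induction z using free_induction with
      | zero => simp only [map_zero, TensorProduct.tmul_zero]
      | add x y hx hy =>
        rw [map_add, map_add, TensorProduct.tmul_add, map_add, map_add, map_add, hx, hy]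
      | tmul x t y =>
        refine homog_induction A.internal (P := fun y => A.rewindLin (A.unwind.toLin
          (A.nbar.coinvMk (c ⊗ₜ[k] col A.nbarCol p (A.nbarMk p (x ⊗ₜ[k] (t ⊗ₜ[k] y)))))) =
          A.nbar.coinvMk (c ⊗ₜ[k] col A.nbarCol p (A.nbarMk p (x ⊗ₜ[k] (t ⊗ₜ[k] y)))))
          (by simp only [map_zero, TensorProduct.tmul_zero])
          (fun y y' h h' => by
            rw [TensorProduct.tmul_add, TensorProduct.tmul_add, map_add, map_add,
              TensorProduct.tmul_add, map_add, map_add, map_add, h, h']) (fun n y hy => ?_) y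
        have h1 : col A.nbarCol p (A.nbarMk p (x ⊗ₜ[k] (t ⊗ₜ[k] y))) =
            A.nbar.l (A.toMod.tw p x) (A.nbar.r y
              (col A.nbarCol p (A.nbarMk p (freeι A (A.tpow p) t)))) := by
          rw [nbar_r, nbar_l, A.toMod.tw_tw, A.toMod.tw_even ⟨p, rfl⟩, l_r_freeι]
        have h2 : (A.barCol p).tw n (freeι A (A.tpow p) t) =
            freeι A (A.tpow p) ((A.tpow p).tw n t) :=
          twist_map_zero (A.tpow p).internal (A.barCol p).internal
            (fun n x hx => freeι_mem (A.tpow p) hx) n t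
        have h3 := A.nbar.coinvMk_right hy (A.toMod.tw n (c * A.toMod.tw p x))
          (A.nbar.tw n (col A.nbarCol p (A.nbarMk p (freeι A (A.tpow p) t))))
        rw [A.toMod.tw_tw, tw_tw, A.toMod.tw_even ⟨n, rfl⟩, tw_even _ ⟨n, rfl⟩] at h3
        rw [unwind_mk, wrap_tmul _ _ _ _ _ hy, rewindLin_col, h1, ← coinvMk_left, ← h3, nbar_tw,
          h2, A.tw_mul, A.toMod.tw_of_mem p hy, smul_mul_assoc, ← TensorProduct.smul_tmul',
          TensorProduct.tmul_smul, mul_comm n, A.tw_mul, A.tw_mul, A.tw_mul, A.toMod.tw_tw,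
          A.toMod.tw_tw, A.toMod.tw_tw, A.toMod.tw_tw,
          A.toMod.tw_congr (p := (p : ℤ) + n + p) (q := n) ⟨p, by ring⟩, add_comm (p : ℤ) n]

/-- The inverse of `unwind`, as a morphism of dg modules. -/
noncomputable def rewind (A : DGAlgebra k) : DGMod.Hom A.hochschildChains A.nbar.coinv where
  toLin := A.rewindLin
  map_gr n x hx := by
    rw [← Submodule.mem_comap (f := A.rewindLin)]
    refine totalGr_induction (M := A.hochCol) (fun p m h x hx => Submodule.mem_comap.2 ?_) hx
    obtain ⟨z, hz, rfl⟩ := hx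
    have h2 : tensorGr A.gr (A.tpow p).gr m ≤ (A.nbar.coinv.gr n).comap
        (A.rewindLin.comp ((A.chainCol p).comp (A.hochMk p))) := by
      refine tensorGr_induction fun i j hij c hc t ht => ?_
      rw [Submodule.mem_comap, LinearMap.comp_apply, LinearMap.comp_apply, rewindLin_col]
      exact coinvMk_mem (m := p + j) (by omega) (A.toMod.tw_mem p hc)
        (col_mem_gr A.nbarCol p rfl ⟨_, freeι_mem (A.tpow p) ht, rfl⟩)
    exact h2 hz
  map_d x := by
    rw [← A.rewindLin_unwind (A.nbar.coinv.d (A.rewindLin x)), A.unwind.map_d, unwind_rewindLin]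

/-- A retraction of the normalized bar resolution onto `S` induces a homotopy equivalence between
the Hochschild chains and `A ⊗_{Aᵉ} S`. -/
theorem nonempty_homotopyEquiv_chains {S : DGBimod A} (R : Retract S A.nbar) :
    Nonempty (HomotopyEquiv A.hochschildChains.toComplex S.coinv.toComplex) := by
  refine nonempty_homotopyEquiv ((coinvMap R.π).comp A.rewind) (A.unwind.comp (coinvMap R.i))
    (A.unwind.toLin.comp (R.coinvHomotopy.comp A.rewindLin)) (fun n x hx => ?_) (fun y => ?_)
    (fun x => ?_)
  · exact A.unwind.map_gr _ _ (R.coinvHomotopy_mem n _ (A.rewind.map_gr n x hx))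
  · change (coinvMap R.π).toLin (A.rewindLin (A.unwind.toLin ((coinvMap R.i).toLin y))) = y
    rw [rewindLin_unwind, R.coinv_π_i]
  · change A.unwind.toLin ((coinvMap R.i).toLin ((coinvMap R.π).toLin (A.rewindLin x))) - x =
      A.hochschildChains.d (A.unwind.toLin (R.coinvHomotopy (A.rewindLin x))) +
        A.unwind.toLin (R.coinvHomotopy (A.rewindLin (A.hochschildChains.d x)))
    have h := A.rewind.map_d x
    change A.rewindLin (A.hochschildChains.d x) = A.nbar.coinv.d (A.rewindLin x) at h
    rw [← A.unwind.map_d, h, ← map_add, ← R.coinv_htpy, map_sub, unwind_rewindLin]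

end DGAlgebra

/-! ### The complex of bimodule maps out of a retract -/

namespace DGBimod

open DGMod CategoryTheory

variable {k : Type u} [CommRing k] {A : DGAlgebra k}

section Functoriality

variable {M M' N : DGBimod A}

/-- The component `i → j` of the differential of `Hom_{Aᵉ}(M, N)`. -/
noncomputable def homDComponent (M N : DGBimod A) (i j : ℤ) (e : i + 1 = j) :
    (homComplex M N).X i ⟶ (homComplex M N).X j :=
  ModuleCat.ofHom (X := homGr M N i) (Y := homGr M N j)
    ((homD M N i).restrict fun _ hf => e ▸ homD_mem M N i hf)

theorem homComplex_d (M N : DGBimod A) {i j : ℤ} (e : i + 1 = j) :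
    (homComplex M N).d i j = homDComponent M N i j e := by
  subst e
  exact CochainComplex.of_d (fun n => ModuleCat.of k (homGr M N n))
    (fun n => homDComponent M N n (n + 1) rfl) i

theorem comp_mem_homGr (f : Hom M M') {n : ℤ} {F : M' →ₗ[k] N} (hF : F ∈ homGr M' N n) :
    F.comp f.toLin ∈ homGr M N n :=
  ⟨fun m x hx => hF.1 m _ (f.map_gr m x hx),
    fun a x => by rw [LinearMap.comp_apply, f.map_l, hF.2.1, LinearMap.comp_apply],
    fun a x => by rw [LinearMap.comp_apply, f.map_r, hF.2.2, LinearMap.comp_apply]⟩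

/-- The component of degree `n` of the chain map `F ↦ F ∘ f`. -/
noncomputable def precompComponent (N : DGBimod A) (f : Hom M M') (n : ℤ) :
    (homComplex M' N).X n ⟶ (homComplex M N).X n :=
  ModuleCat.ofHom (X := homGr M' N n) (Y := homGr M N n)
    ((LinearMap.lcomp k N f.toLin).restrict fun _ hF => comp_mem_homGr f hF)

/-- The chain map `F ↦ F ∘ f`. -/
noncomputable def precomp (N : DGBimod A) (f : Hom M M') : homComplex M' N ⟶ homComplex M N where
  f n := precompComponent N f n
  comm' i j e := by
    rw [homComplex_d M N e, homComplex_d M' N e]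
    refine ModuleCat.hom_ext (LinearMap.ext fun (F : homGr M' N i) =>
      Subtype.ext (LinearMap.ext fun x => ?_))
    change N.d (F.1 (f.toLin x)) - ((i.negOnePow : ℤˣ) : ℤ) • F.1 (f.toLin (M.d x)) =
      N.d (F.1 (f.toLin x)) - ((i.negOnePow : ℤˣ) : ℤ) • F.1 (M'.d (f.toLin x))
    rw [f.map_d]

end Functoriality

section Homotopy

variable {S C N : DGBimod A} (R : Retract S C)

theorem Retract.comp_h_mem_homGr {n : ℤ} {F : C →ₗ[k] N} (hF : F ∈ homGr C N n) :
    F.comp R.h ∈ homGr C N (n - 1) := by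
  refine ⟨fun m x hx => ?_, fun a x => ?_, fun a x => ?_⟩
  · have h := hF.1 _ _ (R.h_gr m x hx)
    rwa [show m + 1 - n = m - (n - 1) by ring] at h
  · rw [LinearMap.comp_apply, R.h_l, hF.2.1, LinearMap.comp_apply, A.toMod.tw_tw,
      A.toMod.tw_congr (p := n + 1) (q := n - 1) ⟨1, by ring⟩]
  · rw [LinearMap.comp_apply, R.h_r, hF.2.2, LinearMap.comp_apply]

/-- The homotopy `F ↦ (-1) ^ |F| F ∘ h`, as a map `i → j`. -/
noncomputable def Retract.homHomotopy (N : DGBimod A) (i j : ℤ) (e : j + 1 = i) :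
    (homComplex C N).X i ⟶ (homComplex C N).X j :=
  ModuleCat.ofHom (X := homGr C N i) (Y := homGr C N j)
    ((((i.negOnePow : ℤˣ) : ℤ) • LinearMap.lcomp k N R.h).restrict fun _ hF => by
      have h := R.comp_h_mem_homGr hF
      rw [← e, add_sub_cancel_right] at h
      exact zsmul_mem h _)

end Homotopy

/-- A deformation retraction of dg bimodules induces a homotopy equivalence of the complexes of
bimodule maps. -/
theorem nonempty_homotopyEquiv_homComplex {S C : DGBimod A} (R : Retract S C)
    (N : DGBimod A) :
    Nonempty (HomotopyEquiv (homComplex C N) (homComplex S N)) := by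
  refine ⟨{ hom := precomp N R.i, inv := precomp N R.π, homotopyHomInvId := ?_,
            homotopyInvHomId := Homotopy.ofEq ?_ }⟩
  · refine
      { hom := fun i j => if e : j + 1 = i then R.homHomotopy N i j e else 0
        zero := fun i j hij => dif_neg hij
        comm := fun i => ?_ }
    have h1 : (ComplexShape.up ℤ).Rel i (i + 1) := rfl
    have h2 : (ComplexShape.up ℤ).Rel (i - 1) i := sub_add_cancel i 1
    rw [dNext_eq _ h1, prevD_eq _ h2, dif_pos (sub_add_cancel i 1), dif_pos rfl,
      homComplex_d C N (sub_add_cancel i 1), homComplex_d C N rfl]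
    refine ModuleCat.hom_ext (LinearMap.ext fun (F : homGr C N i) =>
      Subtype.ext (LinearMap.ext fun x => ?_))
    change F.1 (R.i.toLin (R.π.toLin x)) =
      ((((i + 1).negOnePow : ℤˣ) : ℤ) •
          (N.d (F.1 (R.h x)) - ((i.negOnePow : ℤˣ) : ℤ) • F.1 (C.d (R.h x))) +
        (N.d (((i.negOnePow : ℤˣ) : ℤ) • F.1 (R.h x)) -
          (((i - 1).negOnePow : ℤˣ) : ℤ) • ((i.negOnePow : ℤˣ) : ℤ) • F.1 (R.h (C.d x)))) + F.1 x
    have hs : ((i.negOnePow : ℤˣ) : ℤ) * ((i.negOnePow : ℤˣ) : ℤ) = 1 := by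
      rw [← Units.val_mul, Int.units_mul_self, Units.val_one]
    have hF := congrArg F.1 (R.htpy x)
    rw [map_sub, map_add] at hF
    rw [Int.negOnePow_succ, Int.negOnePow_sub, Int.negOnePow_one, map_zsmul]
    simp only [Units.val_neg, smul_sub, smul_smul, neg_mul, mul_neg,
      mul_one, hs, neg_smul, one_smul]
    rw [sub_eq_iff_eq_add.1 hF]
    abel
  · refine HomologicalComplex.hom_ext _ _ fun i =>
      ModuleCat.hom_ext (LinearMap.ext fun (F : homGr S N i) =>
        Subtype.ext (LinearMap.ext fun x => ?_))
    exact congrArg F.1 (R.π_i x)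

end DGBimod

/-! ### Hochschild cochains as bimodule maps out of the normalized bar resolution -/

namespace DGAlgebra

open DGMod DGBimod CategoryTheory

variable {k : Type u} [CommRing k] {A : DGAlgebra k}

/-- The sign `(-1) ^ (p n + p (p - 1) / 2)` relating a bimodule map `F` of cohomological degree `n`
to its component `f p` on `Ā^{⊗p}`. It turns the signs of the differential of `Hom_{Aᵉ}(-, A)`
into those of the Hochschild cochain complex. -/
def cochSign (n : ℤ) (p : ℕ) : ℤˣ := (p * n + p.choose 2 : ℤ).negOnePow

theorem cochSign_succ (n : ℤ) (p : ℕ) :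
    cochSign (n + 1) p = (p : ℤ).negOnePow * cochSign n p := by
  rw [cochSign, cochSign, ← Int.negOnePow_add]
  congr 1
  ring

theorem cochSign_succ_succ (n : ℤ) (p : ℕ) :
    cochSign (n + 1) (p + 1) = -(n.negOnePow * cochSign n p) := by
  have h : (p + 1).choose 2 = p + p.choose 2 := by
    rw [Nat.choose_succ_succ' p 1, Nat.choose_one_right]
  rw [cochSign, cochSign, ← Int.negOnePow_add, ← Int.negOnePow_succ, h,
    Int.negOnePow_eq_iff]
  exact ⟨p, by push_cast; ring⟩

theorem cochSign_mul_self (n : ℤ) (p : ℕ) : (cochSign n p : ℤ) * cochSign n p = 1 := by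
  rw [← Units.val_mul, Int.units_mul_self, Units.val_one]

/-- The components `t ↦ ± F (1 ⊗ t ⊗ 1)` of a map `F` out of the normalized bar resolution. -/
noncomputable def restrictFun (A : DGAlgebra k) (n : ℤ) (F : A.nbar →ₗ[k] A) (p : ℕ) :
    A.tpow p →ₗ[k] A :=
  (cochSign n p : ℤ) • F.comp ((col A.nbarCol p).comp ((A.nbarMk p).comp (freeι A (A.tpow p))))

theorem restrictFun_apply (n : ℤ) (F : A.nbar →ₗ[k] A) (p : ℕ) (t : A.tpow p) :
    A.restrictFun n F p t =
      (cochSign n p : ℤ) • F (col A.nbarCol p (A.nbarMk p (freeι A (A.tpow p) t))) := rfl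

theorem restrictFun_mem {n : ℤ} {F : A.nbar →ₗ[k] A} (hF : F ∈ homGr A.nbar (self A) n) :
    A.restrictFun n F ∈ A.cochainGr n := by
  refine fun p => ⟨fun m t ht => ?_, fun t ht => ?_⟩
  · have h := hF.1 _ _ (col_mem_gr A.nbarCol p (add_comm (p : ℤ) m)
      ⟨_, freeι_mem (A.tpow p) ht, rfl⟩)
    rw [restrictFun_apply]
    exact zsmul_mem h _
  · have h : A.nbarMk p (freeι A (A.tpow p) t) = 0 :=
      (Submodule.Quotient.mk_eq_zero _).2 (A.tmul_mem_barDegen p 1 1 (Submodule.subset_span ht))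
    rw [restrictFun_apply, h, map_zero, map_zero, smul_zero]

/-- The Hochschild cochain of a bimodule map out of the normalized bar resolution. -/
noncomputable def restrictCochain (A : DGAlgebra k) (n : ℤ) :
    homGr A.nbar (self A) n →ₗ[k] A.cochainGr n where
  toFun F := ⟨A.restrictFun n F.1, restrictFun_mem F.2⟩
  map_add' F G := Subtype.ext (funext fun p => LinearMap.ext fun t => by
    change (cochSign n p : ℤ) • (F.1 _ + G.1 _) =
      (cochSign n p : ℤ) • F.1 _ + (cochSign n p : ℤ) • G.1 _
    rw [smul_add])
  map_smul' c F := Subtype.ext (funext fun p => LinearMap.ext fun t => by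
    change (cochSign n p : ℤ) • (c • F.1 _) = c • ((cochSign n p : ℤ) • F.1 _)
    rw [smul_comm])

theorem act_barDegen {n : ℤ} (f : A.cochainGr n) (p : ℕ) :
    Submodule.span k (A.barDegen p) ≤ LinearMap.ker (A.act (n - p) (f.1 p)) := by
  refine Submodule.span_le.2 ?_
  rintro _ ⟨a, b, x, hx, t, ht, y, hy, rfl⟩
  rw [SetLike.mem_coe, LinearMap.mem_ker, act_tmul, (f.2 p).2 t ht, zero_mul, mul_zero]

/-- The map `x ⊗ t ⊗ y ↦ ± x (f p t) y` on column `p`, with sign `cochSign n p` and the Koszul sign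
of moving `f p`, of internal degree `n - p`, past `x`. -/
noncomputable def extendCol {n : ℤ} (f : A.cochainGr n) (p : ℕ) : A.nbarCol p →ₗ[k] A :=
  (Submodule.span k (A.barDegen p)).liftQ ((cochSign n p : ℤ) • A.act (n - p) (f.1 p))
    ((act_barDegen f p).trans fun z hz => by
      rw [LinearMap.mem_ker] at hz ⊢
      rw [LinearMap.smul_apply, hz, smul_zero])

theorem extendCol_mk {n : ℤ} (f : A.cochainGr n) (p : ℕ) (z : A.barCol p) :
    extendCol f p (A.nbarMk p z) = (cochSign n p : ℤ) • A.act (n - p) (f.1 p) z := rfl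

/-- The extension of a Hochschild cochain to a map out of the normalized bar resolution. -/
noncomputable def extendFun {n : ℤ} (f : A.cochainGr n) : A.nbar →ₗ[k] A :=
  DirectSum.toModule k ℕ A (extendCol f)

theorem extendFun_col {n : ℤ} (f : A.cochainGr n) (p : ℕ) (z : A.barCol p) :
    extendFun f (col A.nbarCol p (A.nbarMk p z)) =
      (cochSign n p : ℤ) • A.act (n - p) (f.1 p) z := by
  rw [← extendCol_mk]
  simp [extendFun]

theorem extendFun_mem {n : ℤ} (f : A.cochainGr n) : extendFun f ∈ homGr A.nbar (self A) n := by
  refine ⟨fun m x hx => ?_, fun a x => ?_, fun a x => ?_⟩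
  · obtain ⟨y, hy, rfl⟩ := nbar_gr_le m hx
    have h2 : A.bar.gr m ≤ (A.gr (m - n)).comap ((extendFun f).comp A.barToNbar) := by
      refine totalGr_induction (M := fun p => (A.barCol p).toDGMod) fun p j hj z hz => ?_
      have h3 : A.barToNbar (DirectSum.lof k ℕ (fun p => (A.barCol p).toDGMod) p z) =
          col A.nbarCol p (A.nbarMk p z) := barToNbar_col p z
      rw [Submodule.mem_comap, LinearMap.comp_apply, h3, extendFun_col]
      have h4 : (A.barCol p).gr j ≤ (A.gr (m - n)).comap (A.act (n - p) (f.1 p)) := by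
        refine free_gr_induction fun i l l' hn x hx t ht y hy => ?_
        rw [Submodule.mem_comap, act_tmul]
        have h5 := A.mul_mem _ _ _ (A.toMod.tw_mem (n - p) hx) _
          (A.mul_mem _ _ _ ((f.2 p).1 l t ht) y hy)
        rwa [show i + (l + p - n + l') = m - n by omega] at h5
      have h5 : A.act (n - p) (f.1 p) z ∈ A.gr (m - n) := h4 hz
      exact zsmul_mem h5 _
    exact h2 hy
  · change extendFun f (A.nbar.l a x) = A.toMod.tw n a * extendFun f x
    induction x using nbar_induction with
    | zero => simp only [map_zero, mul_zero]
    | add x y hx hy => rw [map_add, map_add, hx, hy, map_add, mul_add]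
    | mk p z =>
      rw [nbar_l, extendFun_col, extendFun_col, act_l, A.toMod.tw_tw, sub_add_cancel,
        mul_smul_comm]
  · change extendFun f (A.nbar.r a x) = extendFun f x * a
    induction x using nbar_induction with
    | zero => simp only [map_zero, zero_mul]
    | add x y hx hy => rw [map_add, map_add, hx, hy, map_add, add_mul]
    | mk p z => rw [nbar_r, extendFun_col, extendFun_col, act_r, smul_mul_assoc]

theorem act_restrictFun {n : ℤ} {F : A.nbar →ₗ[k] A} (hF : F ∈ homGr A.nbar (self A) n) (p : ℕ)
    (z : A.barCol p) : A.act (n - p) (A.restrictFun n F p) z =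
      (cochSign n p : ℤ) • F (col A.nbarCol p (A.nbarMk p z)) := by
  induction z using free_induction with
  | zero => simp only [map_zero, smul_zero]
  | add x y hx hy => rw [map_add, map_add, map_add, map_add, hx, hy, smul_add]
  | tmul x t y =>
    have h1 : col A.nbarCol p (A.nbarMk p (x ⊗ₜ[k] (t ⊗ₜ[k] y))) =
        A.nbar.l (A.toMod.tw p x) (A.nbar.r y
          (col A.nbarCol p (A.nbarMk p (freeι A (A.tpow p) t)))) := by
      rw [nbar_r, nbar_l, A.toMod.tw_tw, A.toMod.tw_even ⟨p, rfl⟩, l_r_freeι]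
    have h2 : F (col A.nbarCol p (A.nbarMk p (x ⊗ₜ[k] (t ⊗ₜ[k] y)))) = A.toMod.tw (n + p) x *
        (F (col A.nbarCol p (A.nbarMk p (freeι A (A.tpow p) t))) * y) := by
      rw [h1, hF.2.1, hF.2.2, A.toMod.tw_tw]
      rfl
    rw [h2, act_tmul, restrictFun_apply, smul_mul_assoc, mul_smul_comm,
      A.toMod.tw_congr (p := n - p) (q := n + p) ⟨-p, by ring⟩]

theorem smul_add_smul_sub_smul {X : Type*} [AddCommGroup X] {a b c s t : ℤ} (h : c * t = -a)
    (h' : c = s * b) (x y z : X) :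
    a • x + s • (b • y - (t * s) • b • z) = c • (y - t • (x + s • z)) := by
  obtain rfl : a = -(c * t) := by rw [h, neg_neg]
  subst h'
  module

/-- Restriction to the tensors `1 ⊗ t ⊗ 1` commutes with the differentials: the horizontal one is
evaluated by writing `d (1 ⊗ t ⊗ 1)` through generators, which is where the bimodule structure of
`F` enters. -/
theorem cochFun_restrictFun {n : ℤ} {F : A.nbar →ₗ[k] A} (hF : F ∈ homGr A.nbar (self A) n) :
    A.cochFun n (A.restrictFun n F) =
      A.restrictFun (n + 1) (homD A.nbar (self A) n F) := by
  funext p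
  refine LinearMap.ext fun t => ?_
  cases p with
  | zero =>
    change A.cochV n (A.restrictFun n F 0) t = _
    rw [cochV_apply, restrictFun_apply, restrictFun_apply, restrictFun_apply, homD_apply,
      nbar_d_zero, cochSign_succ]
    have h := QuasiFree.freeι_d (A := A) (A.tpow 0) t
    rw [h, map_zsmul, Nat.cast_zero, Int.negOnePow_zero, one_mul, smul_sub, smul_comm]
  | succ p =>
    change A.cochH (n - p) (A.restrictFun n F p) t +
      (-1 : ℤ) ^ (p + 1) • A.cochV (n - (p + 1 : ℕ)) (A.restrictFun n F (p + 1)) t = _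
    have e1 : (cochSign (n + 1) (p + 1) : ℤ) * (n.negOnePow : ℤˣ) = -cochSign n p := by
      rw [cochSign_succ_succ, Units.val_neg, Units.val_mul, neg_mul, mul_right_comm,
        ← Units.val_mul, Int.units_mul_self, Units.val_one, one_mul]
    have e2 : (cochSign (n + 1) (p + 1) : ℤ) = (-1 : ℤ) ^ (p + 1) * cochSign n (p + 1) := by
      rw [cochSign_succ, Units.val_mul, negOnePow_natCast]
    have e3 : (((n - (p + 1 : ℕ)).negOnePow : ℤˣ) : ℤ) =
        (n.negOnePow : ℤˣ) * (-1 : ℤ) ^ (p + 1) := by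
      rw [Int.negOnePow_sub, Units.val_mul, negOnePow_natCast]
    have h := QuasiFree.freeι_d (A := A) (A.tpow (p + 1)) t
    have h' := QuasiFree.barD_freeι (A := A) p t
    rw [cochH_apply, act_restrictFun hF, cochV_apply, restrictFun_apply, restrictFun_apply,
      restrictFun_apply, homD_apply, nbar_d_succ, h, h', e3, map_zsmul, map_add, map_zsmul]
    change _ = (cochSign (n + 1) (p + 1) : ℤ) • (A.d _ - ((n.negOnePow : ℤˣ) : ℤ) • (F _ +
      (-1 : ℤ) ^ (p + 1) • F _))
    exact smul_add_smul_sub_smul e1 e2 _ _ _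

theorem extendFun_restrictCochain {n : ℤ} (F : homGr A.nbar (self A) n) :
    extendFun (A.restrictCochain n F) = F.1 := by
  refine LinearMap.ext fun x => ?_
  induction x using nbar_induction with
  | zero => simp only [map_zero]
  | add x y hx hy => rw [map_add, map_add, hx, hy]
  | mk p z =>
    have h := act_restrictFun F.2 p z
    rw [extendFun_col]
    refine (congrArg _ h).trans ?_
    rw [smul_smul, cochSign_mul_self, one_smul]

theorem restrictFun_extendFun {n : ℤ} (f : A.cochainGr n) :
    A.restrictFun n (extendFun f) = f.1 := by
  refine funext fun p => LinearMap.ext fun t => ?_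
  rw [restrictFun_apply, extendFun_col, smul_smul, cochSign_mul_self, one_smul, freeι_apply,
    act_tmul, A.tw_one_elem, one_mul, mul_one]

/-- The linear isomorphism between bimodule maps out of the normalized bar resolution and
Hochschild cochains. -/
noncomputable def restrictEquiv (A : DGAlgebra k) (n : ℤ) :
    homGr A.nbar (self A) n ≃ₗ[k] A.cochainGr n :=
  { A.restrictCochain n with
    invFun := fun f => ⟨extendFun f, extendFun_mem f⟩
    left_inv := fun F => Subtype.ext (extendFun_restrictCochain F)
    right_inv := fun f => Subtype.ext (restrictFun_extendFun f) }

/-- The isomorphism between `Hom_{Aᵉ}(-, A)` of the normalized bar resolution and the Hochschild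
cochain complex. -/
noncomputable def restrictIso (A : DGAlgebra k) :
    homComplex A.nbar (self A) ≅ A.hochschildCochains :=
  HomologicalComplex.Hom.isoOfComponents
    (fun n => LinearEquiv.toModuleIso (X₁ := homGr A.nbar (self A) n) (X₂ := A.cochainGr n)
      (A.restrictEquiv n)) (by
    rintro i _ rfl
    rw [homComplex_d _ _ rfl]
    have h : A.hochschildCochains.d i (i + 1) =
        ModuleCat.ofHom (X := A.cochainGr i) (Y := A.cochainGr (i + 1)) (A.cochD i) :=
      CochainComplex.of_d (fun n => ModuleCat.of k (A.cochainGr n))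
        (fun n => ModuleCat.ofHom (A.cochD n)) i
    rw [h]
    exact ModuleCat.hom_ext (LinearMap.ext fun (F : homGr A.nbar (self A) i) =>
      Subtype.ext (cochFun_restrictFun F.2)))

/-- A retraction of the normalized bar resolution onto `S` induces a homotopy equivalence between
the Hochschild cochains and `Hom_{Aᵉ}(S, A)`. -/
theorem nonempty_homotopyEquiv_cochains {S : DGBimod A} (R : Retract S A.nbar) :
    Nonempty (HomotopyEquiv A.hochschildCochains (homComplex S (self A))) :=
  (nonempty_homotopyEquiv_homComplex R (self A)).map (HomotopyEquiv.ofIso A.restrictIso.symm).trans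

end DGAlgebra

end DGHoch

/-! ### The retractions and homotopy equivalences for a quasi-free algebra -/

theorem mainTheorem8 {k : Type u} [Field k] (B : DGHoch.DGAlgebra k)
    (hB : ∀ n : ℤ, n < 0 → B.gr n = ⊥) (Q : DGHoch.QuasiFree B) :
    (∃ R : DGHoch.DGBimod.Retract Q.small B.bar,
      (∀ x : B.barCol 0, R.π.toLin (DGHoch.DGBimod.col B.barCol 0 x) =
        DGHoch.DGBimod.col Q.smallCol 0 x) ∧
      (∀ (n : ℕ) (v : Fin n → Q.V),
        R.π.toLin (DGHoch.DGBimod.col B.barCol 1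
          ((1 : B) ⊗ₜ[k] (((List.ofFn fun i => (v i : B)).prod ⊗ₜ[k] (1 : k)) ⊗ₜ[k] (1 : B)))) =
        ∑ i : Fin n, DGHoch.DGBimod.col Q.smallCol 1
          (((List.ofFn fun j => (v j : B)).take i).prod ⊗ₜ[k]
            (v i ⊗ₜ[k] ((List.ofFn fun j => (v j : B)).drop (i + 1)).prod))) ∧
      (∀ (p : ℕ) (x : B.barCol (p + 2)), R.π.toLin (DGHoch.DGBimod.col B.barCol (p + 2) x) = 0)) ∧
    (∃ R : DGHoch.DGBimod.Retract Q.small B.nbar,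
      (∀ x : B.barCol 0, R.π.toLin (DGHoch.DGBimod.col B.nbarCol 0 (B.nbarMk 0 x)) =
        DGHoch.DGBimod.col Q.smallCol 0 x) ∧
      (∀ (n : ℕ) (v : Fin n → Q.V),
        R.π.toLin (DGHoch.DGBimod.col B.nbarCol 1 (B.nbarMk 1
          ((1 : B) ⊗ₜ[k] (((List.ofFn fun i => (v i : B)).prod ⊗ₜ[k] (1 : k)) ⊗ₜ[k] (1 : B))))) =
        ∑ i : Fin n, DGHoch.DGBimod.col Q.smallCol 1
          (((List.ofFn fun j => (v j : B)).take i).prod ⊗ₜ[k]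
            (v i ⊗ₜ[k] ((List.ofFn fun j => (v j : B)).drop (i + 1)).prod))) ∧
      (∀ (p : ℕ) (x : B.nbarCol (p + 2)),
        R.π.toLin (DGHoch.DGBimod.col B.nbarCol (p + 2) x) = 0)) ∧
    Nonempty (HomotopyEquiv B.hochschildChains.toComplex Q.forms.toComplex) ∧
    Nonempty (HomotopyEquiv B.hochschildCochains Q.fields) := by
  obtain ⟨R, hπ, hR⟩ := Q.exists_retract_bar hB
  obtain ⟨R', hR'⟩ := DGHoch.QuasiFree.exists_retract_nbar R
    (fun x hx => by rw [hπ]; exact Q.projLin_barDegenTotal x hx) hR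
  have h0 : ∀ x : B.barCol 0, R.π.toLin (DGHoch.DGBimod.col B.barCol 0 x) =
      DGHoch.DGBimod.col Q.smallCol 0 x := fun x => by rw [hπ]; exact Q.projLin_zero x
  have h2 : ∀ (p : ℕ) (x : B.barCol (p + 2)),
      R.π.toLin (DGHoch.DGBimod.col B.barCol (p + 2) x) = 0 := fun p x => by
    rw [hπ]; exact Q.projLin_add_two p x
  refine ⟨⟨R, h0, fun n v => ?_, h2⟩, ⟨R', fun x => ?_, fun n v => ?_, fun p x => ?_⟩,
    DGHoch.DGAlgebra.nonempty_homotopyEquiv_chains R',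
    DGHoch.DGAlgebra.nonempty_homotopyEquiv_cochains R'⟩
  · rw [hπ]
    exact Q.projLin_prod n v
  · rw [← DGHoch.DGAlgebra.barToNbar_col, hR', h0]
  · rw [← DGHoch.DGAlgebra.barToNbar_col, hR', hπ]
    exact Q.projLin_prod n v
  · obtain ⟨z, rfl⟩ := (Submodule.span k (B.barDegen (p + 2))).mkQ_surjective x
    have h := DGHoch.DGAlgebra.barToNbar_col (A := B) (p + 2) z
    exact (congrArg R'.π.toLin h).symm.trans ((hR' _).trans (h2 p z))
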